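/- Let $n\ge 0$ and let $\mathcal L_n$ be the following many-sorted first-order language. The sorts are $K$, $M$ and $G^i$ for $i>0$. The symbols are: $+,\cdot,0,1$ on $K$; $+,0$ on $M$; a map $\cdot\colon K\times M\to M$; for each $i>0$, maps $\pi_i\colon K^{i^2}\to G^i$ and $D_i\colon M^i\to G^i$; maps $T_1,\dots,T_n\colon M\to M$; and, for every quantifier free formula $\varphi$ in the language of fields $(+,\cdot,0,1)$ with a partition $\tilde\varphi$ of its variables into sets of sizes $k_1^2,\dots,k_m^2,l$, a predicate $P_{\tilde\varphi}$ on $G^{k_1}\times\dots\times G^{k_m}\times K^l$. Let $I$ be an ideal of $\mathbb Z[T_1,\dots,T_n]$. Consider the theory $\mathfrak T=\mathfrak T_I$ in $\mathcal L_n$ which says: - $K$ is a field and $M$ is a vector space over $K$; - $\pi_i$ is surjective, and $\pi_i(X)=\pi_i(Y)$ if and only if the rows of the $i\times i$ matrices $X$ and $Y$ span the same subspace of $K^i$ (so $G^i$ is the set of linear subspaces of $K^i$); - $P_{\tilde\varphi}(p_1,\dots,p_m,\bar x)$ holds if and only if there are matrices $X_j$ with $\pi_{k_j}(X_j)=p_j$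 for all $j$ and $\varphi(X_1,\dots,X_m,\bar x)$; - $D_i(v_1,\dots,v_i)$ is the subspace of all $\bar x\in K^i$ with $\sum_a x_a v_a=0$; - $T_1,\dots,T_n$ are pairwise commuting linear operators on $M$, and $p(T_1,\dots,T_n)=0$ for every $p\in I$. For a model of $\mathfrak T$, put $\mathbb A=K[T_1,\dots,T_n]/\hat I$, where $\hat I$ is the ideal generated by $I$; then $M$ is an $\mathbb A$-module. Consider the models of $\mathfrak T$ in which $K$ is algebraically closed and the following condition holds: for all $f_1,\dots,f_m,g_1,\dots,g_k\in\mathbb A$ and all $v_1,\dots,v_m,u_1,\dots,u_r\in M$, if no $g_j$ lies in the ideal $(f_1,\dots,f_m)$ of $\mathbb A$, and if for all $t_1,\dots,t_m\in\mathbb A$ the relation $\sum_i t_if_i=0$ implies $\sum_i t_iv_i=0$, then there is $x\in M$ such that $f_ix=v_i$ for all $i$, and $g_jx$ does not lie in the $K$-linear span of $u_1,\dots,u_r$ for any $j$. Theorem. The class of models of $\mathfrak T$ that satisfy these two requirements is the class of all models of a first-order theory $\tilde{\mathfrak T}\supseteq\mathfrak T$ in $\mathcal L_n$, and $\tilde{\mathfrak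 T}$ eliminates quantifiers: modulo $\tilde{\mathfrak T}$, every $\mathcal L_n$-formula is equivalent to a quantifier free $\mathcal L_n$-formula in the same free variables. -/

import Mathlib

universe u

/-! ### Many-sorted first-order logic -/

/-- A many-sorted first-order language. Every symbol has a finite type of argument places, each
argument place has a sort, and function symbols have a target sort. -/
structure MSLanguage where
  /-- the sorts -/
  Srt : Type
  /-- the function symbols -/
  Fun : Type
  /-- the argument places of a function symbol -/
  arity : Fun → Type
  arity_finite : ∀ f, Finite (arity f)
  /-- the sorts of the arguments of a function symbol -/
  dom : (f : Fun) → arity f → Srt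
  /-- the sort of the value of a function symbol -/
  cod : Fun → Srt
  /-- the relation symbols -/
  Rel : Type
  /-- the argument places of a relation symbol -/
  relArity : Rel → Type
  relArity_finite : ∀ r, Finite (relArity r)
  /-- the sorts of the arguments of a relation symbol -/
  relDom : (r : Rel) → relArity r → Srt

namespace MSLanguage

/-- `Var Γ s` is the type of variables of sort `s` among a finite list `Γ` of sorted variables. -/
inductive Var {S : Type} : List S → S → Type
  | zero {Γ : List S} {s : S} : Var (s :: Γ) s
  | succ {Γ : List S} {s t : S} : Var Γ s → Var (t :: Γ) s

/-- Terms of sort `s` in the variables `Γ`. -/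
inductive Term (L : MSLanguage) (Γ : List L.Srt) : L.Srt → Type
  | var {s : L.Srt} (x : Var Γ s) : Term L Γ s
  | func (f : L.Fun) (ts : (a : L.arity f) → Term L Γ (L.dom f a)) : Term L Γ (L.cod f)

/-- First-order formulas whose free variables are among `Γ`. The other connectives and the
existential quantifier are the usual abbreviations. -/
inductive Formula (L : MSLanguage) : List L.Srt → Type
  | falsum {Γ : List L.Srt} : Formula L Γ
  | equal {Γ : List L.Srt} {s : L.Srt} (t₁ t₂ : Term L Γ s) : Formula L Γ
  | rel {Γ : List L.Srt} (r : L.Rel) (ts : (a : L.relArity r) → Term L Γ (L.relDom r a)) :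
      Formula L Γ
  | imp {Γ : List L.Srt} (φ ψ : Formula L Γ) : Formula L Γ
  | all {Γ : List L.Srt} (s : L.Srt) (φ : Formula L (s :: Γ)) : Formula L Γ

/-- A formula without quantifiers. -/
def Formula.IsQF {L : MSLanguage} : {Γ : List L.Srt} → Formula L Γ → Prop
  | _, .falsum => True
  | _, .equal _ _ => True
  | _, .rel _ _ => True
  | _, .imp φ ψ => φ.IsQF ∧ ψ.IsQF
  | _, .all _ _ => False

/-- A structure for a many-sorted language. -/
structure Str (L : MSLanguage) where
  /-- the set of elements of each sort -/
  carrier : L.Srt → Type u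
  /-- the interpretation of function symbols -/
  funMap : (f : L.Fun) → ((a : L.arity f) → carrier (L.dom f a)) → carrier (L.cod f)
  /-- the interpretation of relation symbols -/
  relMap : (r : L.Rel) → ((a : L.relArity r) → carrier (L.relDom r a)) → Prop

/-- An assignment of values in `N` to the variables `Γ`. -/
def Env {L : MSLanguage} (N : Str.{u} L) (Γ : List L.Srt) : Type u :=
  (s : L.Srt) → Var Γ s → N.carrier s

/-- The assignment on no variables. -/
def Env.nil {L : MSLanguage} {N : Str.{u} L} : Env N [] := fun _ x => nomatch x

/-- Extension of an assignment by a value for one new variable. -/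
def Env.cons {L : MSLanguage} {N : Str.{u} L} {Γ : List L.Srt} {s : L.Srt} (a : N.carrier s)
    (e : Env N Γ) : Env N (s :: Γ)
  | _, .zero => a
  | _, .succ x => e _ x

/-- The value of a term. -/
def Term.realize {L : MSLanguage} {N : Str.{u} L} {Γ : List L.Srt} (e : Env N Γ) :
    {s : L.Srt} → Term L Γ s → N.carrier s
  | _, .var x => e _ x
  | _, .func f ts => N.funMap f fun a => (ts a).realize e

/-- The truth of a formula. -/
def Formula.Realize {L : MSLanguage} {N : Str.{u} L} :
    {Γ : List L.Srt} → Formula L Γ → Env N Γ → Prop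
  | _, .falsum, _ => False
  | _, .equal t₁ t₂, e => t₁.realize e = t₂.realize e
  | _, .rel r ts, e => N.relMap r fun a => (ts a).realize e
  | _, .imp φ ψ, e => φ.Realize e → ψ.Realize e
  | _, .all s φ, e => ∀ a : N.carrier s, φ.Realize (Env.cons a e)

/-- A theory is a set of sentences. -/
abbrev Thy (L : MSLanguage) : Type := Set (Formula L [])

/-- `N` is a model of `T`. -/
def Str.Models {L : MSLanguage} (N : Str.{u} L) (T : Thy L) : Prop :=
  ∀ σ ∈ T, σ.Realize (Env.nil : Env N [])

/-- `T` eliminates quantifiers: modulo `T`, every formula (sentences included) is equivalent to a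
quantifier free formula in the same free variables. -/
def Thy.EliminatesQuantifiers {L : MSLanguage} (T : Thy L) : Prop :=
  ∀ (Γ : List L.Srt) (φ : Formula L Γ), ∃ ψ : Formula L Γ, ψ.IsQF ∧
    ∀ N : Str.{u} L, N.Models T → ∀ e : Env N Γ, φ.Realize e ↔ ψ.Realize e

end MSLanguage

/-! ### The language of modules with Grassmannian sorts -/

namespace GrassModule

open MSLanguage

/-- Function symbols of the language of fields `(+, ·, 0, 1)`. -/
inductive FieldFun : ℕ → Type
  | zero : FieldFun 0
  | one : FieldFun 0
  | add : FieldFun 2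
  | mul : FieldFun 2

/-- The (one-sorted) language of fields `(+, ·, 0, 1)`. -/
abbrev fieldLang : FirstOrder.Language.{0, 0} := ⟨FieldFun, fun _ => Empty⟩

/-- A field as a structure for the language of fields. -/
@[reducible]
def fieldStructure (F : Type u) [Field F] : fieldLang.Structure F where
  funMap
    | FieldFun.zero, _ => 0
    | FieldFun.one, _ => 1
    | FieldFun.add, x => x 0 + x 1
    | FieldFun.mul, x => x 0 * x 1
  RelMap r _ := nomatch r

/-- The sorts: the field `K`, the module `M`, and the Grassmannians `G i` for `i > 0`. -/
inductive Srt
  | K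
  | M
  | G (i : ℕ+)

/-- Function symbols: the field operations, addition and zero of `M`, scalar multiplication,
`π i : K ^ (i ^ 2) → G i`, `D i : M ^ i → G i`, and the `n` operators on `M`. -/
inductive Fun (n : ℕ)
  | kadd
  | kmul
  | kzero
  | kone
  | madd
  | mzero
  | smul
  | π (i : ℕ+)
  | D (i : ℕ+)
  | op (j : Fin n)

/-- Argument places of the function symbols; those of `π i` form an `i × i` matrix. -/
abbrev Fun.arity {n : ℕ} : Fun n → Type
  | kadd => Fin 2
  | kmul => Fin 2
  | kzero => Fin 0
  | kone => Fin 0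
  | madd => Fin 2
  | mzero => Fin 0
  | smul => Fin 2
  | π i => Fin i × Fin i
  | D i => Fin i
  | op _ => Fin 1

/-- Sorts of the arguments of the function symbols. -/
abbrev Fun.dom {n : ℕ} : (f : Fun n) → f.arity → Srt
  | kadd, _ => .K
  | kmul, _ => .K
  | kzero, _ => .K
  | kone, _ => .K
  | madd, _ => .M
  | mzero, _ => .M
  | smul, 0 => .K
  | smul, 1 => .M
  | π _, _ => .K
  | D _, _ => .M
  | op _, _ => .M

/-- Sorts of the values of the function symbols. -/
abbrev Fun.cod {n : ℕ} : Fun n → Srt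
  | kadd => .K
  | kmul => .K
  | kzero => .K
  | kone => .K
  | madd => .M
  | mzero => .M
  | smul => .M
  | π i => .G i
  | D i => .G i
  | op _ => .M

/-- Relation symbols `P φ`, on `G k₁ × ⋯ × G kₘ × K ^ l`: a quantifier free formula `φ` in the
language of fields, whose variables are partitioned into `kⱼ × kⱼ` matrices, for `1 ≤ j ≤ m`, and
`l` further variables. -/
structure Rel where
  /-- the number of Grassmannian arguments -/
  m : ℕ
  /-- the sorts of the Grassmannian arguments -/
  k : Fin m → ℕ+
  /-- the number of field arguments -/
  l : ℕ
  /-- the field formula -/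
  φ : fieldLang.Formula ((Σ j : Fin m, Fin (k j) × Fin (k j)) ⊕ Fin l)
  isQF : φ.IsQF

/-- Sorts of the arguments of `P φ`. -/
abbrev Rel.dom (r : Rel) : Fin r.m ⊕ Fin r.l → Srt
  | .inl j => .G (r.k j)
  | .inr _ => .K

/-- The truth of the formula `φ` at matrices `Xⱼ` and field elements `x`. -/
def Rel.Holds (r : Rel) {F : Type u} [Field F]
    (X : (j : Fin r.m) → Fin (r.k j) × Fin (r.k j) → F) (x : Fin r.l → F) : Prop :=
  letI := fieldStructure F
  r.φ.Realize (Sum.elim (fun ja => X ja.1 ja.2) x)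

/-- The language `𝓛ₙ`. -/
abbrev lang (n : ℕ) : MSLanguage where
  Srt := Srt
  Fun := Fun n
  arity := Fun.arity
  arity_finite f := by cases f <;> infer_instance
  dom := Fun.dom
  cod := Fun.cod
  Rel := Rel
  relArity r := Fin r.m ⊕ Fin r.l
  relArity_finite _ := inferInstance
  relDom := Rel.dom

section Interpretations

variable {n : ℕ} (N : Str.{u} (lang n))

/-- The field sort. -/
abbrev K : Type u := N.carrier Srt.K

/-- The module sort. -/
abbrev M : Type u := N.carrier Srt.M

/-- The Grassmannian sorts. -/
abbrev G (i : ℕ+) : Type u := N.carrier (Srt.G i)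

/-- Interpretation of addition on `K`. -/
def kadd (x y : K N) : K N := N.funMap Fun.kadd fun a : Fin 2 => if a = 0 then x else y

/-- Interpretation of multiplication on `K`. -/
def kmul (x y : K N) : K N := N.funMap Fun.kmul fun a : Fin 2 => if a = 0 then x else y

/-- Interpretation of `0` on `K`. -/
def kzero : K N := N.funMap Fun.kzero fun a : Fin 0 => a.elim0

/-- Interpretation of `1` on `K`. -/
def kone : K N := N.funMap Fun.kone fun a : Fin 0 => a.elim0

/-- Interpretation of addition on `M`. -/
def madd (v w : M N) : M N := N.funMap Fun.madd fun a : Fin 2 => if a = 0 then v else w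

/-- Interpretation of `0` on `M`. -/
def mzero : M N := N.funMap Fun.mzero fun a : Fin 0 => a.elim0

/-- Interpretation of scalar multiplication. -/
def smul (x : K N) (v : M N) : M N :=
  N.funMap Fun.smul fun a : Fin 2 => match a with
    | 0 => x
    | 1 => v

/-- Interpretation of `π i`. -/
def proj {i : ℕ+} (X : Fin i × Fin i → K N) : G N i := N.funMap (Fun.π i) X

/-- Interpretation of `D i`. -/
def dep {i : ℕ+} (v : Fin i → M N) : G N i := N.funMap (Fun.D i) v

/-- Interpretation of the operators. -/
def op (j : Fin n) (v : M N) : M N := N.funMap (Fun.op j) fun _ : Fin 1 => v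

/-- Interpretation of `P φ`. -/
def pred (r : Rel) (p : (j : Fin r.m) → G N (r.k j)) (x : Fin r.l → K N) : Prop :=
  N.relMap r fun a => match a with
    | .inl j => p j
    | .inr b => x b

end Interpretations

/-! ### Algebra -/

/-- The subspace of `F ^ i` spanned by the rows of an `i × i` matrix. -/
def rowSpan {F : Type u} [Field F] {i : ℕ+} (X : Fin i × Fin i → F) :
    Submodule F (Fin i → F) :=
  Submodule.span F (Set.range fun a : Fin i => fun b : Fin i => X (a, b))

/-- The subspace of `F ^ i` of linear relations `∑ xₐ vₐ = 0` among `v₁, …, vᵢ`. -/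
def relations {F V : Type u} [Field F] [AddCommGroup V] [Module F V] {i : ℕ+}
    (v : Fin i → V) : Submodule F (Fin i → F) where
  carrier := {x | ∑ a, x a • v a = 0}
  zero_mem' := by simp
  add_mem' {x y} hx hy := by
    simp only [Set.mem_ofPred_eq] at hx hy ⊢
    simp [add_smul, Finset.sum_add_distrib, hx, hy]
  smul_mem' c x hx := by
    simp only [Set.mem_ofPred_eq] at hx ⊢
    simp [mul_smul, ← Finset.smul_sum, hx]

/-- Substitution of pairwise commuting linear operators for the variables of a polynomial. -/
noncomputable def evalOps {F V : Type u} [Field F] [AddCommGroup V] [Module F V] {n : ℕ}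
    (T : Fin n → Module.End F V) (hT : ∀ i j, Commute (T i) (T j)) :
    MvPolynomial (Fin n) F →ₐ[F] Module.End F V :=
  letI : CommSemiring (Algebra.adjoin F (Set.range T)) :=
    { (inferInstance : Semiring (Algebra.adjoin F (Set.range T))) with
      mul_comm := (Algebra.isMulCommutative_adjoin F (by
        rintro _ ⟨i, rfl⟩ _ ⟨j, rfl⟩
        exact hT i j)).is_comm.comm }
  (Algebra.adjoin F (Set.range T)).val.comp
    (MvPolynomial.aeval fun i =>
      (⟨T i, Algebra.subset_adjoin ⟨i, rfl⟩⟩ : Algebra.adjoin F (Set.range T)))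

/-- The ideal `Î` of `F[T₁, …, Tₙ]` generated by an ideal `I` of `ℤ[T₁, …, Tₙ]`. -/
noncomputable def extIdeal (F : Type u) [Field F] {n : ℕ} (I : Ideal (MvPolynomial (Fin n) ℤ)) :
    Ideal (MvPolynomial (Fin n) F) :=
  I.map (MvPolynomial.map (Int.castRingHom F))

/-- The algebra `𝔸 = F[T₁, …, Tₙ] / Î`. -/
abbrev Alg (F : Type u) [Field F] {n : ℕ} (I : Ideal (MvPolynomial (Fin n) ℤ)) : Type u :=
  MvPolynomial (Fin n) F ⧸ extIdeal F I

/-! ### The theories -/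

/-- The axioms of `𝔗_I`: the (uniquely determined) field and vector space structures on the sorts
of `N`, and the properties of `N` that the axioms express. -/
structure TModel {n : ℕ} (I : Ideal (MvPolynomial (Fin n) ℤ)) (N : Str.{u} (lang n)) where
  /-- `K` is a field -/
  [field : Field (K N)]
  /-- `M` is an abelian group -/
  [addCommGroup : AddCommGroup (M N)]
  /-- `M` is a vector space over `K` -/
  [module : Module (K N) (M N)]
  kadd_eq (x y : K N) : kadd N x y = x + y
  kmul_eq (x y : K N) : kmul N x y = x * y
  kzero_eq : kzero N = 0
  kone_eq : kone N = 1
  madd_eq (v w : M N) : madd N v w = v + w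
  mzero_eq : mzero N = 0
  smul_eq (x : K N) (v : M N) : smul N x v = x • v
  /-- `π i` is surjective -/
  proj_surjective (i : ℕ+) (p : G N i) : ∃ X, proj N X = p
  /-- `π i` identifies matrices whose rows span the same subspace -/
  proj_eq_iff (i : ℕ+) (X Y : Fin i × Fin i → K N) :
    proj N X = proj N Y ↔ rowSpan X = rowSpan Y
  /-- `P φ` is the set induced by `φ` on the Grassmannians -/
  pred_iff (r : Rel) (p : (j : Fin r.m) → G N (r.k j)) (x : Fin r.l → K N) :
    pred N r p x ↔
      ∃ X : (j : Fin r.m) → Fin (r.k j) × Fin (r.k j) → K N,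
        r.Holds X x ∧ ∀ j, proj N (X j) = p j
  /-- `D i v` is the space of linear relations among `v` -/
  dep_eq_iff (i : ℕ+) (v : Fin i → M N) (X : Fin i × Fin i → K N) :
    dep N v = proj N X ↔ rowSpan X = relations v
  /-- the operators are linear -/
  T : Fin n → Module.End (K N) (M N)
  op_eq (j : Fin n) (v : M N) : op N j v = T j v
  /-- the operators commute -/
  commute (i j : Fin n) : Commute (T i) (T j)
  /-- the polynomials in `I` act as zero -/
  ideal_eq_zero (p : MvPolynomial (Fin n) ℤ) (hp : p ∈ I) :
    evalOps T commute (MvPolynomial.map (Int.castRingHom (K N)) p) = 0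

namespace TModel

variable {n : ℕ} {I : Ideal (MvPolynomial (Fin n) ℤ)} {N : Str.{u} (lang n)}

/-- The action of `𝔸` on `M`. -/
noncomputable def act (d : TModel I N) :
    letI := d.field; letI := d.addCommGroup; letI := d.module
    Alg (K N) I →ₐ[K N] Module.End (K N) (M N) :=
  letI := d.field; letI := d.addCommGroup; letI := d.module
  Ideal.Quotient.liftₐ (extIdeal (K N) I) (evalOps d.T d.commute) (by
    have h : extIdeal (K N) I ≤ RingHom.ker (evalOps d.T d.commute) := by
      refine Ideal.map_le_iff_le_comap.2 fun p hp => ?_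
      exact d.ideal_eq_zero p hp
    exact fun a ha => h ha)

/-- The solvability condition: if no `gⱼ` lies in the ideal `(f₁, …, fₘ)` of `𝔸`, and every
relation `∑ tᵢ fᵢ = 0` in `𝔸` implies `∑ tᵢ vᵢ = 0`, then some `x` satisfies `fᵢ x = vᵢ` for all
`i`, and `gⱼ x ∉ ⟨u₁, …, uᵣ⟩` for all `j`. -/
def Solvable (d : TModel I N) : Prop :=
  letI := d.field; letI := d.addCommGroup; letI := d.module
  ∀ (m k r : ℕ) (f : Fin m → Alg (K N) I) (g : Fin k → Alg (K N) I)
    (v : Fin m → M N) (u : Fin r → M N),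
    (∀ j, g j ∉ Ideal.span (Set.range f)) →
    (∀ t : Fin m → Alg (K N) I, ∑ i, t i * f i = 0 → ∑ i, d.act (t i) (v i) = 0) →
    ∃ x : M N, (∀ i, d.act (f i) x = v i) ∧
      ∀ j, d.act (g j) x ∉ Submodule.span (K N) (Set.range u)

/-- The field `K` is algebraically closed. -/
def AlgClosed (d : TModel I N) : Prop :=
  letI := d.field
  IsAlgClosed (K N)

end TModel

end GrassModule

/-! ### Uniform degree bounds for linear equations over polynomial rings -/

/-! The language sees a tuple $v$ of vectors only through the $K$-linear relations between the
vectors $T^\mu v_a$. For exponents $\mu$ of bounded degree these relations form a subspace, hence a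
point of a Grassmannian, which `D i` names. Quantifier elimination amounts to the claim that every
formula is a constructible condition on this relation space for one large degree, on matrices for
the subspace variables, and on the field variables. This is what `SG` expresses. The only hard step
is a quantifier over $M$ (`SG.exM`).

Let the rows of a matrix $X'$ be candidates for the relations of degree at most $d$ between an
unknown $x$ and $v$. Each row reads $f_i x = v'_i$, where $v'_i$ is a combination of the $T^\mu
v_a$. If such an $x$ exists, then a relation whose $x$-coefficient is $\sum t_i f_i$ modulo $\hat I$
holds if and only if a relation between the $v_a$ alone holds, and this must agree with membership
in the row space of $X'$ (`ExtCond`). Conversely, this agreement makes the system $f_i x = v'_i$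
compatible, and it then suffices that $x$ has no relations whose $x$-coefficient lies outside $(f_i)
+ \hat I$. Polynomials $t$ of all degrees seem to be needed here. Hermann's theorem removes them:
generators of syzygies and coefficients of ideal members have degrees bounded independently of the
field (`eqCoh_mvBounds`, `exists_uniform_bound`). The condition therefore concerns relations between
the $v_a$ of one fixed degree.

The vector $x$ without further relations comes from solvability (`IsSolvable.exists_independent`).
Solvability avoids only finitely many operators $g_j$ at a time, whereas a whole finite dimensional
space $W$ of operators has to be avoided. The remedy is that an ideal $q$ maximal among those
omitting $g$ has finite codimension: if $gx$ avoids the finite dimensional space generated from $U$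
by representatives of $K[T]/q$, and $qx=0$, then $hx \notin U$ for all $h \notin q$. An induction on
$\dim W$ does the rest.

Conditions on field elements are kept as constructible subsets of $\operatorname{Spec}\mathbb
Z[\alpha]$ (`FD`). Chevalley's theorem and the Nullstellensatz make them closed under quantifiers,
and they coincide with quantifier free field formulas. Formulas of the language are translated into
such conditions by `sg_realize`. They are translated back in `exists_isQF`, where `D i` of monomial
terms supplies the relation space and one predicate `P` states the condition.

Both theories consist of all sentences true in their class of structures (`thyOf`), so the models
are as desired once each defining property is a set of sentences (`Def.of_models`). For solvability
this again rests on the degree bounds, which turn ideal membership and syzygies into field formulas.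
-/

namespace UniformBounds

open Finset

/-- An exhaustion of a ring by subgroups that behave like polynomials of bounded degree. -/
structure DegFiltration (R : Type*) [CommRing R] where
  /-- the elements of degree at most `d` -/
  B : ℕ → AddSubgroup R
  mono : Monotone B
  one_mem : 1 ∈ B 0
  mul_mem {i j : ℕ} {a b : R} : a ∈ B i → b ∈ B j → a * b ∈ B (i + j)

variable {R : Type*} [CommRing R]

/-- The syzygies of the system of linear equations with coefficients `A` are generated by `N`
syzygies of degree at most `D`, and solvable systems with right hand side of degree at most `d`
have solutions of degree at most `D`. -/
def SysBound (Φ : DegFiltration R) {κ ι : Type*} [Fintype ι] (A : κ → ι → R) (d N D : ℕ) : Prop :=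
  (∃ s : Fin N → ι → R, (∀ k i, s k i ∈ Φ.B D) ∧ (∀ k l, ∑ i, s k i * A l i = 0) ∧
    ∀ t : ι → R, (∀ l, ∑ i, t i * A l i = 0) → ∃ c : Fin N → R, ∀ i, t i = ∑ k, c k * s k i) ∧
  ∀ g : κ → R, (∀ l, g l ∈ Φ.B d) → (∃ t : ι → R, ∀ l, ∑ i, t i * A l i = g l) →
    ∃ t : ι → R, (∀ i, t i ∈ Φ.B D) ∧ ∀ l, ∑ i, t i * A l i = g l

/-- Single linear equations are solvable with degree bounds `β`. -/
def EqCoh (Φ : DegFiltration R) (β : ℕ → ℕ → ℕ × ℕ) : Prop :=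
  ∀ (m d : ℕ) (f : Fin m → R), (∀ i, f i ∈ Φ.B d) →
    SysBound Φ (fun _ : Unit => f) d (β m d).1 (β m d).2

/-- Systems of linear equations are solvable with degree bounds `γ`. -/
def SysCoh (Φ : DegFiltration R) (γ : ℕ → ℕ → ℕ → ℕ × ℕ) : Prop :=
  ∀ (r m d : ℕ) (A : Fin r → Fin m → R), (∀ l i, A l i ∈ Φ.B d) →
    SysBound Φ A d (γ r m d).1 (γ r m d).2

lemma sum_mul_sum_mul {ι κ : Type*} [Fintype ι] [Fintype κ] (c : κ → R) (s : κ → ι → R)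
    (f : ι → R) : ∑ i, (∑ k, c k * s k i) * f i = ∑ k, c k * ∑ i, s k i * f i := by
  simp only [Finset.sum_mul, Finset.mul_sum]
  rw [Finset.sum_comm]
  simp only [mul_assoc]

lemma SysBound.mono {Φ : DegFiltration R} {κ ι : Type*} [Fintype ι] {A : κ → ι → R}
    {d N D D' : ℕ} (h : SysBound Φ A d N D) (hD : D ≤ D') : SysBound Φ A d N D' := by
  obtain ⟨⟨s, h1, h2⟩, h3⟩ := h
  refine ⟨⟨s, fun k i => Φ.mono hD (h1 k i), h2⟩, fun g hg ht => ?_⟩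
  obtain ⟨t, h4, h5⟩ := h3 g hg ht
  exact ⟨t, fun i => Φ.mono hD (h4 i), h5⟩

lemma SysBound.pad {Φ : DegFiltration R} {κ ι : Type*} [Fintype ι] {A : κ → ι → R}
    {d N D N' : ℕ} (h : SysBound Φ A d N D) (hN : N ≤ N') : SysBound Φ A d N' D := by
  obtain ⟨⟨s, h1, h2, h3⟩, h4⟩ := h
  obtain ⟨M, rfl⟩ := Nat.exists_eq_add_of_le hN
  refine ⟨⟨Fin.append s 0, fun k i => ?_, fun k l => ?_, fun t ht => ?_⟩, h4⟩
  · induction k using Fin.addCases with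
    | left k => simpa using h1 k i
    | right k => simp
  · induction k using Fin.addCases with
    | left k => simpa using h2 k l
    | right k => simp
  · obtain ⟨c, hc⟩ := h3 t ht
    exact ⟨Fin.append c 0, fun i => by simp [Fin.sum_univ_add, hc]⟩

/-- The degree bounds for systems that follow from those for single equations. -/
def sysBounds (β : ℕ → ℕ → ℕ × ℕ) : ℕ → ℕ → ℕ → ℕ × ℕ
  | 0, m, _ => (m, 0)
  | r + 1, m, d =>
    ((sysBounds β r (β m d).1 (d + (β m d).2)).1,
      (sysBounds β r (β m d).1 (d + (β m d).2)).2 + (β m d).2)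

/-- Elimination of one equation at a time: the solutions of the first equation are a particular
solution plus combinations of $N$ bounded syzygies. Substitution turns the other equations into a
system for the $N$ coefficients of the combination, with coefficients of degree at most $d + D$. -/
theorem EqCoh.sysCoh {Φ : DegFiltration R} {β : ℕ → ℕ → ℕ × ℕ} (h : EqCoh Φ β) :
    SysCoh Φ (sysBounds β) := by
  intro r
  induction r with
  | zero =>
    intro m d A _
    change SysBound Φ A d m 0
    refine ⟨⟨fun k i => if k = i then 1 else 0, fun k i => ?_, fun _ l => l.elim0, fun t _ =>
      ⟨t, fun i => by simp⟩⟩, fun g _ _ => ⟨0, fun _ => zero_mem _, fun l => l.elim0⟩⟩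
    dsimp only
    split_ifs
    · exact Φ.one_mem
    · exact zero_mem _
  | succ r ih =>
    intro m d A hA
    have h0 := h m d (A 0) (hA 0)
    simp only [sysBounds]
    set N := (β m d).1
    set D := (β m d).2
    obtain ⟨⟨s, hs, hs0, hs1⟩, hp⟩ := h0
    have hdD (l : Fin r) (k : Fin N) : ∑ i, s k i * A l.succ i ∈ Φ.B (d + D) :=
      sum_mem fun i _ => by rw [add_comm]; exact Φ.mul_mem (hs k i) (hA _ i)
    obtain ⟨⟨s', hs', hs0', hs1'⟩, hp'⟩ := ih N (d + D) (fun l k => ∑ i, s k i * A l.succ i) hdD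
    refine ⟨⟨fun j i => ∑ k, s' j k * s k i, fun j i => ?_, fun j l => ?_, fun t ht => ?_⟩,
      fun g hg ht => ?_⟩
    · exact sum_mem fun k _ => Φ.mul_mem (hs' j k) (hs k i)
    · rw [sum_mul_sum_mul]
      induction l using Fin.cases with
      | zero => simp [hs0 _ ()]
      | succ l => exact hs0' j l
    · obtain ⟨c, hc⟩ := hs1 t fun _ => ht 0
      obtain ⟨c', hc'⟩ := hs1' c fun l => by
        rw [← ht l.succ, ← sum_mul_sum_mul]
        simp only [hc]
      refine ⟨c', fun i => ?_⟩
      rw [hc]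
      simp only [hc']
      rw [sum_mul_sum_mul]
    · obtain ⟨t, ht⟩ := ht
      obtain ⟨t₀, ht₀, ht₀'⟩ := hp (fun _ => g 0) (fun _ => hg 0) ⟨t, fun _ => ht 0⟩
      obtain ⟨c, hc⟩ := hs1 (t - t₀) fun _ => by
        simp [sub_mul, Finset.sum_sub_distrib, ht, ht₀' ()]
      obtain ⟨c', hc', hc''⟩ := hp' (fun l => g l.succ - ∑ i, t₀ i * A l.succ i) (fun l => by
          refine sub_mem (Φ.mono (Nat.le_add_right _ _) (hg _)) (sum_mem fun i _ => ?_)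
          rw [add_comm]; exact Φ.mul_mem (ht₀ i) (hA _ i)) ⟨c, fun l => by
          rw [← sum_mul_sum_mul, ← ht]
          simp only [← hc]
          simp [sub_mul, Finset.sum_sub_distrib]⟩
      refine ⟨fun i => t₀ i + ∑ k, c' k * s k i, fun i => ?_, fun l => ?_⟩
      · exact add_mem (Φ.mono (Nat.le_add_left _ _) (ht₀ i))
          (sum_mem fun k _ => Φ.mul_mem (hc' k) (hs k i))
      · simp only [add_mul, Finset.sum_add_distrib]
        rw [sum_mul_sum_mul]
        induction l using Fin.cases with
        | zero => simp [hs0 _ (), ht₀' ()]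
        | succ l => rw [hc'']; ring

lemma SysBound.reindex {Φ : DegFiltration R} {κ κ' ι ι' : Type*} [Fintype ι] [Fintype ι']
    (e : ι' ≃ ι) (e' : κ' ≃ κ) {A : κ → ι → R} {d N D : ℕ}
    (h : SysBound Φ (fun k i => A (e' k) (e i)) d N D) : SysBound Φ A d N D := by
  obtain ⟨⟨s, h1, h2, h3⟩, h4⟩ := h
  refine ⟨⟨fun k i => s k (e.symm i), fun k i => h1 _ _, fun k l => ?_, fun t ht => ?_⟩,
    fun g hg ht => ?_⟩
  · rw [← h2 k (e'.symm l), ← e.sum_comp]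
    simp
  · obtain ⟨c, hc⟩ := h3 (fun i => t (e i)) fun l => by
      rw [← ht (e' l), ← e.sum_comp]
    exact ⟨c, fun i => by simp [← hc]⟩
  · obtain ⟨t, ht⟩ := ht
    obtain ⟨t', h5, h6⟩ := h4 (fun l => g (e' l)) (fun l => hg _) ⟨fun i => t (e i), fun l => by
      rw [← ht (e' l), ← e.sum_comp]⟩
    refine ⟨fun i => t' (e.symm i), fun i => h5 _, fun l => ?_⟩
    have := h6 (e'.symm l)
    rw [Equiv.apply_symm_apply] at this
    rw [← this, ← e.sum_comp]
    simp

theorem SysCoh.fintype {Φ : DegFiltration R} {γ : ℕ → ℕ → ℕ → ℕ × ℕ} (h : SysCoh Φ γ)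
    {κ ι : Type*} [Fintype κ] [Fintype ι] {d : ℕ} {A : κ → ι → R} (hA : ∀ l i, A l i ∈ Φ.B d) :
    SysBound Φ A d (γ (Fintype.card κ) (Fintype.card ι) d).1
      (γ (Fintype.card κ) (Fintype.card ι) d).2 :=
  SysBound.reindex (Fintype.equivFin ι).symm (Fintype.equivFin κ).symm (h _ _ _ _ fun _ _ => hA _ _)

/-! ### From systems over `R` to one equation over `R[X]` -/

section Polynomial

open Polynomial

/-- Polynomials of degree at most `d` with coefficients of degree at most `d`. -/
def DegFiltration.polynomial (Φ : DegFiltration R) : DegFiltration R[X] where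
  B d :=
    { carrier := {p | p.natDegree ≤ d ∧ ∀ k, p.coeff k ∈ Φ.B d}
      zero_mem' := by simp
      add_mem' := fun {p q} hp hq =>
        ⟨(natDegree_add_le _ _).trans (max_le hp.1 hq.1), fun k => by
          rw [coeff_add]; exact add_mem (hp.2 k) (hq.2 k)⟩
      neg_mem' := fun {p} hp => ⟨by simpa using hp.1, fun k => by simpa using hp.2 k⟩ }
  mono i j hij p hp := ⟨hp.1.trans hij, fun k => Φ.mono hij (hp.2 k)⟩
  one_mem := ⟨by simp, fun k => by
    rw [coeff_one]; split_ifs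
    · exact Φ.one_mem
    · exact zero_mem _⟩
  mul_mem {i j a b} ha hb := ⟨natDegree_mul_le.trans (add_le_add ha.1 hb.1), fun k => by
    rw [coeff_mul]; exact sum_mem fun x _ => Φ.mul_mem (ha.2 _) (hb.2 _)⟩

/-- These are the Koszul syzygies $f_{i_0} e_j - f_j e_{i_0}$. They allow $t_j$ to be changed by
multiples of $f_{i_0}$ at the expense of $t_{i_0}$. -/
lemma sum_koszul_mul {ι : Type*} [Fintype ι] [DecidableEq ι] (f : ι → R[X]) (i₀ j : ι) :
    ∑ i, ((Pi.single j (f i₀) : _ → R[X]) i - (Pi.single i₀ (f j) : _ → R[X]) i) * f i = 0 := by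
  simp only [sub_mul, Finset.sum_sub_distrib, Pi.single_apply, ite_mul, zero_mul,
    Finset.sum_ite_eq', mem_univ, if_true]
  ring

/-- Division with remainder by a monic coefficient bounds the degrees of a solution. -/
lemma exists_natDegree_le_sub_koszul [Nontrivial R] {ι : Type*} [Fintype ι] [DecidableEq ι]
    (f : ι → R[X]) (i₀ : ι) (hm : (f i₀).Monic) {d : ℕ} (hf : ∀ i, (f i).natDegree ≤ d)
    (t : ι → R[X]) (ht : (∑ i, t i * f i).natDegree ≤ d) :
    ∃ (q t' : ι → R[X]), (∀ i, (t' i).natDegree ≤ 2 * d) ∧ (∑ i, t' i * f i = ∑ i, t i * f i) ∧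
      ∀ i, t i = t' i + ∑ j, q j *
        ((Pi.single j (f i₀) : _ → R[X]) i - (Pi.single i₀ (f j) : _ → R[X]) i) := by
  -- Subtraction of these multiples replaces every $t_j$ with $j \ne i_0$ by its remainder modulo
  -- $f_{i_0}$. The Koszul syzygy with index $i_0$ is zero, so its coefficient is immaterial.
  set q : ι → R[X] := fun j => if j = i₀ then 0 else t j /ₘ f i₀ with hq
  set t' : ι → R[X] := fun i => t i - ∑ j, q j *
    ((Pi.single j (f i₀) : _ → R[X]) i - (Pi.single i₀ (f j) : _ → R[X]) i)
    with ht'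
  have hsum : ∑ i, t' i * f i = ∑ i, t i * f i := by
    simp only [ht', sub_mul, Finset.sum_sub_distrib, sub_eq_self]
    rw [sum_mul_sum_mul]
    refine Finset.sum_eq_zero fun j _ => ?_
    rw [sum_koszul_mul, mul_zero]
  have hne (i : ι) (hi : i ≠ i₀) : t' i = t i %ₘ f i₀ := by
    have : ∑ j, q j * ((Pi.single j (f i₀) : _ → R[X]) i - (Pi.single i₀ (f j) : _ → R[X]) i) =
        f i₀ * (t i /ₘ f i₀) := by
      rw [Finset.sum_eq_single i]
      · simp [hq, hi, mul_comm]
      · intro j _ hj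
        simp [hj.symm, hi]
      · simp
    simp only [ht', this]
    rw [sub_eq_iff_eq_add, modByMonic_add_div]
  have hd (i : ι) (hi : i ≠ i₀) : (t' i).natDegree ≤ d := by
    rw [hne i hi]
    exact (natDegree_modByMonic_le _ hm).trans (hf i₀)
  refine ⟨q, t', fun i => ?_, hsum, fun i => by simp [ht']⟩
  by_cases hi : i = i₀
  · subst hi
    -- The remaining coordinate is controlled by the equation itself: its product with $f_{i_0}$ is
    -- a difference of polynomials of degree at most $2d$, and multiplication by a monic polynomial
    -- does not lower degrees.
    have h1 : t' i * f i = ∑ j, t j * f j - ∑ j ∈ univ.erase i, t' j * f j := by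
      rw [← hsum, eq_sub_iff_add_eq, add_comm, Finset.sum_erase_add _ _ (mem_univ i)]
    have h2 : (t' i * f i).natDegree ≤ 2 * d := by
      rw [h1]
      refine (natDegree_sub_le _ _).trans (max_le (ht.trans (by lia)) ?_)
      refine natDegree_sum_le_of_forall_le _ _ fun j hj => ?_
      refine natDegree_mul_le.trans ?_
      have := hd j (Finset.ne_of_mem_erase hj)
      have := hf j
      lia
    by_cases h0 : t' i = 0
    · simp [h0]
    · rw [mul_comm, hm.natDegree_mul' h0] at h2
      lia
  · exact (hd i hi).trans (by lia)

lemma coeff_sum_monomial {M : ℕ} (τ : Fin M → R) (k : ℕ) :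
    (∑ j : Fin M, monomial (j : ℕ) (τ j)).coeff k = if h : k < M then τ ⟨k, h⟩ else 0 := by
  rw [finsetSum_coeff]
  simp only [coeff_monomial]
  split_ifs with h
  · rw [Finset.sum_eq_single ⟨k, h⟩]
    · simp
    · intro b _ hb
      rw [if_neg]
      rintro rfl
      exact hb rfl
    · simp
  · exact Finset.sum_eq_zero fun b _ => if_neg (by have := b.2; lia)

lemma sum_monomial_mem {Φ : DegFiltration R} {M d e : ℕ} (τ : Fin M → R) (hτ : ∀ j, τ j ∈ Φ.B e)
    (hM : M ≤ d + 1) (he : e ≤ d) : ∑ j : Fin M, monomial (j : ℕ) (τ j) ∈ Φ.polynomial.B d := by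
  refine sum_mem fun j _ => ⟨(natDegree_monomial_le _).trans (by have := j.2; lia), fun k => ?_⟩
  rw [coeff_monomial]
  split_ifs
  · exact Φ.mono he (hτ j)
  · exact zero_mem _

/-- The degree bounds for one equation over `R[X]` with a monic coefficient that follow from those
for systems over `R`. -/
def polyBounds (γ : ℕ → ℕ → ℕ → ℕ × ℕ) (m d : ℕ) : ℕ × ℕ :=
  (m + (γ (3 * d + 1) (m * (2 * d + 1)) d).1, d + 2 * d + (γ (3 * d + 1) (m * (2 * d + 1)) d).2)

/-- Modulo the Koszul syzygies, unknowns of degree at most $2d$ suffice. The products then have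
degree at most $3d$, so comparison of coefficients gives $3d+1$ equations over $R$ in $m(2d+1)$
unknowns. The generating syzygies are the $m$ Koszul ones together with those lifted from $R$. -/
theorem SysCoh.polynomial [Nontrivial R] {Φ : DegFiltration R} {γ : ℕ → ℕ → ℕ → ℕ × ℕ}
    (h : SysCoh Φ γ)
    {m d : ℕ} (f : Fin m → R[X]) (hf : ∀ i, f i ∈ Φ.polynomial.B d) (i₀ : Fin m)
    (hm : (f i₀).Monic) :
    SysBound Φ.polynomial (fun _ : Unit => f) d (polyBounds γ m d).1 (polyBounds γ m d).2 := by
  classical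
  set A : Fin (3 * d + 1) → Fin m × Fin (2 * d + 1) → R := fun l ik =>
    (X ^ (ik.2 : ℕ) * f ik.1).coeff l with hA
  have hAmem (l ik) : A l ik ∈ Φ.B d := by
    simp only [hA, coeff_X_pow_mul']
    split_ifs
    · exact (hf ik.1).2 _
    · exact zero_mem _
  have hsys := h.fintype hAmem
  simp only [Fintype.card_fin, Fintype.card_prod] at hsys
  simp only [polyBounds]
  set N := (γ (3 * d + 1) (m * (2 * d + 1)) d).1
  set D := (γ (3 * d + 1) (m * (2 * d + 1)) d).2
  -- lifting vectors of coefficients to vectors of polynomials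
  set lift : (Fin m × Fin (2 * d + 1) → R) → Fin m → R[X] := fun τ i =>
    ∑ k : Fin (2 * d + 1), monomial (k : ℕ) (τ (i, k)) with hlift
  have hmul (τ : Fin m × Fin (2 * d + 1) → R) (l : ℕ) :
      (∑ i, lift τ i * f i).coeff l = ∑ ik, τ ik * (X ^ (ik.2 : ℕ) * f ik.1).coeff l := by
    simp only [hlift, finsetSum_coeff, Finset.sum_mul, Fintype.sum_prod_type]
    refine Finset.sum_congr rfl fun i _ => Finset.sum_congr rfl fun k _ => ?_
    rw [← coeff_C_mul, ← mul_assoc, C_mul_X_pow_eq_monomial]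
  have hlift_mem (τ : Fin m × Fin (2 * d + 1) → R) (hτ : ∀ j, τ j ∈ Φ.B D) (i : Fin m) :
      lift τ i ∈ Φ.polynomial.B (d + 2 * d + D) :=
    sum_monomial_mem _ (fun k => hτ _) (by lia) (by lia)
  have hunlift (t : Fin m → R[X]) (ht : ∀ i, (t i).natDegree ≤ 2 * d) :
      lift (fun ik => (t ik.1).coeff ik.2) = t := by
    funext i
    ext k
    simp only [hlift, coeff_sum_monomial]
    split_ifs with hk
    · rfl
    · exact (coeff_eq_zero_of_natDegree_lt (by have := ht i; lia)).symm
  -- Both sides have degree at most $3d$, so agreement of the first $3d+1$ coefficients is enough.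
  have hext (τ : Fin m × Fin (2 * d + 1) → R) (g : R[X]) (hg : g.natDegree ≤ d)
      (hτ : ∀ l : Fin (3 * d + 1), ∑ ik, τ ik * A l ik = g.coeff l) :
      ∑ i, lift τ i * f i = g := by
    ext l
    by_cases hl : l < 3 * d + 1
    · rw [hmul, ← hτ ⟨l, hl⟩]
    · rw [coeff_eq_zero_of_natDegree_lt (p := g) (by lia), coeff_eq_zero_of_natDegree_lt]
      refine lt_of_le_of_lt (natDegree_sum_le_of_forall_le _ _ (n := 3 * d) fun i _ => ?_) (by lia)
      refine natDegree_mul_le.trans ?_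
      have h1 : (lift τ i).natDegree ≤ 2 * d := natDegree_sum_le_of_forall_le _ _ fun k _ =>
        (natDegree_monomial_le _).trans (by have := k.2; lia)
      have := (hf i).1
      lia
  obtain ⟨⟨s, hs, hs0, hs1⟩, hp⟩ := hsys
  refine ⟨⟨Fin.append
    (fun j i => (Pi.single j (f i₀) : _ → R[X]) i - (Pi.single i₀ (f j) : _ → R[X]) i)
    (fun k => lift (s k)), fun k i => ?_, fun k _ => ?_, fun t ht => ?_⟩, fun g hg ht => ?_⟩
  · induction k using Fin.addCases with
    | left k =>
      have hmem (j : Fin m) : f j ∈ Φ.polynomial.B (d + 2 * d + D) :=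
        Φ.polynomial.mono (by lia) (hf j)
      simp only [Fin.append_left, Pi.single_apply]
      refine sub_mem ?_ ?_
      · split_ifs
        · exact hmem _
        · exact zero_mem _
      · split_ifs
        · exact hmem _
        · exact zero_mem _
    | right k =>
      simpa using hlift_mem _ (hs k) i
  · induction k using Fin.addCases with
    | left k => simp only [Fin.append_left, sum_koszul_mul]
    | right k =>
      simp only [Fin.append_right]
      exact hext _ 0 (by simp) fun l => by simpa using hs0 k l
  · obtain ⟨q, t', h1, h2, h3⟩ := exists_natDegree_le_sub_koszul f i₀ hm (fun i => (hf i).1) t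
      (by rw [ht ()]; simp)
    obtain ⟨c, hc⟩ := hs1 (fun ik => (t' ik.1).coeff ik.2) fun l => by
      rw [← hmul, hunlift _ h1, h2, ht ()]; simp
    refine ⟨Fin.append q fun k => C (c k), fun i => ?_⟩
    rw [h3, Fin.sum_univ_add]
    simp only [Fin.append_left, Fin.append_right]
    rw [add_comm]
    congr 1
    conv_lhs => rw [← hunlift t' h1]
    simp only [hlift, hc, map_sum, Finset.mul_sum, C_mul_monomial]
    rw [Finset.sum_comm]
  · obtain ⟨t, ht⟩ := ht
    obtain ⟨q, t', h1, h2, -⟩ := exists_natDegree_le_sub_koszul f i₀ hm (fun i => (hf i).1) t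
      (by rw [ht ()]; exact (hg ()).1)
    obtain ⟨τ, hτ, hτ'⟩ := hp (fun l => (g ()).coeff l) (fun l => (hg ()).2 l)
      ⟨fun ik => (t' ik.1).coeff ik.2, fun l => by
        rw [← hmul, hunlift _ h1, h2, ht ()]⟩
    exact ⟨lift τ, hlift_mem τ hτ, fun _ => hext τ _ (hg ()).1 hτ'⟩

end Polynomial

end UniformBounds

namespace UniformBounds

open Finset MvPolynomial

/-! ### Change of coordinates and of scale for the bounds -/

section Transfer

variable {R S : Type*} [CommRing R] [CommRing S]

lemma SysBound.of_ringEquiv {Φ : DegFiltration R} {Ψ : DegFiltration S} (ψ : R ≃+* S)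
    {κ ι : Type*} [Fintype ι] {A : κ → ι → R} {d e N D E : ℕ}
    (hd : ∀ a ∈ Φ.B d, ψ a ∈ Ψ.B e) (hD : ∀ a ∈ Ψ.B D, ψ.symm a ∈ Φ.B E)
    (h : SysBound Ψ (fun l i => ψ (A l i)) e N D) : SysBound Φ A d N E := by
  obtain ⟨⟨s, hs, hs0, hs1⟩, hp⟩ := h
  refine ⟨⟨fun k i => ψ.symm (s k i), fun k i => hD _ (hs k i), fun k l => ?_, fun t ht => ?_⟩,
    fun g hg ht => ?_⟩
  · apply ψ.injective
    simpa using hs0 k l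
  · obtain ⟨c, hc⟩ := hs1 (fun i => ψ (t i)) fun l => by
      rw [← map_zero ψ, ← ht l]; simp
    refine ⟨fun k => ψ.symm (c k), fun i => ψ.injective ?_⟩
    simp [hc]
  · obtain ⟨t, ht⟩ := ht
    obtain ⟨t', h1, h2⟩ := hp (fun l => ψ (g l)) (fun l => hd _ (hg l)) ⟨fun i => ψ (t i), fun l => by
      rw [← ht l]; simp⟩
    refine ⟨fun i => ψ.symm (t' i), fun i => hD _ (h1 i), fun l => ψ.injective ?_⟩
    simpa using h2 l

/-- A unit factor changes neither the syzygies nor the solvable systems. This turns a coefficient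
that is monic up to a unit into a monic one. -/
lemma SysBound.of_smul {Φ : DegFiltration R} {κ ι : Type*} [Fintype ι] {A : κ → ι → R}
    {d N D : ℕ} {u v : R} (huv : v * u = 1) (hu : u ∈ Φ.B 0)
    (h : SysBound Φ (fun l i => u * A l i) d N D) : SysBound Φ A d N D := by
  have key (t : ι → R) (l : κ) : ∑ i, t i * (u * A l i) = u * ∑ i, t i * A l i := by
    rw [Finset.mul_sum]
    exact Finset.sum_congr rfl fun i _ => by ring
  have inj {a b : R} (hab : u * a = u * b) : a = b := by
    rw [← one_mul a, ← one_mul b, ← huv, mul_assoc, hab, mul_assoc]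
  obtain ⟨⟨s, hs, hs0, hs1⟩, hp⟩ := h
  refine ⟨⟨s, hs, fun k l => inj ?_, fun t ht => hs1 t fun l => ?_⟩, fun g hg ht => ?_⟩
  · rw [← key, hs0, mul_zero]
  · rw [key, ht, mul_zero]
  · obtain ⟨t, ht⟩ := ht
    obtain ⟨t', h1, h2⟩ := hp (fun l => u * g l)
      (fun l => by simpa using Φ.mul_mem hu (hg l)) ⟨t, fun l => by rw [key, ht]⟩
    exact ⟨t', h1, fun l => inj (by rw [← key, h2])⟩

lemma SysBound.of_eq_zero {Φ : DegFiltration R} {κ : Type*} {m : ℕ} {A : κ → Fin m → R}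
    (h : ∀ l i, A l i = 0) (d : ℕ) : SysBound Φ A d m 0 := by
  refine ⟨⟨fun k i => if k = i then 1 else 0, fun k i => ?_, fun _ l => by simp [h], fun t _ =>
      ⟨t, fun i => by simp⟩⟩, fun g _ ⟨t, ht⟩ => ⟨0, fun _ => zero_mem _, fun l => ?_⟩⟩
  · dsimp only
    split_ifs
    · exact Φ.one_mem
    · exact zero_mem _
  · rw [← ht l]; simp [h]

lemma DegFiltration.pow_mem (Φ : DegFiltration R) {a : R} {i : ℕ} (ha : a ∈ Φ.B i) (k : ℕ) :
    a ^ k ∈ Φ.B (k * i) := by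
  induction k with
  | zero => simpa using Φ.one_mem
  | succ k ih =>
    rw [pow_succ, add_mul, one_mul]
    exact Φ.mul_mem ih ha

lemma DegFiltration.prod_mem (Φ : DegFiltration R) {ι : Type*} (s : Finset ι) {a : ι → R} {i : ℕ}
    (ha : ∀ j ∈ s, a j ∈ Φ.B i) : ∏ j ∈ s, a j ∈ Φ.B (s.card * i) := by
  classical
  induction s using Finset.induction_on with
  | empty => simpa using Φ.one_mem
  | insert j s hj ih =>
    rw [Finset.prod_insert hj, Finset.card_insert_of_notMem hj, add_mul, one_mul, add_comm]
    exact Φ.mul_mem (ha j (by simp)) (ih fun k hk => ha k (by simp [hk]))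

end Transfer

/-! ### Polynomials of bounded degree in each variable -/

section Box

variable {F : Type*} [Field F] {n : ℕ}

/-- The filtration of a polynomial ring by the maximum of the degrees in the single variables. -/
noncomputable def box (n : ℕ) (F : Type*) [Field F] : DegFiltration (MvPolynomial (Fin n) F) where
  B d := (restrictDegree (Fin n) F d).toAddSubgroup
  mono i j hij p hp s hs k := (hp hs k).trans hij
  one_mem := by
    change (1 : MvPolynomial (Fin n) F) ∈ restrictDegree (Fin n) F 0
    rw [mem_restrictDegree]
    intro s hs i
    rw [mem_support_iff, coeff_one] at hs
    by_cases h : 0 = s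
    · simp [← h]
    · simp [h] at hs
  mul_mem {i j a b} ha hb := by
    classical
    change a ∈ restrictDegree (Fin n) F i at ha
    change b ∈ restrictDegree (Fin n) F j at hb
    change a * b ∈ restrictDegree (Fin n) F (i + j)
    rw [mem_restrictDegree] at *
    intro s hs k
    have h := support_mul a b hs
    obtain ⟨x, hx, y, hy, rfl⟩ := Finset.mem_add.1 h
    exact add_le_add (ha x hx k) (hb y hy k)

lemma mem_box {d : ℕ} {p : MvPolynomial (Fin n) F} :
    p ∈ (box n F).B d ↔ ∀ s, coeff s p ≠ 0 → ∀ i, s i ≤ d := by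
  change p ∈ restrictDegree (Fin n) F d ↔ _
  simp [mem_restrictDegree]

lemma C_mem_box (a : F) (d : ℕ) : (C a : MvPolynomial (Fin n) F) ∈ (box n F).B d := by
  rw [mem_box]
  intro s hs i
  rw [coeff_C] at hs
  by_cases h : 0 = s
  · simp [← h]
  · simp [h] at hs

lemma X_mem_box (i : Fin n) : (X i : MvPolynomial (Fin n) F) ∈ (box n F).B 1 := by
  classical
  rw [mem_box]
  intro s hs j
  rw [coeff_X] at hs
  by_cases h : Finsupp.single i 1 = s
  · rw [← h, Finsupp.single_apply]; split_ifs <;> simp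
  · simp [h] at hs

lemma aeval_mem {R : Type*} [CommRing R] [Algebra F R] {Φ : DegFiltration R} {w d : ℕ}
    (hC : ∀ a : F, algebraMap F R a ∈ Φ.B 0) (x : Fin n → R) (hx : ∀ i, x i ∈ Φ.B w)
    {p : MvPolynomial (Fin n) F} (hp : p ∈ (box n F).B d) : aeval x p ∈ Φ.B (n * (d * w)) := by
  rw [mem_box] at hp
  rw [aeval_def, eval₂_eq]
  refine sum_mem fun s hs => ?_
  rw [mem_support_iff] at hs
  rw [← zero_add (n * (d * w))]
  refine Φ.mul_mem (hC _) ?_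
  have h : ∏ i ∈ s.support, x i ^ s i = ∏ i, x i ^ s i :=
    Finset.prod_subset (subset_univ _) fun i _ hi => by simp [Finsupp.notMem_support_iff.1 hi]
  rw [h]
  simpa using Φ.prod_mem univ (i := d * w) fun i _ =>
    Φ.mono (Nat.mul_le_mul_right w (hp s hs i)) (Φ.pow_mem (hx i) (s i))

/-- The degree in each single variable, unlike the total degree, is exactly what
`DegFiltration.polynomial` iterates, so separating off one variable costs nothing in either
direction. -/
lemma finSuccEquiv_mem {d : ℕ} {p : MvPolynomial (Fin (n + 1)) F} (hp : p ∈ (box (n + 1) F).B d) :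
    finSuccEquiv F n p ∈ (box n F).polynomial.B d := by
  rw [mem_box] at hp
  refine ⟨?_, fun k => ?_⟩
  · rw [natDegree_finSuccEquiv, degreeOf_le_iff]
    intro s hs
    exact hp s (by simpa using hs) 0
  · rw [mem_box]
    intro s hs i
    rw [finSuccEquiv_coeff_coeff] at hs
    simpa using hp _ hs i.succ

lemma finSuccEquiv_symm_mem {d : ℕ} {p : Polynomial (MvPolynomial (Fin n) F)}
    (hp : p ∈ (box n F).polynomial.B d) : (finSuccEquiv F n).symm p ∈ (box (n + 1) F).B d := by
  rw [mem_box]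
  intro s hs i
  obtain ⟨q, rfl⟩ := (finSuccEquiv F n).surjective p
  rw [AlgEquiv.symm_apply_apply] at hs
  have h : coeff s.tail ((finSuccEquiv F n q).coeff (s 0)) ≠ 0 := by
    rwa [finSuccEquiv_coeff_coeff, Finsupp.cons_tail]
  induction i using Fin.cases with
  | zero =>
    refine le_trans (Polynomial.le_natDegree_of_ne_zero fun h0 => ?_) hp.1
    simp [h0] at h
  | succ i => exact mem_box.1 (hp.2 (s 0)) _ h i

end Box

/-! ### Nagata's change of variables -/

section Nagata

variable {F : Type*} [Field F] {n : ℕ} (U : ℕ)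

/-- The substitution of `X i + c • X 0 ^ (U ^ i)` for `X i`, for `i ≠ 0`. -/
noncomputable def nagataHom (n : ℕ) (c : F) :
    MvPolynomial (Fin (n + 1)) F →ₐ[F] MvPolynomial (Fin (n + 1)) F :=
  aeval fun i : Fin (n + 1) => if i = 0 then X 0 else X i + c • X 0 ^ U ^ (i : ℕ)

/-- The variable $X_0$ is fixed, so the shifts by $\pm c X_0^{U^i}$ cancel. -/
lemma nagataHom_comp (c : F) :
    (nagataHom U n c).comp (nagataHom U n (-c)) = AlgHom.id _ _ := by
  unfold nagataHom
  rw [comp_aeval, ← MvPolynomial.aeval_X_left]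
  ext i v
  cases i using Fin.cases <;> simp

/-- Nagata's automorphism. -/
noncomputable def nagata (F : Type*) [Field F] (n : ℕ) :
    MvPolynomial (Fin (n + 1)) F ≃ₐ[F] MvPolynomial (Fin (n + 1)) F :=
  AlgEquiv.ofAlgHom (nagataHom U n 1) (nagataHom U n (-1)) (nagataHom_comp U 1)
    (by simpa using nagataHom_comp (F := F) U (n := n) (-1))

lemma nagataHom_mem (c : F) {d : ℕ} {p : MvPolynomial (Fin (n + 1)) F}
    (hp : p ∈ (box (n + 1) F).B d) :
    nagataHom (U + 1) n c p ∈ (box (n + 1) F).B ((n + 1) * (d * (U + 1) ^ n)) := by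
  refine aeval_mem (fun a => C_mem_box a 0) _ (fun i => ?_) hp
  have h1 : 1 ≤ (U + 1) ^ n := Nat.one_le_pow _ _ (by lia)
  split_ifs
  · exact (box _ F).mono h1 (X_mem_box 0)
  · refine add_mem ((box _ F).mono h1 (X_mem_box i)) ?_
    rw [smul_eq_C_mul, ← zero_add ((U + 1) ^ n)]
    refine (box _ F).mul_mem (C_mem_box c 0) ?_
    refine (box _ F).mono ?_ ((box _ F).pow_mem (X_mem_box 0) _)
    rw [mul_one]
    exact Nat.pow_le_pow_right (by lia) (by lia)

lemma finSuccEquiv_nagata_monomial (v : Fin (n + 1) →₀ ℕ) (a : F) :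
    (finSuccEquiv F n (nagata U F n (monomial v a))) = Polynomial.C (C a) *
      ∏ i : Fin (n + 1), (finSuccEquiv F n (nagata U F n (X i))) ^ v i := by
  rw [monomial_eq, Finsupp.prod_pow]
  simp only [map_mul, map_prod, map_pow]
  congr 1
  rw [show (C a : MvPolynomial (Fin (n + 1)) F) = algebraMap F _ a from rfl, AlgEquiv.commutes,
    AlgEquiv.commutes]
  rfl

lemma finSuccEquiv_nagata_X (hU : 0 < U) (i : Fin (n + 1)) :
    (finSuccEquiv F n (nagata U F n (X i))).Monic ∧
      (finSuccEquiv F n (nagata U F n (X i))).natDegree = U ^ (i : ℕ) := by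
  cases i using Fin.cases with
  | zero => simp [nagata, nagataHom, finSuccEquiv_X_zero, Polynomial.monic_X]
  | succ i =>
    have : finSuccEquiv F n (nagata U F n (X i.succ)) =
        Polynomial.X ^ (U ^ ((i : ℕ) + 1)) + Polynomial.C (X i) := by
      simp [nagata, nagataHom, finSuccEquiv_X_zero, finSuccEquiv_X_succ, add_comm]
    rw [this]
    exact ⟨Polynomial.monic_X_pow_add_C _ (by positivity), by simp⟩

/-- The image of each variable $X_i$ is monic in $X_0$ of degree $U^i$, and degrees of monic
polynomials add up. The degree of a monomial thus records its exponents as digits in base $U$. -/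
lemma natDegree_finSuccEquiv_nagata_monomial (hU : 0 < U) (v : Fin (n + 1) →₀ ℕ) {a : F}
    (ha : a ≠ 0) : (finSuccEquiv F n (nagata U F n (monomial v a))).natDegree =
        ∑ i : Fin (n + 1), U ^ (i : ℕ) * v i ∧
      (finSuccEquiv F n (nagata U F n (monomial v a))).leadingCoeff = C a := by
  rw [finSuccEquiv_nagata_monomial U]
  have hm : (∏ i : Fin (n + 1), (finSuccEquiv F n (nagata U F n (X i))) ^ v i).Monic :=
    Polynomial.monic_prod_of_monic _ _ fun i _ => (finSuccEquiv_nagata_X U hU i).1.pow _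
  have ha' : (C a : MvPolynomial (Fin n) F) ≠ 0 := by simpa using ha
  constructor
  · rw [Polynomial.natDegree_C_mul ha', Polynomial.natDegree_prod_of_monic _ _ fun i _ =>
      (finSuccEquiv_nagata_X U hU i).1.pow _]
    refine Finset.sum_congr rfl fun i _ => ?_
    rw [(finSuccEquiv_nagata_X U hU i).1.natDegree_pow, (finSuccEquiv_nagata_X U hU i).2, mul_comm]
  · rw [Polynomial.leadingCoeff_mul, hm.leadingCoeff, mul_one, Polynomial.leadingCoeff_C]

/-- Uniqueness of digits in base $U$. -/
lemma sum_pow_mul_injective (hU : 1 < U) {v w : Fin (n + 1) →₀ ℕ} (hv : ∀ i, v i < U)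
    (hw : ∀ i, w i < U)
    (h : ∑ i : Fin (n + 1), U ^ (i : ℕ) * v i = ∑ i : Fin (n + 1), U ^ (i : ℕ) * w i) : v = w := by
  refine Finsupp.ext <| congrFun <| List.ofFn_inj.mp ?_
  apply Nat.ofDigits_inj_of_len_eq hU (by simp) (by grind) (by grind)
  simpa only [Nat.ofDigits_eq_sum_mapIdx, List.mapIdx_eq_ofFn, List.get_ofFn, List.length_ofFn,
    Fin.val_cast, mul_comm, List.sum_ofFn] using! h

/-- Nagata's automorphism makes a polynomial monic up to a scalar. -/
lemma exists_leadingCoeff_nagata {d : ℕ} (hU : d + 1 < U) {f : MvPolynomial (Fin (n + 1)) F}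
    (hf : f ∈ (box (n + 1) F).B d) (h0 : f ≠ 0) :
    ∃ a : F, a ≠ 0 ∧ (finSuccEquiv F n (nagata U F n f)).leadingCoeff = C a := by
  classical
  rw [mem_box] at hf
  set ψ : MvPolynomial (Fin (n + 1)) F → Polynomial (MvPolynomial (Fin n) F) := fun p =>
    finSuccEquiv F n (nagata U F n p) with hψ
  obtain ⟨v, hv, hmax⟩ := Finset.exists_max_image f.support
    (fun v => ∑ i : Fin (n + 1), U ^ (i : ℕ) * v i) (support_nonempty.mpr h0)
  have hc (w) (hw : w ∈ f.support) : coeff w f ≠ 0 := mem_support_iff.1 hw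
  have hdeg (w) (hw : w ∈ f.support) := natDegree_finSuccEquiv_nagata_monomial U (by lia) w (hc w hw)
  -- Different exponents with entries below $U$ give different degrees in $X_0$, so a single
  -- monomial determines the leading coefficient.
  have hlt (w) (hw : w ∈ f.support.erase v) :
      (ψ (monomial w (coeff w f))).degree < (ψ (monomial v (coeff v f))).degree := by
    obtain ⟨hne, hw⟩ := Finset.mem_erase.1 hw
    refine Polynomial.degree_lt_degree ?_
    simp only [hψ]
    rw [(hdeg w hw).1, (hdeg v hv).1]
    refine lt_of_le_of_ne (hmax w hw) fun h => hne ?_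
    exact sum_pow_mul_injective U (by lia) (fun i => by have := hf w (hc w hw) i; lia)
      (fun i => by have := hf v (hc v hv) i; lia) h
  refine ⟨coeff v f, hc v hv, ?_⟩
  have hsplit : ψ f = ∑ w ∈ f.support.erase v, ψ (monomial w (coeff w f)) +
      ψ (monomial v (coeff v f)) := by
    rw [Finset.sum_erase_add _ _ hv]
    simp only [hψ]
    rw [← map_sum, ← map_sum, f.support_sum_monomial_coeff]
  change (ψ f).leadingCoeff = _
  rw [hsplit, Polynomial.leadingCoeff_add_of_degree_lt, (hdeg v hv).2]
  refine lt_of_le_of_lt (Polynomial.degree_sum_le _ _) ?_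
  refine (Finset.sup_lt_iff ?_).2 hlt
  refine Ne.bot_lt fun h => ?_
  have h1 := (hdeg v hv).2
  rw [show finSuccEquiv F n (nagata U F n (monomial v (coeff v f))) = 0 from
    Polynomial.degree_eq_bot.1 h] at h1
  exact hc v hv (by simpa using h1.symm)

end Nagata

/-- The growth of degrees under Nagata's automorphism. -/
def nagataGrowth (n d e : ℕ) : ℕ := (n + 1) * (e * (d + 2) ^ n)

/-- Degree bounds for linear equations over polynomial rings in `n` variables over fields. -/
def mvBounds : ℕ → ℕ → ℕ → ℕ × ℕ
  | 0, m, _ => (m, 0)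
  | n + 1, m, d =>
    let b := polyBounds (sysBounds (mvBounds n)) m (nagataGrowth n d d)
    (m + b.1, nagataGrowth n d b.2)

/-- Hermann's bounds, by induction on the number of variables. Nagata's automorphism makes some
nonzero coefficient monic in $X_0$ up to a scalar, which reduces the equation to systems in $n$
variables. Unlike a linear change of variables, this works over finite fields too. The bounds do not
mention $F$, which is the uniformity needed later. -/
theorem eqCoh_mvBounds (n : ℕ) : ∀ (F : Type u) [Field F], EqCoh (box n F) (mvBounds n) := by
  classical
  induction n with
  | zero =>
    intro F _ m d f hf
    have hmem (p : MvPolynomial (Fin 0) F) (e : ℕ) : p ∈ (box 0 F).B e :=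
      mem_box.2 fun _ _ i => i.elim0
    change SysBound (box 0 F) (fun _ : Unit => f) d m 0
    by_cases h : ∀ i, f i = 0
    · exact SysBound.of_eq_zero (fun _ => h) d
    obtain ⟨i₀, h₀⟩ := not_forall.1 h
    obtain ⟨a, ha⟩ : ∃ a, a * f i₀ = 1 := by
      rw [eq_C_of_isEmpty (f i₀)] at h₀ ⊢
      have : coeff 0 (f i₀) ≠ 0 := fun h => h₀ (by rw [h, map_zero])
      exact ⟨C (coeff 0 (f i₀))⁻¹, by rw [← C_mul, inv_mul_cancel₀ this, C_1]⟩
    -- Over a field the syzygies are generated by $e_k - f_k f_{i_0}^{-1} e_{i_0}$, and $g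
    -- f_{i_0}^{-1} e_{i_0}$ is a solution.
    refine ⟨⟨fun k i => (if i = k then 1 else 0) - if i = i₀ then f k * a else 0,
      fun _ _ => hmem _ _, fun k _ => ?_, fun t ht => ⟨t, fun i => ?_⟩⟩,
      fun g _ _ => ⟨fun i => if i = i₀ then g () * a else 0, fun _ => hmem _ _, fun _ => ?_⟩⟩
    · simp [sub_mul, Finset.sum_sub_distrib, mul_assoc, ha]
    · have : ∑ k, t k * (f k * a) = 0 := by
        simp only [← mul_assoc]
        rw [← Finset.sum_mul, ht (), zero_mul]
      simp only [mul_sub, Finset.sum_sub_distrib, mul_ite, mul_one, mul_zero]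
      split_ifs <;> simp [this]
    · simp [mul_assoc, ha]
  | succ n ih =>
    intro F _ m d f hf
    simp only [mvBounds]
    by_cases h : ∀ i, f i = 0
    · exact ((SysBound.of_eq_zero (fun _ => h) d).pad (Nat.le_add_right _ _)).mono (Nat.zero_le _)
    obtain ⟨i₀, h₀⟩ := not_forall.1 h
    refine SysBound.pad ?_ (Nat.le_add_left _ _)
    -- The base $d+2$ exceeds all exponents, which are at most $d$, and is at least $2$ even for $d
    -- = 0$.
    set ψ := (nagata (d + 2) F n).trans (finSuccEquiv F n) with hψ
    obtain ⟨a, ha0, ha⟩ := exists_leadingCoeff_nagata (d + 2) (by lia) (hf i₀) h₀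
    have hd (e : ℕ) : ∀ p ∈ (box (n + 1) F).B e,
        ψ p ∈ (box n F).polynomial.B (nagataGrowth n d e) := fun p hp =>
      finSuccEquiv_mem (nagataHom_mem (d + 1) 1 hp)
    have hd' (e : ℕ) : ∀ p ∈ (box n F).polynomial.B e,
        ψ.symm p ∈ (box (n + 1) F).B (nagataGrowth n d e) := fun p hp =>
      nagataHom_mem (d + 1) (-1) (finSuccEquiv_symm_mem hp)
    have hCmem (c : F) (e : ℕ) : Polynomial.C (C c) ∈ (box n F).polynomial.B e := by
      refine ⟨by simp, fun k => ?_⟩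
      rw [Polynomial.coeff_C]
      split_ifs
      · exact C_mem_box _ _
      · exact zero_mem _
    refine SysBound.of_ringEquiv ψ.toRingEquiv (hd d) (hd' _) ?_
    refine SysBound.of_smul (u := Polynomial.C (C a⁻¹)) (v := Polynomial.C (C a)) ?_
      (hCmem _ _) ?_
    · rw [← map_mul, ← map_mul, mul_inv_cancel₀ ha0, map_one, map_one]
    · refine SysCoh.polynomial (ih F).sysCoh _ (fun i => ?_) i₀ ?_
      · rw [← zero_add (nagataGrowth n d d)]
        exact (box n F).polynomial.mul_mem (hCmem _ _) (hd d _ (hf i))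
      · change (Polynomial.C (C a⁻¹) * (finSuccEquiv F n (nagata (d + 2) F n (f i₀)))).Monic
        rw [Polynomial.Monic, Polynomial.leadingCoeff_mul, ha, Polynomial.leadingCoeff_C, ← map_mul,
          inv_mul_cancel₀ ha0, map_one]

end UniformBounds

/-! ### Bounds modulo an ideal defined over the integers -/

namespace UniformBounds

open Finset MvPolynomial

/-- Passage to a field can only remove monomials, so the integral degrees serve for every field. -/
lemma exists_box_bound {n q : ℕ} (p : Fin q → MvPolynomial (Fin n) ℤ) :
    ∃ e, ∀ (F : Type u) [Field F] (j : Fin q), map (Int.castRingHom F) (p j) ∈ (box n F).B e := by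
  refine ⟨univ.sup fun j => (p j).totalDegree, fun F _ j => ?_⟩
  rw [mem_box]
  intro s hs i
  rw [coeff_map] at hs
  have h : s ∈ (p j).support := by
    rw [mem_support_iff]
    intro h
    simp [h] at hs
  exact (monomial_le_degreeOf i h).trans ((degreeOf_le_totalDegree _ _).trans
    (Finset.le_sup (f := fun j => (p j).totalDegree) (mem_univ j)))

/-- Uniform bounds for ideal membership and syzygies modulo the extension of an ideal of
`ℤ[T₁, …, Tₙ]` to polynomials over a field. -/
theorem exists_uniform_bound {n q : ℕ} (p : Fin q → MvPolynomial (Fin n) ℤ) (ι : Type) [Fintype ι]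
    (d : ℕ) : ∃ D : ℕ, ∀ (F : Type u) [Field F] (f : ι → MvPolynomial (Fin n) F),
    (∀ i, f i ∈ (box n F).B d) →
      (∀ g ∈ (box n F).B d,
        g ∈ Ideal.span (Set.range f) ⊔ GrassModule.extIdeal F (Ideal.span (Set.range p)) →
        ∃ (t : ι → MvPolynomial (Fin n) F) (s : Fin q → MvPolynomial (Fin n) F),
          (∀ i, t i ∈ (box n F).B D) ∧ (∀ j, s j ∈ (box n F).B D) ∧
          ∑ i, t i * f i + ∑ j, s j * map (Int.castRingHom F) (p j) = g) ∧
      ∀ t : ι → MvPolynomial (Fin n) F,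
        ∑ i, t i * f i ∈ GrassModule.extIdeal F (Ideal.span (Set.range p)) →
        ∃ (N : ℕ) (c : Fin N → MvPolynomial (Fin n) F) (τ : Fin N → ι → MvPolynomial (Fin n) F)
          (s : Fin N → Fin q → MvPolynomial (Fin n) F),
          (∀ k i, τ k i ∈ (box n F).B D) ∧ (∀ k j, s k j ∈ (box n F).B D) ∧
          (∀ k, ∑ i, τ k i * f i + ∑ j, s k j * map (Int.castRingHom F) (p j) = 0) ∧
          ∀ i, t i = ∑ k, c k * τ k i := by
  obtain ⟨e, he⟩ := exists_box_bound.{u} p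
  set m := Fintype.card (ι ⊕ Fin q)
  refine ⟨(mvBounds n m (max d e)).2, fun F _ f hf => ?_⟩
  have hext : GrassModule.extIdeal F (Ideal.span (Set.range p)) =
      Ideal.span (Set.range fun j => map (Int.castRingHom F) (p j)) := by
    rw [GrassModule.extIdeal, Ideal.map_span, ← Set.range_comp]
    rfl
  -- Working modulo $\hat I$ means working with one linear equation that has the generators of $\hat
  -- I$ as additional coefficients.
  set A : ι ⊕ Fin q → MvPolynomial (Fin n) F :=
    Sum.elim f fun j => map (Int.castRingHom F) (p j) with hA
  have hAmem (i) : A i ∈ (box n F).B (max d e) := by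
    rcases i with i | j
    · exact (box n F).mono (le_max_left _ _) (hf i)
    · exact (box n F).mono (le_max_right _ _) (he F j)
  obtain ⟨⟨s, hs, hs0, hs1⟩, hp⟩ := SysBound.reindex (A := fun _ : Unit => A)
    (Fintype.equivFin (ι ⊕ Fin q)).symm (Equiv.refl _) (eqCoh_mvBounds n F m (max d e) _
      fun i => hAmem _)
  constructor
  · intro g hg hmem
    rw [hext, ← Ideal.span_union, ← Set.Sum.elim_range, Ideal.mem_span_range_iff_exists_fun] at hmem
    obtain ⟨t, ht⟩ := hmem
    obtain ⟨t', h1, h2⟩ := hp (fun _ => g) (fun _ => (box n F).mono (le_max_left _ _) hg)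
      ⟨t, fun _ => ht⟩
    refine ⟨fun i => t' (.inl i), fun j => t' (.inr j), fun i => h1 _, fun j => h1 _, ?_⟩
    rw [← h2 ()]
    simp [hA]
  · intro t ht
    rw [hext, Ideal.mem_span_range_iff_exists_fun] at ht
    obtain ⟨r, hr⟩ := ht
    -- A syzygy modulo $\hat I$ becomes a true syzygy of the enlarged family once the negated
    -- coefficients of its value in $\hat I$ are appended.
    obtain ⟨c, hc⟩ := hs1 (Sum.elim t fun j => - r j) fun _ => by
      simp [hA, hr]
    refine ⟨_, c, fun k i => s k (.inl i), fun k j => s k (.inr j), fun k i => hs _ _,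
      fun k j => hs _ _, fun k => ?_, fun i => hc (.inl i)⟩
    rw [← hs0 k ()]
    simp [hA]

end UniformBounds

/-! ### Solutions that are independent under a space of operators -/

namespace GrassModule

open MvPolynomial Module

section Independence

variable {F V : Type u} [Field F] [AddCommGroup V] [Module F V] {n : ℕ}

/-- The solvability condition in terms of representatives in a polynomial ring of the elements of
its quotient by `J`. -/
def IsSolvable (ev : MvPolynomial (Fin n) F →ₐ[F] End F V) (J : Ideal (MvPolynomial (Fin n) F)) :
    Prop :=
  ∀ (m k r : ℕ) (f : Fin m → MvPolynomial (Fin n) F) (g : Fin k → MvPolynomial (Fin n) F)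
    (v : Fin m → V) (u : Fin r → V), (∀ j, g j ∉ Ideal.span (Set.range f) ⊔ J) →
    (∀ t : Fin m → MvPolynomial (Fin n) F, ∑ i, t i * f i ∈ J → ∑ i, ev (t i) (v i) = 0) →
    ∃ x : V, (∀ i, ev (f i) x = v i) ∧ ∀ j, ev (g j) x ∉ Submodule.span F (Set.range u)

/-- An ideal that is maximal among those that omit a given element has finite codimension. -/
lemma finite_quotient_of_maximal_omitting {A : Type*} [CommRing A] [Algebra F A]
    [Algebra.FiniteType F A] (g : A) (hg : g ≠ 0)
    (hmem : ∀ h : A, h ≠ 0 → ∃ a, a * h = g) : Module.Finite F A := by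
  have : IsNoetherianRing A := Algebra.FiniteType.isNoetherianRing F A
  have hann (a : A) (ha : a * g ≠ 0) : ∃ b, b * a * g = g := by
    obtain ⟨b, hb⟩ := hmem _ ha
    exact ⟨b, by rw [mul_assoc, hb]⟩
  -- The annihilator of $g$ is maximal: if $ag \ne 0$, then $g$ is a multiple of $ag$, so $a$ is
  -- invertible modulo the annihilator.
  set 𝔪 : Ideal A := LinearMap.ker (LinearMap.toSpanSingleton A A g) with h𝔪
  have hm (a : A) : a ∈ 𝔪 ↔ a * g = 0 := by simp [h𝔪]
  have hmax : 𝔪.IsMaximal := by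
    rw [Ideal.isMaximal_iff]
    refine ⟨by simpa [hm] using hg, fun J x hJ hx hxJ => ?_⟩
    obtain ⟨b, hb⟩ := hann x (by rwa [hm] at hx)
    have h1 : 1 - b * x ∈ J := hJ ((hm _).2 (by rw [sub_mul, hb, one_mul, sub_self]))
    simpa using J.add_mem h1 (J.mul_mem_left b hxJ)
  -- If no power of $\mathfrak m$ vanished, $g$ would lie in all of them, and Krull's intersection
  -- theorem would give $r \in \mathfrak m$ with $rg = g$, although $rg = 0$. A nilpotent maximal
  -- ideal is the only prime, so the ring is Artinian, and being of finite type it is finite over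
  -- $F$.
  obtain ⟨N, hN⟩ : ∃ N : ℕ, 𝔪 ^ N = ⊥ := by
    by_contra! hne
    have : g ∈ (⨅ i : ℕ, 𝔪 ^ i • ⊤ : Submodule A A) := by
      rw [Submodule.mem_iInf]
      intro i
      obtain ⟨h, hh, h0⟩ := Submodule.exists_mem_ne_zero_of_ne_bot (hne i)
      obtain ⟨a, rfl⟩ := hmem h h0
      simpa using Ideal.mul_mem_left _ a hh
    rw [Ideal.mem_iInf_smul_pow_eq_bot_iff] at this
    obtain ⟨r, hr⟩ := this
    have := (hm _).1 r.2
    rw [smul_eq_mul, this] at hr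
    exact hg hr.symm
  have hdim : Ring.KrullDimLE 0 A := by
    refine Ring.KrullDimLE.mk₀ fun p hp => ?_
    have : 𝔪 ≤ p := hp.le_of_pow_le (hN ▸ bot_le)
    rwa [← hmax.eq_of_le hp.ne_top this]
  have : IsArtinianRing A := isArtinianRing_iff_isNoetherianRing_krullDimLE_zero.2 ⟨‹_›, hdim⟩
  exact Module.finite_of_isArtinianRing F A

variable {ev : MvPolynomial (Fin n) F →ₐ[F] End F V} {J : Ideal (MvPolynomial (Fin n) F)}

/-- By the ascending chain condition. Maximality of $q$ means that $g \in q + (h)$ for every $h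
\notin q$, which is the form used below. -/
lemma exists_maximal_omitting {R : Type*} [CommRing R] [IsNoetherianRing R] (𝔞 : Ideal R) {g : R}
    (hg : g ∉ 𝔞) : ∃ q : Ideal R, 𝔞 ≤ q ∧ g ∉ q ∧ ∀ h, h ∉ q → ∃ a, a * h - g ∈ q := by
  obtain ⟨q, ⟨h1, h2⟩, hmax⟩ := set_has_maximal_iff_noetherian.2 (inferInstance : IsNoetherian R R)
    {q : Ideal R | 𝔞 ≤ q ∧ g ∉ q} ⟨𝔞, le_rfl, hg⟩
  refine ⟨q, h1, h2, fun h hh => ?_⟩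
  by_contra! hno
  refine hmax (q ⊔ Ideal.span {h}) ⟨h1.trans le_sup_left, fun hgq => ?_⟩ ?_
  · obtain ⟨y, hy, z, hz, hyz⟩ := Submodule.mem_sup.1 hgq
    obtain ⟨a, rfl⟩ := Ideal.mem_span_singleton'.1 hz
    exact hno a (by rw [← hyz]; simpa using hy)
  · refine lt_of_le_of_ne le_sup_left fun heq => hh ?_
    rw [heq]
    exact Ideal.mem_sup_right (Ideal.mem_span_singleton_self h)

/-- One element that avoids a finite dimensional subspace `U` under all operators outside of an
ideal that is maximal among those that omit `g`. -/
lemma IsSolvable.exists_avoiding (hsol : IsSolvable ev J) {q : Ideal (MvPolynomial (Fin n) F)}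
    (hJq : J ≤ q) {g : MvPolynomial (Fin n) F} (hg : g ∉ q)
    (hq : ∀ h, h ∉ q → ∃ a, a * h - g ∈ q) (U : Submodule F V) (hU : U.FG) :
    ∃ x : V, (∀ a ∈ q, ev a x = 0) ∧ ∀ h, ev h x ∈ U → h ∈ q := by
  have hfin : Module.Finite F (MvPolynomial (Fin n) F ⧸ q) := by
    refine finite_quotient_of_maximal_omitting (Ideal.Quotient.mk q g)
      (by rwa [Ne, Ideal.Quotient.eq_zero_iff_mem]) fun h hh => ?_
    obtain ⟨h, rfl⟩ := Ideal.Quotient.mk_surjective h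
    rw [Ne, Ideal.Quotient.eq_zero_iff_mem] at hh
    obtain ⟨a, ha⟩ := hq h hh
    exact ⟨Ideal.Quotient.mk q a, by rw [← map_mul, Ideal.Quotient.eq]; exact ha⟩
  obtain ⟨N, b, hb⟩ := Submodule.fg_iff_exists_fin_generating_family.1 hfin.fg_top
  choose B hB using fun i => Ideal.Quotient.mk_surjective (b i)
  obtain ⟨M, w, rfl⟩ := Submodule.fg_iff_exists_fin_generating_family.1 hU
  obtain ⟨m, f, hf⟩ := Submodule.fg_iff_exists_fin_generating_family.1
    ((isNoetherianRing_iff_ideal_fg _).1 inferInstance q)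
  change Ideal.span (Set.range f) = q at hf
  -- The space to be avoided is spanned by the $B_i w_j$, for representatives $B_i$ of generators of
  -- $F[T]/q$ and generators $w_j$ of $U$. If $hx \in U$ with $h \notin q$, then $ah \equiv g$
  -- modulo $q$ for some $a \equiv \sum c_i B_i$, so $gx = \sum c_i B_i h x$ would lie in this
  -- space.
  obtain ⟨x, hx1, hx2⟩ := hsol m 1 (N * M) f (fun _ => g) 0
    (fun k => ev (B (finProdFinEquiv.symm k).1) (w (finProdFinEquiv.symm k).2))
    (fun _ => by rwa [hf, sup_eq_left.2 hJq]) (by simp)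
  have hqx (a) (ha : a ∈ q) : ev a x = 0 := by
    rw [← hf, Ideal.mem_span_range_iff_exists_fun] at ha
    obtain ⟨c, rfl⟩ := ha
    simp [hx1]
  refine ⟨x, hqx, fun h hh => ?_⟩
  by_contra hhq
  obtain ⟨a, ha⟩ := hq h hhq
  have : Ideal.Quotient.mk q a ∈ Submodule.span F (Set.range b) := hb ▸ Submodule.mem_top
  obtain ⟨c, hc⟩ := (Submodule.mem_span_range_iff_exists_fun F).1 this
  have hac : a - ∑ i, c i • B i ∈ q := by
    rw [← Ideal.Quotient.eq, ← hc]
    simp only [← Ideal.Quotient.mkₐ_eq_mk F, map_sum, map_smul]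
    simp [hB]
  have hgx : ev g x = ∑ i, c i • ev (B i) (ev h x) := by
    have h1 : g - (∑ i, c i • B i) * h ∈ q := by
      have := q.sub_mem (q.mul_mem_right h hac) ha
      convert! this using 1
      ring
    have h2 := hqx _ h1
    rw [map_sub, LinearMap.sub_apply, sub_eq_zero] at h2
    rw [h2, map_mul, map_sum]
    simp
  refine hx2 0 ?_
  rw [hgx]
  refine Submodule.sum_mem _ fun i _ => Submodule.smul_mem _ _ ?_
  obtain ⟨y, hy⟩ := (Submodule.mem_span_range_iff_exists_fun F).1 hh
  rw [← hy, map_sum]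
  refine Submodule.sum_mem _ fun j _ => ?_
  rw [map_smul]
  exact Submodule.smul_mem _ _ (Submodule.subset_span ⟨finProdFinEquiv (i, j), by simp⟩)

/-- Induction on $\dim W$. For a nonzero $g \in W$ let $q \supseteq \mathfrak a$ be maximal omitting
$g$, let $y$ serve for the smaller space $W \cap q$, and let $x$ be killed by $q$ and avoid $U + Wy$
outside of $q$. Then $h(x+y) \in U$ forces $hx \in U + Wy$, hence $h \in q$ and $hx = 0$, and $y$
takes care of the rest. -/
lemma IsSolvable.exists_independent_aux (hsol : IsSolvable ev J)
    (𝔞 : Ideal (MvPolynomial (Fin n) F)) (hJ : J ≤ 𝔞) (U : Submodule F V) (hU : U.FG) (d : ℕ) :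
    ∀ (W : Submodule F (MvPolynomial (Fin n) F)) [FiniteDimensional F W], finrank F W = d →
      (∀ h ∈ W, h ∈ 𝔞 → h = 0) →
      ∃ x : V, (∀ a ∈ 𝔞, ev a x = 0) ∧ ∀ h ∈ W, ev h x ∈ U → h = 0 := by
  induction d using Nat.strong_induction_on with
  | _ d ih =>
  intro W _ hd hW
  by_cases h0 : W = ⊥
  · exact ⟨0, fun _ _ => map_zero _, fun h hh _ => by simpa [h0] using hh⟩
  obtain ⟨g, hgW, hg0⟩ := Submodule.exists_mem_ne_zero_of_ne_bot h0
  obtain ⟨q, hq1, hq2, hq3⟩ := exists_maximal_omitting 𝔞 fun h => hg0 (hW g hgW h)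
  have hlt : W ⊓ q.restrictScalars F < W := lt_of_le_of_ne inf_le_left fun h =>
    hq2 (h.symm.le hgW).2
  have : FiniteDimensional F (W ⊓ q.restrictScalars F : Submodule F (MvPolynomial (Fin n) F)) :=
    Submodule.finiteDimensional_of_le inf_le_left
  obtain ⟨y, hy1, hy2⟩ := ih _ (hd ▸ Submodule.finrank_lt_finrank_of_lt hlt)
    (W ⊓ q.restrictScalars F) rfl fun h hh => hW h hh.1
  set E : MvPolynomial (Fin n) F →ₗ[F] V := (LinearMap.applyₗ y).comp ev.toLinearMap with hE
  have hWfg : W.FG := (Submodule.fg_iff_finiteDimensional W).2 ‹_›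
  obtain ⟨x, hx1, hx2⟩ := hsol.exists_avoiding (hJ.trans hq1) hq2 hq3 (U ⊔ W.map E)
    (hU.sup (hWfg.map _))
  refine ⟨x + y, fun a ha => by rw [map_add, hx1 a (hq1 ha), hy1 a ha, add_zero],
    fun h hh hxy => ?_⟩
  rw [map_add] at hxy
  have hhq : h ∈ q := hx2 h <| by
    have h1 : ev h x = (ev h x + ev h y) - E h := by simp [hE]
    rw [h1]
    exact Submodule.sub_mem _ (Submodule.mem_sup_left hxy)
      (Submodule.mem_sup_right (Submodule.mem_map_of_mem hh))
  rw [hx1 h hhq, zero_add] at hxy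
  exact hy2 h ⟨hh, hhq⟩ hxy

/-- A solution of compatible equations at which the operators from a finite dimensional space `W`
are independent modulo `U`. -/
theorem IsSolvable.exists_independent (hsol : IsSolvable ev J) {m : ℕ}
    (f : Fin m → MvPolynomial (Fin n) F) (v : Fin m → V)
    (hv : ∀ t : Fin m → MvPolynomial (Fin n) F, ∑ i, t i * f i ∈ J → ∑ i, ev (t i) (v i) = 0)
    (U : V → Submodule F V) (hU : ∀ x, (U x).FG)
    (hUx : ∀ x y, (∀ i, ev (f i) x = ev (f i) y) → U x = U y)
    (W : Submodule F (MvPolynomial (Fin n) F)) (hWfg : W.FG)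
    (hW : ∀ h ∈ W, h ∈ Ideal.span (Set.range f) ⊔ J → h = 0) :
    ∃ x : V, (∀ i, ev (f i) x = v i) ∧ ∀ h ∈ W, ev h x ∈ U x → h = 0 := by
  have : FiniteDimensional F W := (Submodule.fg_iff_finiteDimensional W).1 hWfg
  obtain ⟨y, hy, -⟩ := hsol m 0 0 f Fin.elim0 v Fin.elim0 (fun j => j.elim0) hv
  set E : MvPolynomial (Fin n) F →ₗ[F] V := (LinearMap.applyₗ y).comp ev.toLinearMap with hE
  -- A particular solution $y$ is corrected by a solution $x$ of the homogeneous equations that is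
  -- independent modulo $U(y) + Wy$. The correction does not change $U$, which depends only on the
  -- values under the $f_i$.
  obtain ⟨x, hx1, hx2⟩ := hsol.exists_independent_aux (Ideal.span (Set.range f) ⊔ J) le_sup_right
    (U y ⊔ W.map E) ((hU y).sup (hWfg.map _)) _ W rfl hW
  have hfx (i) : ev (f i) (x + y) = v i := by
    rw [map_add, hx1 _ (Ideal.mem_sup_left (Ideal.subset_span ⟨i, rfl⟩)), zero_add, hy]
  refine ⟨x + y, hfx, fun h hh hU' => hx2 h hh ?_⟩
  rw [hUx (x + y) y fun i => by rw [hfx, hy]] at hU'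
  have h1 : ev h x = (ev h (x + y)) - E h := by simp [hE]
  rw [h1]
  exact Submodule.sub_mem _ (Submodule.mem_sup_left hU')
      (Submodule.mem_sup_right (Submodule.mem_map_of_mem hh))

end Independence

end GrassModule

namespace GrassModule

open MvPolynomial Topology

/-! ### Relations that are uniformly constructible over algebraically closed fields -/

section Constructible

variable {α β : Type}

/-- The point of the spectrum of `ℤ[α]` that is given by elements of a field. -/
noncomputable def specPoint {F : Type u} [Field F] (x : α → F) : PrimeSpectrum (MvPolynomial α ℤ) :=
  ⟨RingHom.ker (aeval x : MvPolynomial α ℤ →ₐ[ℤ] F), RingHom.ker_isPrime _⟩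

lemma mem_specPoint {F : Type u} [Field F] (x : α → F) (p : MvPolynomial α ℤ) :
    p ∈ (specPoint x).asIdeal ↔ aeval x p = 0 := RingHom.mem_ker

/-- A relation on tuples of field elements that is defined, uniformly over all algebraically closed
fields, by a constructible set. -/
def FD (S : ∀ (F : Type u) [Field F], (α → F) → Prop) : Prop :=
  ∃ C : Set (PrimeSpectrum (MvPolynomial α ℤ)), IsConstructible C ∧
    ∀ (F : Type u) [Field F] [IsAlgClosed F] (x : α → F), S F x ↔ specPoint x ∈ C

/-- A function on tuples of field elements that is defined by a polynomial over `ℤ`. -/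
def FT (t : ∀ (F : Type u) [Field F], (α → F) → F) : Prop :=
  ∃ p : MvPolynomial α ℤ, ∀ (F : Type u) [Field F] (x : α → F), t F x = aeval x p

section Terms

variable {s t : ∀ (F : Type u) [Field F], (α → F) → F}

lemma FT.var (a : α) : FT (fun (F : Type u) [Field F] (x : α → F) => x a) :=
  ⟨X a, fun F _ x => by simp⟩

lemma FT.zero : FT (fun (F : Type u) [Field F] (_ : α → F) => (0 : F)) :=
  ⟨0, fun F _ x => by simp⟩

lemma FT.one : FT (fun (F : Type u) [Field F] (_ : α → F) => (1 : F)) :=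
  ⟨1, fun F _ x => by simp⟩

lemma FT.add (hs : FT s) (ht : FT t) : FT (fun F _ x => s F x + t F x) := by
  obtain ⟨p, hp⟩ := hs
  obtain ⟨q, hq⟩ := ht
  exact ⟨p + q, fun F _ x => by simp [hp, hq]⟩

lemma FT.mul (hs : FT s) (ht : FT t) : FT (fun F _ x => s F x * t F x) := by
  obtain ⟨p, hp⟩ := hs
  obtain ⟨q, hq⟩ := ht
  exact ⟨p * q, fun F _ x => by simp [hp, hq]⟩

lemma FT.sum {ι : Type*} {s : ι → ∀ (F : Type u) [Field F], (α → F) → F} (I : Finset ι)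
    (hs : ∀ i, FT (s i)) : FT (fun F _ x => ∑ i ∈ I, s i F x) := by
  choose p hp using hs
  exact ⟨∑ i ∈ I, p i, fun F _ x => by simp [hp]⟩

lemma FT.aeval {s : β → ∀ (F : Type u) [Field F], (α → F) → F} (hs : ∀ i, FT (s i))
    (p : MvPolynomial β ℤ) : FT (fun F _ x => aeval (fun b => s b F x) p) := by
  choose q hq using hs
  refine ⟨MvPolynomial.aeval q p, fun F _ x => ?_⟩
  simp only [hq]
  rw [← AlgHom.comp_apply, comp_aeval]

end Terms

variable {S T : ∀ (F : Type u) [Field F], (α → F) → Prop}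

lemma FD.congr (h : FD S) (hST : ∀ (F : Type u) [Field F] [IsAlgClosed F] (x : α → F),
    T F x ↔ S F x) : FD T := by
  obtain ⟨C, hC, h⟩ := h
  exact ⟨C, hC, fun F _ _ x => (hST F x).trans (h F x)⟩

lemma FD.not (h : FD S) : FD (fun F _ x => ¬ S F x) := by
  obtain ⟨C, hC, h⟩ := h
  exact ⟨Cᶜ, hC.compl, fun F _ _ x => not_congr (h F x)⟩

lemma FD.and (hS : FD S) (hT : FD T) : FD (fun F _ x => S F x ∧ T F x) := by
  obtain ⟨C, hC, h⟩ := hS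
  obtain ⟨C', hC', h'⟩ := hT
  exact ⟨C ∩ C', hC.inter hC', fun F _ _ x => and_congr (h F x) (h' F x)⟩

lemma FD.imp (hS : FD S) (hT : FD T) : FD (fun F _ x => S F x → T F x) :=
  (hS.and hT.not).not.congr fun F _ _ x => by tauto

lemma FD.iff (hS : FD S) (hT : FD T) : FD (fun F _ x => S F x ↔ T F x) :=
  ((hS.imp hT).and (hT.imp hS)).congr fun F _ _ x => by tauto

lemma FD.false : FD (fun (F : Type u) [Field F] (_ : α → F) => False) :=
  ⟨∅, .empty, fun F _ _ x => by simp⟩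

lemma FD.forall_finite {ι : Type*} [Finite ι] {S : ι → ∀ (F : Type u) [Field F], (α → F) → Prop}
    (h : ∀ i, FD (S i)) : FD (fun F _ x => ∀ i, S i F x) := by
  choose C hC h using h
  exact ⟨⋂ i, C i, .iInter hC, fun F _ _ x => by simp [h]⟩

lemma FD.eq {s t : ∀ (F : Type u) [Field F], (α → F) → F} (hs : FT s) (ht : FT t) :
    FD (fun F _ x => s F x = t F x) := by
  obtain ⟨p, hp⟩ := hs
  obtain ⟨q, hq⟩ := ht
  refine ⟨(PrimeSpectrum.basicOpen (p - q) : Set _)ᶜ,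
    PrimeSpectrum.isConstructible_basicOpen.compl, fun F _ _ x => ?_⟩
  simp [mem_specPoint, hp, hq, sub_eq_zero]

/-- Constructible sets pull back along maps of spectra, and the point given by $s(x)$ is the image
of the point given by $x$. -/
lemma FD.subst {S : ∀ (F : Type u) [Field F], (β → F) → Prop} (h : FD S)
    {s : β → ∀ (F : Type u) [Field F], (α → F) → F} (hs : ∀ b, FT (s b)) :
    FD (fun F _ x => S F fun b => s b F x) := by
  obtain ⟨C, hC, h⟩ := h
  choose p hp using hs
  obtain ⟨C, rfl⟩ := PrimeSpectrum.exists_constructibleSetData_iff.2 hC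
  refine ⟨(C.map (aeval p : MvPolynomial β ℤ →ₐ[ℤ] MvPolynomial α ℤ).toRingHom).toSet,
    PrimeSpectrum.exists_constructibleSetData_iff.1 ⟨_, rfl⟩, fun F _ _ x => ?_⟩
  refine (h F _).trans ?_
  rw [PrimeSpectrum.ConstructibleSetData.toSet_map, Set.mem_preimage]
  congr! 1
  ext q
  change _ ↔ _ ∈ (specPoint x).asIdeal
  rw [mem_specPoint, mem_specPoint]
  simp only [hp]
  rw [← comp_aeval]
  rfl

lemma FD.comp {S : ∀ (F : Type u) [Field F], (β → F) → Prop} (h : FD S) (f : β → α) :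
    FD (fun F _ x => S F fun b => x (f b)) :=
  h.subst fun b => FT.var (f b)

/-- A system of polynomial equations and an inequation that are solvable over some common extension
are solvable over an algebraically closed field. -/
lemma exists_specPoint_mem {F : Type u} [Field F] [IsAlgClosed F] [Finite β] (x : α → F)
    (Q : PrimeSpectrum (MvPolynomial (α ⊕ β) ℤ))
    (hQ : PrimeSpectrum.comap (rename Sum.inl : MvPolynomial α ℤ →ₐ[ℤ] _).toRingHom Q = specPoint x)
    (C : PrimeSpectrum.BasicConstructibleSetData (MvPolynomial (α ⊕ β) ℤ)) (hC : Q ∈ C.toSet) :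
    ∃ y : β → F, specPoint (Sum.elim x y) ∈ C.toSet := by
  set R := MvPolynomial α ℤ ⧸ (specPoint x).asIdeal
  set B := MvPolynomial (α ⊕ β) ℤ ⧸ Q.asIdeal
  set L := FractionRing B
  have hQ' (p : MvPolynomial α ℤ) : rename Sum.inl p ∈ Q.asIdeal ↔ aeval x p = 0 := by
    rw [← mem_specPoint, ← hQ]; rfl
  let iF : R →+* F := Ideal.Quotient.lift _ (aeval x : MvPolynomial α ℤ →ₐ[ℤ] F).toRingHom
    fun p hp => (mem_specPoint x p).1 hp
  let iB : R →+* B := Ideal.Quotient.lift _ ((Ideal.Quotient.mk Q.asIdeal).comp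
    (rename Sum.inl : MvPolynomial α ℤ →ₐ[ℤ] _).toRingHom) fun p hp =>
      Ideal.Quotient.eq_zero_iff_mem.2 ((hQ' p).2 ((mem_specPoint x p).1 hp))
  have hiF : Function.Injective iF := by
    rw [injective_iff_map_eq_zero]
    intro p hp
    obtain ⟨p, rfl⟩ := Ideal.Quotient.mk_surjective p
    exact Ideal.Quotient.eq_zero_iff_mem.2 ((mem_specPoint x p).2 hp)
  have hiB : Function.Injective iB := by
    rw [injective_iff_map_eq_zero]
    intro p hp
    obtain ⟨p, rfl⟩ := Ideal.Quotient.mk_surjective p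
    exact Ideal.Quotient.eq_zero_iff_mem.2 ((mem_specPoint x p).2
      ((hQ' p).1 (Ideal.Quotient.eq_zero_iff_mem.1 hp)))
  let _ : Algebra R F := iF.toAlgebra
  let _ : Algebra R L := ((algebraMap B L).comp iB).toAlgebra
  -- The fields $F$ and $L$ contain the common domain $R$, so they have a common extension $\Omega$,
  -- a residue field of the tensor product. The generic point of $Q$ solves the system in $\Omega$.
  have : Nontrivial (TensorProduct R F L) :=
    Algebra.TensorProduct.nontrivial_of_algebraMap_injective_of_isDomain R F L hiF
      ((IsFractionRing.injective B L).comp hiB)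
  obtain ⟨𝔪, h𝔪⟩ := Ideal.exists_maximal (TensorProduct R F L)
  set Ω := TensorProduct R F L ⧸ 𝔪
  let _ : Field Ω := Ideal.Quotient.field 𝔪
  let jF : F →+* Ω := (Ideal.Quotient.mk 𝔪).comp Algebra.TensorProduct.includeLeftRingHom
  let jL : L →+* Ω := (Ideal.Quotient.mk 𝔪).comp
    (Algebra.TensorProduct.includeRight : L →ₐ[R] TensorProduct R F L).toRingHom
  have hj (r : R) : jF (iF r) = jL (algebraMap B L (iB r)) := by
    change Ideal.Quotient.mk 𝔪 _ = Ideal.Quotient.mk 𝔪 _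
    congr 1
    exact (Algebra.TensorProduct.includeLeft : F →ₐ[R] TensorProduct R F L).commutes r |>.trans
      ((Algebra.TensorProduct.includeRight : L →ₐ[R] TensorProduct R F L).commutes r).symm
  let φ : MvPolynomial (α ⊕ β) ℤ →+* Ω :=
    (jL.comp (algebraMap B L)).comp (Ideal.Quotient.mk Q.asIdeal)
  -- The map $\kappa$ substitutes $x$ for the first variables. Evaluation in $\Omega$ factors
  -- through it, so identities between polynomials over $F$ can be tested in $\Omega$.
  let κ : MvPolynomial (α ⊕ β) ℤ →ₐ[ℤ] MvPolynomial β F :=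
    aeval (Sum.elim (fun a => MvPolynomial.C (x a)) MvPolynomial.X)
  let ω : MvPolynomial β F →+* Ω := eval₂Hom jF fun b => φ (MvPolynomial.X (.inr b))
  have hωκ : ω.comp κ.toRingHom = φ := by
    refine MvPolynomial.ringHom_ext (fun k => ?_) fun i => ?_
    · simp
    · rcases i with a | b
      · have h1 : iF (Ideal.Quotient.mk _ (MvPolynomial.X a)) = x a :=
          (Ideal.Quotient.lift_mk _ _ _).trans (aeval_X x a)
        have h2 : iB (Ideal.Quotient.mk _ (MvPolynomial.X a)) =
            Ideal.Quotient.mk Q.asIdeal (MvPolynomial.X (Sum.inl a)) :=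
          (Ideal.Quotient.lift_mk _ _ _).trans (congrArg _ (rename_X _ a))
        have := hj (Ideal.Quotient.mk _ (MvPolynomial.X a))
        rw [h1, h2] at this
        simpa [ω, κ, φ] using this
      · simp [ω, κ]
  have hφ (p : MvPolynomial (α ⊕ β) ℤ) : φ p = 0 ↔ p ∈ Q.asIdeal := by
    rw [← Ideal.Quotient.eq_zero_iff_mem]
    exact map_eq_zero_iff (jL.comp (algebraMap B L)) (jL.injective.comp (IsFractionRing.injective B L))
  have hκ (y : β → F) (p : MvPolynomial (α ⊕ β) ℤ) :
      aeval y (κ p) = aeval (Sum.elim x y) p := by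
    have : ((aeval y : MvPolynomial β F →ₐ[F] F).restrictScalars ℤ).comp κ = aeval (Sum.elim x y) := by
      ext i
      rcases i with a | b <;> simp [κ]
    exact DFunLike.congr_fun this p
  simp only [PrimeSpectrum.BasicConstructibleSetData.toSet, Set.mem_sdiff,
    PrimeSpectrum.mem_zeroLocus, Set.singleton_subset_iff, Set.range_subset_iff,
    SetLike.mem_coe, mem_specPoint] at hC ⊢
  -- Without a solution over $F$, the Nullstellensatz puts a power of the inequation into the ideal
  -- of the equations. In $\Omega$ the equations hold and the inequation does not vanish.
  by_contra! hno
  have hmem : κ C.f ∈ vanishingIdeal F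
      (zeroLocus F (Ideal.span (Set.range fun i => κ (C.g i)))) := by
    rw [mem_vanishingIdeal_iff]
    intro y hy
    rw [hκ]
    exact hno y fun i => by
      rw [← hκ]
      exact hy _ (Ideal.subset_span ⟨i, rfl⟩)
  rw [vanishingIdeal_zeroLocus_eq_radical, Ideal.mem_radical_iff] at hmem
  obtain ⟨N, hN⟩ := hmem
  obtain ⟨c, hc⟩ := Ideal.mem_span_range_iff_exists_fun.1 hN
  have hωφ (p) : ω (κ p) = φ p := DFunLike.congr_fun hωκ p
  have h0 : φ C.f ^ N = 0 := by
    rw [← hωφ, ← map_pow, ← hc, map_sum]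
    refine Finset.sum_eq_zero fun i _ => ?_
    rw [map_mul, hωφ, (hφ _).2 (hC.1 i), mul_zero]
  exact hC.2 ((hφ _).1 ((pow_eq_zero_iff (by rintro rfl; simp at h0)).1 h0))

/-- Projection corresponds to the image under the map of spectra induced by $\mathbb Z[\alpha] \to
\mathbb Z[\alpha \sqcup \beta]$, which is constructible by Chevalley's theorem. A point of the image
over `specPoint x` need not be given by elements of $F$. `exists_specPoint_mem` replaces it by one
that is. -/
lemma FD.ex [Finite α] [Finite β] {S : ∀ (F : Type u) [Field F], (α → F) → (β → F) → Prop}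
    (h : FD (fun F _ (z : α ⊕ β → F) => S F (fun a => z (.inl a)) fun b => z (.inr b))) :
    FD (fun F _ x => ∃ y : β → F, S F x y) := by
  obtain ⟨C, hC, h⟩ := h
  have hfp : (rename Sum.inl : MvPolynomial α ℤ →ₐ[ℤ]
      MvPolynomial (α ⊕ β) ℤ).toRingHom.FinitePresentation := by
    rw [← RingHom.FinitePresentation.of_finiteType]
    refine RingHom.FiniteType.of_comp_finiteType (f := algebraMap ℤ _) ?_
    rw [show ((rename Sum.inl : MvPolynomial α ℤ →ₐ[ℤ] MvPolynomial (α ⊕ β) ℤ).toRingHom).comp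
      (algebraMap ℤ _) = algebraMap ℤ _ from RingHom.ext_int _ _]
    exact RingHom.finiteType_algebraMap.2 inferInstance
  refine ⟨_, PrimeSpectrum.isConstructible_comap_image hfp hC, fun F _ _ x => ?_⟩
  have h' (y : β → F) : S F x y ↔ specPoint (Sum.elim x y) ∈ C := h F (Sum.elim x y)
  simp only [h']
  constructor
  · rintro ⟨y, hy⟩
    refine ⟨_, hy, ?_⟩
    ext p
    change rename Sum.inl p ∈ (specPoint (Sum.elim x y)).asIdeal ↔ _
    rw [mem_specPoint, mem_specPoint, aeval_rename]
    rfl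
  · rintro ⟨Q, hQ, hQx⟩
    obtain ⟨C, rfl⟩ := PrimeSpectrum.exists_constructibleSetData_iff.2 hC
    simp only [PrimeSpectrum.ConstructibleSetData.toSet, Set.mem_iUnion] at hQ ⊢
    obtain ⟨c, hc, hQ⟩ := hQ
    obtain ⟨y, hy⟩ := exists_specPoint_mem x Q hQx c hQ
    exact ⟨y, c, hc, hy⟩

lemma FD.all [Finite α] [Finite β] {S : ∀ (F : Type u) [Field F], (α → F) → (β → F) → Prop}
    (h : FD (fun F _ (z : α ⊕ β → F) => S F (fun a => z (.inl a)) fun b => z (.inr b))) :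
    FD (fun F _ x => ∀ y : β → F, S F x y) :=
  (FD.ex (S := fun F _ x y => ¬ S F x y) h.not).not.congr fun F _ _ x => by simp

end Constructible
end GrassModule

namespace GrassModule

open MvPolynomial Topology

/-! ### Quantifier free formulas in the language of fields -/

section Formulas

open FirstOrder Language

variable {α : Type}

/-- The truth of a formula of the language of fields in a field. -/
def FieldHolds (φ : fieldLang.Formula α) (F : Type u) [Field F] (x : α → F) : Prop :=
  letI := fieldStructure F
  φ.Realize x

/-- The value of a term of the language of fields in a field. -/
def fieldValue (t : fieldLang.Term α) (F : Type u) [Field F] (x : α → F) : F :=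
  letI := fieldStructure F
  t.realize x

lemma fieldValue_func {k : ℕ} (f : FieldFun k) (ts : Fin k → fieldLang.Term α) (F : Type u)
    [Field F] (x : α → F) : fieldValue (.func f ts) F x =
      (fieldStructure F).funMap f fun i => fieldValue (ts i) F x := rfl

lemma FT.fieldValue (t : fieldLang.Term α) :
    FT (fun (F : Type u) [Field F] (x : α → F) => fieldValue t F x) := by
  induction t with
  | var a => exact FT.var a
  | func f ts ih =>
    simp only [fieldValue_func]
    cases f with
    | zero => exact FT.zero
    | one => exact FT.one
    | add => exact (ih 0).add (ih 1)
    | mul => exact (ih 0).mul (ih 1)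

lemma exists_term_add (s t : fieldLang.Term α) : ∃ r : fieldLang.Term α,
    ∀ (F : Type u) [Field F] (x : α → F), fieldValue r F x = fieldValue s F x + fieldValue t F x :=
  ⟨.func FieldFun.add ![s, t], fun _ _ _ => rfl⟩

lemma exists_term_mul (s t : fieldLang.Term α) : ∃ r : fieldLang.Term α,
    ∀ (F : Type u) [Field F] (x : α → F), fieldValue r F x = fieldValue s F x * fieldValue t F x :=
  ⟨.func FieldFun.mul ![s, t], fun _ _ _ => rfl⟩

lemma exists_term_natCast (k : ℕ) : ∃ r : fieldLang.Term α,
    ∀ (F : Type u) [Field F] (x : α → F), fieldValue r F x = k := by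
  induction k with
  | zero => exact ⟨.func FieldFun.zero ![], fun F _ x => Nat.cast_zero.symm⟩
  | succ k ih =>
    obtain ⟨r, hr⟩ := ih
    obtain ⟨r', hr'⟩ := exists_term_add.{u} r (.func FieldFun.one ![])
    refine ⟨r', fun F _ x => ?_⟩
    rw [hr', hr, Nat.cast_succ]
    rfl

/-- A polynomial over `ℤ` is a difference of terms. -/
lemma exists_terms_sub (p : MvPolynomial α ℤ) : ∃ s t : fieldLang.Term α,
    ∀ (F : Type u) [Field F] (x : α → F), aeval x p = fieldValue s F x - fieldValue t F x := by
  induction p using MvPolynomial.induction_on with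
  | C k =>
    obtain ⟨s, hs⟩ := exists_term_natCast.{u} (α := α) k.toNat
    obtain ⟨t, ht⟩ := exists_term_natCast.{u} (α := α) (-k).toNat
    refine ⟨s, t, fun F _ x => ?_⟩
    rw [hs, ht]
    have : (k : F) = ((k.toNat - (-k).toNat : ℤ) : F) := by rw [Int.toNat_sub_toNat_neg]
    rw [aeval_C, eq_intCast, this, Int.cast_sub, Int.cast_natCast, Int.cast_natCast]
  | add p q hp hq =>
    obtain ⟨s, t, h⟩ := hp
    obtain ⟨s', t', h'⟩ := hq
    obtain ⟨a, ha⟩ := exists_term_add.{u} s s'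
    obtain ⟨b, hb⟩ := exists_term_add.{u} t t'
    refine ⟨a, b, fun F _ x => ?_⟩
    rw [ha, hb, map_add, h, h']
    ring
  | mul_X p i hp =>
    obtain ⟨s, t, h⟩ := hp
    obtain ⟨a, ha⟩ := exists_term_mul.{u} s (.var i)
    obtain ⟨b, hb⟩ := exists_term_mul.{u} t (.var i)
    refine ⟨a, b, fun F _ x => ?_⟩
    rw [ha, hb, map_mul, h, aeval_X, sub_mul]
    rfl

/-- A relation on tuples of field elements that is defined by a quantifier free formula. -/
def QFDefinable (S : ∀ (F : Type u) [Field F], (α → F) → Prop) : Prop :=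
  ∃ φ : fieldLang.Formula α, φ.IsQF ∧ ∀ (F : Type u) [Field F] (x : α → F),
    FieldHolds φ F x ↔ S F x

lemma QFDefinable.imp {S T : ∀ (F : Type u) [Field F], (α → F) → Prop} (hS : QFDefinable S)
    (hT : QFDefinable T) : QFDefinable (fun F _ x => S F x → T F x) := by
  obtain ⟨φ, hφ, h⟩ := hS
  obtain ⟨ψ, hψ, h'⟩ := hT
  exact ⟨φ.imp ψ, hφ.imp hψ, fun F _ x => by dsimp only; rw [← h, ← h']; rfl⟩

lemma QFDefinable.false : QFDefinable (fun (F : Type u) [Field F] (_ : α → F) => False) :=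
  ⟨.falsum, .falsum, fun _ _ _ => Iff.rfl⟩

lemma QFDefinable.congr {S T : ∀ (F : Type u) [Field F], (α → F) → Prop} (hS : QFDefinable S)
    (hST : ∀ (F : Type u) [Field F] (x : α → F), T F x ↔ S F x) : QFDefinable T := by
  obtain ⟨φ, hφ, h⟩ := hS
  exact ⟨φ, hφ, fun F _ x => (h F x).trans (hST F x).symm⟩

lemma QFDefinable.and {S T : ∀ (F : Type u) [Field F], (α → F) → Prop} (hS : QFDefinable S)
    (hT : QFDefinable T) : QFDefinable (fun F _ x => S F x ∧ T F x) :=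
  ((hS.imp (hT.imp .false)).imp .false).congr fun F _ x => by tauto

lemma QFDefinable.forall_mem {ι : Type*} (I : Finset ι)
    {S : ι → ∀ (F : Type u) [Field F], (α → F) → Prop} (h : ∀ i, QFDefinable (S i)) :
    QFDefinable (fun F _ x => ∀ i ∈ I, S i F x) := by
  classical
  induction I using Finset.induction_on with
  | empty => exact (QFDefinable.false.imp .false).congr fun F _ x => by simp
  | insert i I _ ih => exact ((h i).and ih).congr fun F _ x => by simp

lemma QFDefinable.exists_mem {ι : Type*} (I : Finset ι)
    {S : ι → ∀ (F : Type u) [Field F], (α → F) → Prop} (h : ∀ i, QFDefinable (S i)) :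
    QFDefinable (fun F _ x => ∃ i ∈ I, S i F x) := by
  refine ((QFDefinable.forall_mem I fun i => (h i).imp .false).imp .false).congr fun F _ x => ?_
  simp

lemma QFDefinable.aeval_eq_zero (p : MvPolynomial α ℤ) :
    QFDefinable (fun (F : Type u) [Field F] (x : α → F) => aeval x p = 0) := by
  obtain ⟨s, t, h⟩ := exists_terms_sub.{u} p
  refine ⟨s.equal t, BoundedFormula.IsQF.of_isAtomic (.equal _ _), fun F _ x => ?_⟩
  dsimp only
  rw [h, sub_eq_zero]
  let _ := fieldStructure F
  exact Formula.realize_equal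

/-- Elimination of quantifiers for algebraically closed fields. -/
theorem FD.exists_formula {S : ∀ (F : Type u) [Field F], (α → F) → Prop} (h : FD S) :
    ∃ φ : fieldLang.Formula α, φ.IsQF ∧ ∀ (F : Type u) [Field F] [IsAlgClosed F] (x : α → F),
      FieldHolds φ F x ↔ S F x := by
  obtain ⟨C, hC, h⟩ := h
  obtain ⟨C, rfl⟩ := PrimeSpectrum.exists_constructibleSetData_iff.2 hC
  have hc (c : PrimeSpectrum.BasicConstructibleSetData (MvPolynomial α ℤ)) :
      QFDefinable (fun (F : Type u) [Field F] (x : α → F) =>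
        (∀ i ∈ Finset.univ, aeval x (c.g i) = 0) ∧ (aeval x c.f = 0 → False)) :=
    (QFDefinable.forall_mem Finset.univ fun i => QFDefinable.aeval_eq_zero (c.g i)).and
      ((QFDefinable.aeval_eq_zero c.f).imp .false)
  obtain ⟨φ, hφ, h'⟩ := QFDefinable.exists_mem C hc
  refine ⟨φ, hφ, fun F _ _ x => ?_⟩
  rw [h', h]
  simp [PrimeSpectrum.ConstructibleSetData.toSet, PrimeSpectrum.BasicConstructibleSetData.toSet,
    PrimeSpectrum.mem_zeroLocus, Set.range_subset_iff, mem_specPoint]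
  exact exists_congr fun c => by tauto

theorem FD.of_formula {φ : fieldLang.Formula α} (hφ : φ.IsQF) :
    FD (fun (F : Type u) [Field F] (x : α → F) => FieldHolds φ F x) := by
  have key : ∀ {φ : fieldLang.BoundedFormula α 0}, φ.IsQF →
      FD (fun (F : Type u) [Field F] (x : α → F) => FieldHolds φ F x) := by
    intro φ hφ
    induction hφ with
    | falsum => exact FD.false
    | of_isAtomic h =>
      cases h with
      | equal t₁ t₂ =>
        obtain ⟨p, hp⟩ := FT.fieldValue.{u} t₁
        obtain ⟨q, hq⟩ := FT.fieldValue.{u} t₂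
        have hv (i : α ⊕ Fin 0) : FT (fun (F : Type u) [Field F] (x : α → F) =>
            (Sum.elim x Fin.elim0 : α ⊕ Fin 0 → F) i) := by
          rcases i with a | i
          · exact FT.var a
          · exact i.elim0
        refine (FD.eq (FT.aeval hv p) (FT.aeval hv q)).congr fun F _ _ x => ?_
        rw [← hp, ← hq]
        let _ := fieldStructure F
        change BoundedFormula.Realize _ _ _ ↔ _
        rw [BoundedFormula.realize_bdEqual, Subsingleton.elim (default : Fin 0 → F) Fin.elim0]
        rfl
      | rel R ts => exact R.elim
    | imp _ _ h₁ h₂ => exact (h₁.imp h₂).congr fun F _ _ x => Iff.rfl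
  exact key hφ

end Formulas

/-! ### Uniform families of polynomials and subspaces -/

section Families

variable {α β : Type} {n : ℕ}

/-- A family of polynomials in `T₁, …, Tₙ` whose coefficients are polynomials over `ℤ` in
parameters from a field. -/
def UP (p : ∀ (F : Type u) [Field F], (α → F) → MvPolynomial (Fin n) F) : Prop :=
  ∃ P : MvPolynomial (Fin n) (MvPolynomial α ℤ), ∀ (F : Type u) [Field F] (x : α → F),
    p F x = map (aeval x : MvPolynomial α ℤ →ₐ[ℤ] F).toRingHom P

section UP

variable {p q : ∀ (F : Type u) [Field F], (α → F) → MvPolynomial (Fin n) F}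

lemma UP.add (hp : UP p) (hq : UP q) : UP (fun F _ x => p F x + q F x) := by
  obtain ⟨P, hP⟩ := hp
  obtain ⟨Q, hQ⟩ := hq
  exact ⟨P + Q, fun F _ x => by dsimp only; rw [hP, hQ, map_add]⟩

lemma UP.sub (hp : UP p) (hq : UP q) : UP (fun F _ x => p F x - q F x) := by
  obtain ⟨P, hP⟩ := hp
  obtain ⟨Q, hQ⟩ := hq
  exact ⟨P - Q, fun F _ x => by dsimp only; rw [hP, hQ, map_sub]⟩

lemma UP.mul (hp : UP p) (hq : UP q) : UP (fun F _ x => p F x * q F x) := by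
  obtain ⟨P, hP⟩ := hp
  obtain ⟨Q, hQ⟩ := hq
  exact ⟨P * Q, fun F _ x => by dsimp only; rw [hP, hQ, map_mul]⟩

lemma UP.sum {ι : Type*} (I : Finset ι)
    {p : ι → ∀ (F : Type u) [Field F], (α → F) → MvPolynomial (Fin n) F} (hp : ∀ i, UP (p i)) :
    UP (fun F _ x => ∑ i ∈ I, p i F x) := by
  choose P hP using hp
  exact ⟨∑ i ∈ I, P i, fun F _ x => by simp only [hP, map_sum]⟩

lemma UP.zero : UP (fun (F : Type u) [Field F] (_ : α → F) => (0 : MvPolynomial (Fin n) F)) :=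
  ⟨0, fun F _ x => by simp⟩

lemma UP.monomial {c : ∀ (F : Type u) [Field F], (α → F) → F} (hc : FT c) (s : Fin n →₀ ℕ) :
    UP (fun F _ x => monomial s (c F x)) := by
  obtain ⟨C, hC⟩ := hc
  exact ⟨MvPolynomial.monomial s C, fun F _ x => by dsimp only; rw [hC, map_monomial]; rfl⟩

lemma UP.map_int (p : MvPolynomial (Fin n) ℤ) :
    UP (fun (F : Type u) [Field F] (_ : α → F) => map (Int.castRingHom F) p) :=
  ⟨map C p, fun F _ x => by
    dsimp only; rw [map_map]
    exact congrArg (fun h => map h p) (RingHom.ext_int _ _)⟩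

lemma UP.map_aeval (P : MvPolynomial (Fin n) (MvPolynomial β ℤ))
    {s : β → ∀ (F : Type u) [Field F], (α → F) → F} (hs : ∀ b, FT (s b)) :
    UP (fun F _ x => map (aeval (fun b => s b F x) : MvPolynomial β ℤ →ₐ[ℤ] F).toRingHom P) := by
  choose q hq using hs
  refine ⟨map (aeval q : MvPolynomial β ℤ →ₐ[ℤ] MvPolynomial α ℤ).toRingHom P, fun F _ x => ?_⟩
  rw [map_map]
  refine congrArg (fun h : MvPolynomial β ℤ →+* F => map h P) (RingHom.ext fun r => ?_)
  change MvPolynomial.aeval (fun b => s b F x) r =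
    MvPolynomial.aeval x (MvPolynomial.aeval q r)
  simp only [hq]
  rw [← AlgHom.comp_apply, comp_aeval]

lemma UP.coeff (hp : UP p) (s : Fin n →₀ ℕ) : FT (fun F _ x => coeff s (p F x)) := by
  obtain ⟨P, hP⟩ := hp
  exact ⟨MvPolynomial.coeff s P, fun F _ x => by dsimp only; rw [hP, coeff_map]; rfl⟩

/-- Equality is tested on coefficients, and only the finitely many exponents in the support of the
generic polynomial matter, whatever the field. -/
lemma UP.eq (hp : UP p) (hq : UP q) : FD (fun F _ x => p F x = q F x) := by
  obtain ⟨P, hP⟩ := hp.sub hq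
  refine FD.congr (FD.forall_finite (ι := P.support)
    fun s => FD.eq (UP.coeff ⟨P, hP⟩ s) FT.zero) fun F _ _ x => ?_
  rw [← sub_eq_zero]
  constructor
  · intro h s
    rw [h, coeff_zero]
  · intro h
    ext s
    by_cases hs : s ∈ P.support
    · rw [h ⟨s, hs⟩, coeff_zero]
    · rw [show p F x - q F x = _ from hP F x, coeff_map, notMem_support_iff.1 hs]
      simp

end UP

/-- The exponents of the monomials of degree at most `d` in each of `n` variables. -/
abbrev Box (n d : ℕ) : Type := Fin n → Fin (d + 1)

/-- A member of `Box n d` as an exponent. -/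
noncomputable def Box.exp {d : ℕ} (μ : Box n d) : Fin n →₀ ℕ :=
  Finsupp.equivFunOnFinite.symm fun i => (μ i : ℕ)

lemma Box.exp_apply {d : ℕ} (μ : Box n d) (i : Fin n) : μ.exp i = μ i := rfl

lemma Box.exp_injective {d : ℕ} : Function.Injective (Box.exp : Box n d → _) := fun μ ν h => by
  funext i
  exact Fin.ext (DFunLike.congr_fun h i)

lemma Box.exists_exp_eq {d : ℕ} {s : Fin n →₀ ℕ} (hs : ∀ i, s i ≤ d) :
    ∃ μ : Box n d, μ.exp = s :=
  ⟨fun i => ⟨s i, by have := hs i; lia⟩, by ext i; rfl⟩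

/-- The polynomial with given coefficients. -/
noncomputable def boxPoly {d : ℕ} {F : Type*} [Field F] :
    (Box n d → F) →ₗ[F] MvPolynomial (Fin n) F :=
  ∑ μ : Box n d, (monomial μ.exp).comp (LinearMap.proj μ)

section boxPoly

variable {F : Type*} [Field F] {d : ℕ}

lemma boxPoly_apply (c : Box n d → F) : boxPoly c = ∑ μ : Box n d, monomial μ.exp (c μ) := by
  simp [boxPoly]

lemma coeff_boxPoly (c : Box n d → F) (μ : Box n d) : coeff μ.exp (boxPoly c) = c μ := by
  classical
  rw [boxPoly_apply, coeff_sum, Finset.sum_eq_single μ]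
  · simp
  · intro ν _ hν
    rw [coeff_monomial, if_neg fun h => hν (Box.exp_injective h)]
  · simp

lemma boxPoly_mem (c : Box n d → F) : boxPoly c ∈ (UniformBounds.box n F).B d := by
  classical
  rw [UniformBounds.mem_box]
  intro s hs i
  rw [boxPoly_apply, coeff_sum] at hs
  obtain ⟨μ, -, hμ⟩ := Finset.exists_ne_zero_of_sum_ne_zero hs
  rw [coeff_monomial] at hμ
  have : μ.exp = s := by
    by_contra h
    simp [h] at hμ
  rw [← this, Box.exp_apply]
  have := (μ i).2
  lia

/-- The coefficients of a polynomial. -/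
noncomputable def boxCoeff (d : ℕ) (p : MvPolynomial (Fin n) F) : Box n d → F :=
  fun μ => coeff μ.exp p

lemma boxPoly_boxCoeff {p : MvPolynomial (Fin n) F} (hp : p ∈ (UniformBounds.box n F).B d) :
    boxPoly (boxCoeff d p) = p := by
  ext s
  by_cases h : ∀ i, s i ≤ d
  · obtain ⟨μ, rfl⟩ := Box.exists_exp_eq h
    rw [coeff_boxPoly]
    rfl
  · have key (q) (hq : q ∈ (UniformBounds.box n F).B d) : coeff s q = 0 := by
      by_contra hne
      exact h (UniformBounds.mem_box.1 hq s hne)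
    rw [key _ hp, key _ (boxPoly_mem _)]

lemma UP.boxPoly {d : ℕ} {c : Box n d → ∀ (F : Type u) [Field F], (α → F) → F}
    (hc : ∀ μ, FT (c μ)) : UP (fun F _ x => boxPoly fun μ => c μ F x) := by
  simp only [boxPoly_apply]
  exact UP.sum _ fun μ => UP.monomial (hc μ) _

end boxPoly

/-- The space that is spanned by the rows of a matrix. -/
def rspan {F ρ ι : Type*} [Field F] (X : ρ × ι → F) : Submodule F (ι → F) :=
  Submodule.span F (Set.range fun a b => X (a, b))

/-- The rows are the images of the standard basis under a linear projection onto $W$. -/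
lemma exists_rspan_eq {F ι : Type*} [Field F] [Finite ι] (W : Submodule F (ι → F)) :
    ∃ X : ι × ι → F, rspan X = W := by
  classical
  obtain ⟨g, hg⟩ := LinearMap.exists_leftInverse_of_injective W.subtype W.ker_subtype
  have _ := Fintype.ofFinite ι
  refine ⟨fun ab => (g (Pi.single ab.1 1) : ι → F) ab.2, ?_⟩
  have h1 : (Set.range fun a b => (g (Pi.single a 1) : ι → F) b) =
      (W.subtype ∘ₗ g) '' Set.range (Pi.basisFun F ι) := by
    rw [← Set.range_comp]
    congr 1
  rw [rspan, h1, Submodule.span_image, (Pi.basisFun F ι).span_eq, Submodule.map_top,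
    LinearMap.range_comp, LinearMap.range_eq_top.2, Submodule.map_top, Submodule.range_subtype]
  exact fun w => ⟨w, DFunLike.congr_fun hg w⟩

lemma FD.mem_rspan [Finite α] {ρ ι : Type} [Finite ρ] [Finite ι]
    {X : ρ × ι → ∀ (F : Type u) [Field F], (α → F) → F} (hX : ∀ ab, FT (X ab))
    {r : ι → ∀ (F : Type u) [Field F], (α → F) → F} (hr : ∀ b, FT (r b)) :
    FD (fun F _ x => (fun b => r b F x) ∈ rspan fun ab => X ab F x) := by
  have _ := Fintype.ofFinite ρ
  have hcomp {t : ∀ (F : Type u) [Field F], (α → F) → F} (ht : FT t) :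
      FT (fun F _ (z : α ⊕ ρ → F) => t F fun a => z (.inl a)) := by
    obtain ⟨p, hp⟩ := ht
    simp only [hp]
    exact FT.aeval (fun a => FT.var _) p
  refine FD.congr (FD.ex (β := ρ)
    (S := fun F _ x c => ∀ b, ∑ a, c a * X (a, b) F x = r b F x) ?_) fun F _ _ x => ?_
  · exact FD.forall_finite fun b => FD.eq
      (FT.sum _ fun a => (FT.var _).mul (hcomp (hX _))) (hcomp (hr b))
  · rw [rspan, Submodule.mem_span_range_iff_exists_fun]
    simp only [funext_iff, Finset.sum_apply, Pi.smul_apply, smul_eq_mul]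

end Families

end GrassModule

/-! ### Models with their field and module as instances -/

namespace GrassModule

open MvPolynomial MSLanguage

lemma evalOps_X {F V : Type u} [Field F] [AddCommGroup V] [Module F V] {n : ℕ}
    (T : Fin n → Module.End F V) (hT : ∀ i j, Commute (T i) (T j)) (i : Fin n) :
    evalOps T hT (X i) = T i := by
  simp only [evalOps, AlgHom.comp_apply, aeval_X]
  rfl

/-- A structure whose field and module sorts are a field and a module with commuting operators. -/
class BMdl {n : ℕ} (N : Str.{u} (lang n)) where
  [field : Field (K N)]
  [addCommGroup : AddCommGroup (M N)]
  [module : Module (K N) (M N)]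
  kadd_eq (x y : K N) : kadd N x y = x + y
  kmul_eq (x y : K N) : kmul N x y = x * y
  kzero_eq : kzero N = 0
  kone_eq : kone N = 1
  madd_eq (v w : M N) : madd N v w = v + w
  mzero_eq : mzero N = 0
  smul_eq (x : K N) (v : M N) : smul N x v = x • v
  /-- the operators -/
  T : Fin n → Module.End (K N) (M N)
  op_eq (j : Fin n) (v : M N) : op N j v = T j v
  commute (i j : Fin n) : Commute (T i) (T j)

attribute [reducible, instance] BMdl.field BMdl.addCommGroup BMdl.module

section

variable {n : ℕ} (I : Ideal (MvPolynomial (Fin n) ℤ)) (N : Str.{u} (lang n))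

/-- The action of polynomials on `M`. -/
noncomputable def ev [BMdl N] : MvPolynomial (Fin n) (K N) →ₐ[K N] Module.End (K N) (M N) :=
  evalOps BMdl.T BMdl.commute

/-- The axioms of `𝔗_I` beyond those for the field, the module and the operators. -/
structure TProps [BMdl N] : Prop where
  proj_surjective (i : ℕ+) (p : G N i) : ∃ X, proj N X = p
  proj_eq_iff (i : ℕ+) (X Y : Fin i × Fin i → K N) :
    proj N X = proj N Y ↔ rowSpan X = rowSpan Y
  pred_iff (r : Rel) (p : (j : Fin r.m) → G N (r.k j)) (x : Fin r.l → K N) :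
    pred N r p x ↔
      ∃ X : (j : Fin r.m) → Fin (r.k j) × Fin (r.k j) → K N,
        r.Holds X x ∧ ∀ j, proj N (X j) = p j
  dep_eq_iff (i : ℕ+) (v : Fin i → M N) (X : Fin i × Fin i → K N) :
    dep N v = proj N X ↔ rowSpan X = relations v
  ideal_eq_zero (p : MvPolynomial (Fin n) ℤ) (hp : p ∈ I) :
    ev N (MvPolynomial.map (Int.castRingHom (K N)) p) = 0

variable {I N}

/-- The field, the module and the operators of a model. -/
abbrev TModel.toBMdl (d : TModel I N) : BMdl N where
  field := d.field
  addCommGroup := d.addCommGroup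
  module := d.module
  kadd_eq := d.kadd_eq
  kmul_eq := d.kmul_eq
  kzero_eq := d.kzero_eq
  kone_eq := d.kone_eq
  madd_eq := d.madd_eq
  mzero_eq := d.mzero_eq
  smul_eq := d.smul_eq
  T := d.T
  op_eq := d.op_eq
  commute := d.commute

lemma TModel.tprops (d : TModel I N) : letI := d.toBMdl; TProps I N :=
  letI := d.toBMdl
  ⟨d.proj_surjective, d.proj_eq_iff, d.pred_iff, d.dep_eq_iff, d.ideal_eq_zero⟩

/-- The model that consists of given data. -/
def TProps.toTModel [b : BMdl N] (h : TProps I N) : TModel I N where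
  field := b.field
  addCommGroup := b.addCommGroup
  module := b.module
  kadd_eq := b.kadd_eq
  kmul_eq := b.kmul_eq
  kzero_eq := b.kzero_eq
  kone_eq := b.kone_eq
  madd_eq := b.madd_eq
  mzero_eq := b.mzero_eq
  smul_eq := b.smul_eq
  T := b.T
  op_eq := b.op_eq
  commute := b.commute
  proj_surjective := h.proj_surjective
  proj_eq_iff := h.proj_eq_iff
  pred_iff := h.pred_iff
  dep_eq_iff := h.dep_eq_iff
  ideal_eq_zero := h.ideal_eq_zero

/-- Elements of $\mathbb A$ are replaced by representatives: membership in an ideal of the quotient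
is membership in the sum with $\hat I$, and a relation in $\mathbb A$ is a sum lying in $\hat I$. -/
lemma TModel.solvable_iff (d : TModel I N) : letI := d.toBMdl
    d.Solvable ↔ IsSolvable (ev N) (extIdeal (K N) I) := by
  let _ := d.toBMdl
  have hmem {m : ℕ} (f : Fin m → MvPolynomial (Fin n) (K N)) (g : MvPolynomial (Fin n) (K N)) :
      Ideal.Quotient.mk (extIdeal (K N) I) g ∈
        Ideal.span (Set.range fun i => Ideal.Quotient.mk (extIdeal (K N) I) (f i)) ↔
      g ∈ Ideal.span (Set.range f) ⊔ extIdeal (K N) I := by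
    rw [← Ideal.mem_quotient_iff_mem_sup, Ideal.map_span, ← Set.range_comp]
    rfl
  constructor
  · intro h m k r f g v u hg ht
    exact h m k r (fun i => Ideal.Quotient.mk _ (f i)) (fun i => Ideal.Quotient.mk _ (g i)) v u
      (fun j => (hmem f (g j)).not.2 (hg j)) fun t htf => by
        choose t' ht' using fun i => Ideal.Quotient.mk_surjective (t i)
        obtain rfl : (fun i => Ideal.Quotient.mk _ (t' i)) = t := funext ht'
        refine ht t' ?_
        rw [← Ideal.Quotient.eq_zero_iff_mem, map_sum, ← htf]
        simp
  · intro h m k r f g v u hg ht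
    choose f' hf' using fun i => Ideal.Quotient.mk_surjective (f i)
    choose g' hg' using fun i => Ideal.Quotient.mk_surjective (g i)
    obtain rfl : (fun i => Ideal.Quotient.mk _ (f' i)) = f := funext hf'
    obtain rfl : (fun i => Ideal.Quotient.mk _ (g' i)) = g := funext hg'
    exact h m k r f' g' v u (fun j => (hmem f' (g' j)).not.1 (hg j)) fun t htf =>
      ht (fun i => Ideal.Quotient.mk _ (t i)) (by
        rw [← Ideal.Quotient.eq_zero_iff_mem, map_sum] at htf
        rw [← htf]
        simp)

variable (I N) in
/-- The models of the theory that eliminates quantifiers. -/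
structure Good [BMdl N] : Prop where
  tprops : TProps I N
  isAlgClosed : IsAlgClosed (K N)
  isSolvable : IsSolvable (ev N) (extIdeal (K N) I)

lemma TModel.good (d : TModel I N) (h₁ : d.AlgClosed) (h₂ : d.Solvable) :
    letI := d.toBMdl; Good I N :=
  letI := d.toBMdl
  ⟨d.tprops, h₁, d.solvable_iff.1 h₂⟩

end

end GrassModule

/-! ### Relations of bounded degree and adjunction of one vector -/

namespace GrassModule

open MvPolynomial Module UniformBounds

section Relations

variable {F V : Type u} [Field F] [AddCommGroup V] [Module F V] {n : ℕ}
  (ev : MvPolynomial (Fin n) F →ₐ[F] End F V) {A : Type} [Fintype A]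

/-- Linear combinations of the vectors that arise from `v` by application of monomials. -/
noncomputable def relMap (e : ℕ) (v : A → V) : (A × Box n e → F) →ₗ[F] V :=
  ∑ a, (LinearMap.applyₗ (v a)).comp (ev.toLinearMap.comp
    (boxPoly.comp (LinearMap.funLeft F F fun μ => (a, μ))))

/-- The linear relations between the vectors that arise from `v` by application of monomials. -/
noncomputable def relSub (e : ℕ) (v : A → V) : Submodule F (A × Box n e → F) :=
  LinearMap.ker (relMap ev e v)

lemma relMap_apply (e : ℕ) (v : A → V) (r : A × Box n e → F) :
    relMap ev e v r = ∑ a, ev (boxPoly fun μ => r (a, μ)) (v a) := by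
  simp only [relMap, LinearMap.sum_apply]
  rfl

lemma mem_relSub {e : ℕ} {v : A → V} {r : A × Box n e → F} :
    r ∈ relSub ev e v ↔ ∑ a, ev (boxPoly fun μ => r (a, μ)) (v a) = 0 := by
  rw [relSub, LinearMap.mem_ker, relMap_apply]

lemma boxCoeff_mem_relSub {e : ℕ} {v : A → V} {p : A → MvPolynomial (Fin n) F}
    (hp : ∀ a, p a ∈ (box n F).B e) :
    (fun aμ : A × Box n e => coeff aμ.2.exp (p aμ.1)) ∈ relSub ev e v ↔ ∑ a, ev (p a) (v a) = 0 := by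
  rw [mem_relSub]
  have h (a : A) : (boxPoly fun μ : Box n e => coeff μ.exp (p a)) = p a := boxPoly_boxCoeff (hp a)
  simp only [h]

variable {ev} {J : Ideal (MvPolynomial (Fin n) F)}

lemma IsSolvable.exists_independent_fintype (hsol : IsSolvable ev J) {ι : Type*} [Fintype ι]
    (f : ι → MvPolynomial (Fin n) F) (v : ι → V)
    (hv : ∀ t : ι → MvPolynomial (Fin n) F, ∑ i, t i * f i ∈ J → ∑ i, ev (t i) (v i) = 0)
    (U : V → Submodule F V) (hU : ∀ x, (U x).FG)
    (hUx : ∀ x y, (∀ i, ev (f i) x = ev (f i) y) → U x = U y)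
    (W : Submodule F (MvPolynomial (Fin n) F)) (hWfg : W.FG)
    (hW : ∀ h ∈ W, h ∈ Ideal.span (Set.range f) ⊔ J → h = 0) :
    ∃ x : V, (∀ i, ev (f i) x = v i) ∧ ∀ h ∈ W, ev h x ∈ U x → h = 0 := by
  set e := Fintype.equivFin ι
  have hr : Set.range (fun i => f (e.symm i)) = Set.range f := e.symm.surjective.range_comp f
  obtain ⟨x, hx, hx'⟩ := hsol.exists_independent (fun i => f (e.symm i)) (fun i => v (e.symm i))
    (fun t ht => by
      rw [← hv (fun i => t (e i)), ← e.sum_comp]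
      · simp
      · rw [← e.sum_comp] at ht
        simpa using ht) U hU (fun x y h => hUx x y fun i => by simpa using h (e i)) W hWfg
      (by rwa [hr])
  exact ⟨x, fun i => by simpa using hx (e i), hx'⟩

/-- The condition that a matrix `X'` describes the relations between given vectors and a further
vector, in terms of a matrix `X` that describes the relations between the given vectors. -/
def ExtCond {q : ℕ} (p : Fin q → MvPolynomial (Fin n) ℤ) (A : Type) [Fintype A] (d D e : ℕ)
    (F : Type u) [Field F]
    (X' : (Option A × Box n d) × (Option A × Box n d) → F)
    (X : (A × Box n e) × (A × Box n e) → F) : Prop :=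
  ∀ y : ((Option A × Box n d) × Box n D) ⊕ ((Fin q × Box n D) ⊕ (Option A × Box n d)) → F,
    ∑ i, (boxPoly fun μ => y (.inl (i, μ))) * (boxPoly fun μ => X' (i, (none, μ))) +
      ∑ j, (boxPoly fun μ => y (.inr (.inl (j, μ)))) * map (Int.castRingHom F) (p j) =
      (boxPoly fun μ => y (.inr (.inr (none, μ)))) →
    ((fun aμ : A × Box n e => coeff aμ.2.exp
        (∑ i, (boxPoly fun μ => y (.inl (i, μ))) * (boxPoly fun μ => X' (i, (some aμ.1, μ))) -
          boxPoly fun μ => y (.inr (.inr (some aμ.1, μ))))) ∈ rspan X ↔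
      (fun i => y (.inr (.inr i))) ∈ rspan X')

/-- Products of polynomials of degrees at most $d$ and $D$ have degree at most $e$, so their
coefficients fit the relation space that $X$ describes. Membership in its row space then says that a
combination of the $v_a$ vanishes. -/
lemma ext_cond_polynomials {q : ℕ} (p : Fin q → MvPolynomial (Fin n) ℤ) {d D e : ℕ}
    (he : d + D ≤ e) {v : A → V} {X' : (Option A × Box n d) × (Option A × Box n d) → F}
    {X : (A × Box n e) × (A × Box n e) → F} (hX : rspan X = relSub ev e v) :
    ExtCond p A d D e F X' X ↔
    ∀ (t : Option A × Box n d → MvPolynomial (Fin n) F) (s : Fin q → MvPolynomial (Fin n) F)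
      (w : Option A × Box n d → F), (∀ i, t i ∈ (box n F).B D) → (∀ j, s j ∈ (box n F).B D) →
      ∑ i, t i * (boxPoly fun μ => X' (i, (none, μ))) +
        ∑ j, s j * map (Int.castRingHom F) (p j) = (boxPoly fun μ => w (none, μ)) →
      (∑ a, ev (∑ i, t i * (boxPoly fun μ => X' (i, (some a, μ))) -
          boxPoly fun μ => w (some a, μ)) (v a) = 0 ↔ w ∈ rspan X') := by
  have key (t : Option A × Box n d → MvPolynomial (Fin n) F) (w : Option A × Box n d → F)
      (ht : ∀ i, t i ∈ (box n F).B D) :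
      (fun aμ : A × Box n e => coeff aμ.2.exp
        (∑ i, t i * (boxPoly fun μ => X' (i, (some aμ.1, μ))) -
          boxPoly fun μ => w (some aμ.1, μ))) ∈ rspan X ↔
      ∑ a, ev (∑ i, t i * (boxPoly fun μ => X' (i, (some a, μ))) -
          boxPoly fun μ => w (some a, μ)) (v a) = 0 := by
    rw [hX]
    refine boxCoeff_mem_relSub (p := fun a => ∑ i, t i * (boxPoly fun μ => X' (i, (some a, μ))) -
      boxPoly fun μ => w (some a, μ)) ev fun a => sub_mem (sum_mem fun i _ => ?_) ?_
    · refine (box n F).mono he ?_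
      rw [add_comm]
      exact (box n F).mul_mem (ht i) (boxPoly_mem _)
    · exact (box n F).mono (by lia) (boxPoly_mem _)
  constructor
  · intro h t s w ht hs htw
    have h1 := h (Sum.elim (fun iμ => boxCoeff D (t iμ.1) iμ.2)
      (Sum.elim (fun jμ => boxCoeff D (s jμ.1) jμ.2) w))
    simp only [Sum.elim_inl, Sum.elim_inr] at h1
    simp only [fun i => boxPoly_boxCoeff (ht i), fun i => boxPoly_boxCoeff (hs i)] at h1
    rw [← key t w ht]
    exact h1 htw
  · intro h y hy
    have h1 := h (fun i => boxPoly fun μ => y (.inl (i, μ)))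
      (fun j => boxPoly fun μ => y (.inr (.inl (j, μ)))) (fun i => y (.inr (.inr i)))
      (fun i => boxPoly_mem _) (fun i => boxPoly_mem _) hy
    rw [← h1]
    exact key (fun i => boxPoly fun μ => y (.inl (i, μ))) (fun i => y (.inr (.inr i)))
      fun i => boxPoly_mem _

lemma ev_sum_option {d : ℕ} {v : A → V} (x : V) {r : Option A × Box n d → F} :
    r ∈ relSub ev d (fun o : Option A => o.elim x v) ↔ ev (boxPoly fun μ => r (none, μ)) x +
      ∑ a, ev (boxPoly fun μ => r (some a, μ)) (v a) = 0 := by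
  rw [mem_relSub, Fintype.sum_option]
  rfl

variable {I : Ideal (MvPolynomial (Fin n) ℤ)}

/-- One direction of the elimination of a quantifier over the module. -/
lemma extCond_of_exists {q : ℕ} {p : Fin q → MvPolynomial (Fin n) ℤ}
    (hev : ∀ j, ev (map (Int.castRingHom F) (p j)) = 0) {d D e : ℕ}
    (he : d + D ≤ e) {v : A → V} {X' : (Option A × Box n d) × (Option A × Box n d) → F}
    {X : (A × Box n e) × (A × Box n e) → F} (hX : rspan X = relSub ev e v) (x : V)
    (hX' : rspan X' = relSub ev d (fun o : Option A => o.elim x v)) :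
    ExtCond p A d D e F X' X := by
  rw [ext_cond_polynomials p he hX]
  intro t s w ht hs htw
  -- The rows, being relations, say $f_i x = v'_i$. Hence $\sum t_i f_i$ applied to $x$ equals $\sum
  -- t_i v'_i$, in which $x$ no longer occurs.
  have hrow (i) : ev (boxPoly fun μ => X' (i, (none, μ))) x =
      - ∑ a, ev (boxPoly fun μ => X' (i, (some a, μ))) (v a) := by
    rw [eq_neg_iff_add_eq_zero]
    refine (ev_sum_option x (r := fun j => X' (i, j))).1 ?_
    rw [← hX']
    exact Submodule.subset_span ⟨i, rfl⟩
  rw [hX', ev_sum_option, ← htw, map_add, LinearMap.add_apply, map_sum, map_sum]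
  simp only [LinearMap.sum_apply, map_mul, Module.End.mul_apply, hrow, hev, LinearMap.zero_apply,
    map_zero, Finset.sum_const_zero, add_zero, map_neg, map_sub, map_sum, LinearMap.sub_apply,
    Finset.sum_sub_distrib, Finset.sum_neg_distrib]
  rw [Finset.sum_comm, sub_eq_zero, neg_add_eq_zero]

/-- The other direction of the elimination of a quantifier over the module. -/
lemma exists_of_extCond {q : ℕ} {p : Fin q → MvPolynomial (Fin n) ℤ}
    (hev : ∀ h ∈ J, ev h = 0) (hJ : J = extIdeal F (Ideal.span (Set.range p)))
    (hsol : IsSolvable ev J) {d D e : ℕ}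
    (hD : ∀ f : Option A × Box n d → MvPolynomial (Fin n) F, (∀ i, f i ∈ (box n F).B d) →
      (∀ g ∈ (box n F).B d,
        g ∈ Ideal.span (Set.range f) ⊔ GrassModule.extIdeal F (Ideal.span (Set.range p)) →
        ∃ (t : Option A × Box n d → MvPolynomial (Fin n) F) (s : Fin q → MvPolynomial (Fin n) F),
          (∀ i, t i ∈ (box n F).B D) ∧ (∀ j, s j ∈ (box n F).B D) ∧
          ∑ i, t i * f i + ∑ j, s j * map (Int.castRingHom F) (p j) = g) ∧
      ∀ t : Option A × Box n d → MvPolynomial (Fin n) F,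
        ∑ i, t i * f i ∈ GrassModule.extIdeal F (Ideal.span (Set.range p)) →
        ∃ (N : ℕ) (c : Fin N → MvPolynomial (Fin n) F)
          (τ : Fin N → Option A × Box n d → MvPolynomial (Fin n) F)
          (s : Fin N → Fin q → MvPolynomial (Fin n) F),
          (∀ k i, τ k i ∈ (box n F).B D) ∧ (∀ k j, s k j ∈ (box n F).B D) ∧
          (∀ k, ∑ i, τ k i * f i + ∑ j, s k j * map (Int.castRingHom F) (p j) = 0) ∧
          ∀ i, t i = ∑ k, c k * τ k i)
    (he : d + D ≤ e) {v : A → V} {X' : (Option A × Box n d) × (Option A × Box n d) → F}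
    {X : (A × Box n e) × (A × Box n e) → F} (hX : rspan X = relSub ev e v)
    (hc : ExtCond p A d D e F X' X) :
    ∃ x, rspan X' = relSub ev d (fun o : Option A => o.elim x v) := by
  rw [ext_cond_polynomials p he hX] at hc
  set f : Option A × Box n d → MvPolynomial (Fin n) F := fun i => boxPoly fun μ => X' (i, (none, μ))
    with hf
  set v' : Option A × Box n d → V := fun i =>
    - ∑ a, ev (boxPoly fun μ => X' (i, (some a, μ))) (v a) with hv'
  obtain ⟨hD1, hD2⟩ := hD f fun i => boxPoly_mem _
  have hevp (j) : ev (map (Int.castRingHom F) (p j)) = 0 := hev _ (by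
    rw [hJ]
    exact Ideal.mem_map_of_mem _ (Ideal.subset_span ⟨j, rfl⟩))
  have hsum (t : Option A × Box n d → MvPolynomial (Fin n) F) (w : Option A × Box n d → F) :
      ∑ a, ev (∑ i, t i * (boxPoly fun μ => X' (i, (some a, μ))) -
          boxPoly fun μ => w (some a, μ)) (v a) =
        - (∑ i, ev (t i) (v' i) + ∑ a, ev (boxPoly fun μ => w (some a, μ)) (v a)) := by
    simp only [hv', map_sub, map_sum, map_mul, LinearMap.sub_apply, LinearMap.sum_apply,
      Module.End.mul_apply, map_neg, Finset.sum_sub_distrib, Finset.sum_neg_distrib]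
    rw [Finset.sum_comm]
    abel
  -- Compatibility of the system $f_i x = v'_i$: for $w = 0$ the condition says that bounded
  -- syzygies modulo $\hat I$ kill $v'$, and these generate all syzygies.
  have hcomp (t : Option A × Box n d → MvPolynomial (Fin n) F) (ht : ∑ i, t i * f i ∈ J) :
      ∑ i, ev (t i) (v' i) = 0 := by
    rw [hJ] at ht
    obtain ⟨N, c, τ, s, h1, h2, h3, h4⟩ := hD2 t ht
    have h5 (k) : ∑ i, ev (τ k i) (v' i) = 0 := by
      have := (hc (τ k) (s k) 0 (h1 k) (h2 k) (by
        rw [h3]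
        exact (map_zero (boxPoly (n := n) (d := d) (F := F))).symm)).2 (zero_mem _)
      rw [hsum] at this
      have hz : (boxPoly fun _ : Box n d => (0 : F)) = 0 :=
        map_zero (boxPoly (n := n) (d := d) (F := F))
      simpa [hz] using this
    simp only [h4, map_sum, map_mul, LinearMap.sum_apply, Module.End.mul_apply]
    rw [Finset.sum_comm]
    refine Finset.sum_eq_zero fun k _ => ?_
    rw [← map_sum, h5, map_zero]
  set 𝔟 := Ideal.span (Set.range f) ⊔ J with h𝔟
  set Wd : Submodule F (MvPolynomial (Fin n) F) := LinearMap.range (boxPoly (n := n) (d := d)) with hWd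
  have hWdfg : Wd.FG := by
    rw [hWd, LinearMap.range_eq_map]
    exact Module.Finite.fg_top.map _
  have hfg {W : Submodule F (MvPolynomial (Fin n) F)} (hW : W ≤ Wd) : W.FG := by
    have : FiniteDimensional F Wd := (Submodule.fg_iff_finiteDimensional _).1 hWdfg
    exact (Submodule.fg_iff_finiteDimensional _).2 (Submodule.finiteDimensional_of_le hW)
  -- Among the operators of degree at most $d$, those in $\mathfrak b$ have values at $x$ determined
  -- by the equations. On a complement of them the operators are to be independent, modulo the span
  -- of the $T^\mu v_a$ and the determined values.
  set W₀ := Wd ⊓ 𝔟.restrictScalars F with hW₀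
  obtain ⟨W', hW'⟩ := Submodule.exists_isCompl W₀
  have hmod : W₀ ⊔ (W' ⊓ Wd) = Wd := by
    rw [← sup_inf_assoc_of_le _ inf_le_left, hW'.sup_eq_top, top_inf_eq]
  have hdet {x y : V} (hxy : ∀ i, ev (f i) x = ev (f i) y) {h} (hh : h ∈ 𝔟) : ev h x = ev h y := by
    obtain ⟨a, ha, b, hb, rfl⟩ := Submodule.mem_sup.1 hh
    obtain ⟨c, rfl⟩ := Ideal.mem_span_range_iff_exists_fun.1 ha
    simp [hev b hb, hxy]
  set E : V → MvPolynomial (Fin n) F →ₗ[F] V := fun x =>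
    (LinearMap.applyₗ x).comp ev.toLinearMap with hE
  obtain ⟨x, hx, hx'⟩ := hsol.exists_independent_fintype f v' hcomp
    (fun x => LinearMap.range (relMap ev d v) ⊔ W₀.map (E x))
    (fun x => by
      refine Submodule.FG.sup ?_ ((hfg inf_le_left).map _)
      rw [LinearMap.range_eq_map]
      exact Module.Finite.fg_top.map _)
    (fun x y hxy => by
      have : W₀.map (E x) = W₀.map (E y) := by
        ext z
        simp only [Submodule.mem_map]
        refine exists_congr fun h => and_congr_right fun hh => ?_
        rw [show E x h = E y h from hdet hxy hh.2]
      simp only [this])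
    (W' ⊓ Wd) (hfg inf_le_right) fun h hh hh' => by
      have : h ∈ W₀ ⊓ W' := ⟨⟨hh.2, hh'⟩, hh.1⟩
      rw [hW'.inf_eq_bot] at this
      simpa using this
  refine ⟨x, ?_⟩
  ext w
  rw [ev_sum_option]
  -- For relations whose $x$-coefficient lies in $\mathfrak b$, the ideal membership has bounded
  -- coefficients, and the hypothesis decides the relation. It remains to show that both sides
  -- consist of such relations.
  have main (hg : (boxPoly fun μ => w (none, μ)) ∈ 𝔟) : w ∈ rspan X' ↔
      ev (boxPoly fun μ => w (none, μ)) x + ∑ a, ev (boxPoly fun μ => w (some a, μ)) (v a) = 0 := by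
    obtain ⟨t, s, ht, hs, hts⟩ := hD1 _ (boxPoly_mem _) (by rwa [h𝔟, hJ] at hg)
    rw [← hc t s w ht hs hts, hsum, neg_eq_zero, ← hts]
    simp [hevp, hx]
  constructor
  · intro hw
    refine (main ?_).1 hw
    refine Ideal.mem_sup_left ?_
    obtain ⟨c, rfl⟩ := (Submodule.mem_span_range_iff_exists_fun F).1 hw
    have : (boxPoly fun μ : Box n d => (∑ i, c i • fun b => X' (i, b)) (none, μ)) =
        ∑ i, C (c i) * f i := by
      simp only [hf, ← smul_eq_C_mul, ← map_smul, ← map_sum]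
      congr 1
      ext μ
      simp
    rw [this]
    exact sum_mem fun i _ => Ideal.mul_mem_left _ _ (Ideal.subset_span ⟨i, rfl⟩)
  · intro hw
    refine (main ?_).2 hw
    have hgd : (boxPoly fun μ => w (none, μ)) ∈ Wd := ⟨_, rfl⟩
    rw [← hmod] at hgd
    obtain ⟨g', hg', g'', hg'', hgg⟩ := Submodule.mem_sup.1 hgd
    -- The relation expresses $g''x$ by the determined values and the $T^\mu v_a$, so independence
    -- makes $g''$ vanish and leaves the $x$-coefficient in $\mathfrak b$.
    have h0 : g'' = 0 := by
      refine hx' g'' hg'' ?_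
      have h1 : ev g'' x = ev (boxPoly fun μ => w (none, μ)) x - E x g' := by
        rw [← hgg, map_add]
        simp [hE]
      rw [h1]
      refine sub_mem (Submodule.mem_sup_left ?_)
        (Submodule.mem_sup_right (Submodule.mem_map_of_mem hg'))
      rw [eq_neg_of_add_eq_zero_left hw]
      refine neg_mem ⟨fun aμ => w (some aμ.1, aμ.2), ?_⟩
      rw [relMap_apply]
    rw [← hgg, h0, add_zero]
    exact hg'.2

end Relations

end GrassModule

namespace GrassModule

open MvPolynomial Module MSLanguage UniformBounds

/-! ### Relations that are constructible in terms of the relations between vectors -/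

section Definability

variable {n : ℕ} {A A' C C' D : Type} [Fintype A] [Fintype A']

/-- The index type of matrices of relations between the vectors that arise from `A` vectors. -/
abbrev RelIdx (A : Type) (n e : ℕ) : Type := (A × Box n e) × (A × Box n e)

/-- A relation on vectors and field elements that is definable over the models of the complete
theory in terms of the relations between the images of the vectors under all monomials of large
enough bounded degree. -/
def SG (I : Ideal (MvPolynomial (Fin n) ℤ))
    (R : ∀ (N : Str.{u} (lang n)) [BMdl N], (A → M N) → (C → K N) → Prop) : Prop :=
  ∃ d : ℕ, ∀ e, d ≤ e → ∃ S : ∀ (F : Type u) [Field F], (RelIdx A n e ⊕ C → F) → Prop,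
    FD S ∧ ∀ (N : Str.{u} (lang n)) [BMdl N], Good I N → ∀ (v : A → M N)
      (z : RelIdx A n e ⊕ C → K N), rspan (fun i => z (.inl i)) = relSub (ev N) e v →
      (R N v (fun i => z (.inr i)) ↔ S (K N) z)

variable {I : Ideal (MvPolynomial (Fin n) ℤ)}
  {R R' : ∀ (N : Str.{u} (lang n)) [BMdl N], (A → M N) → (C → K N) → Prop}

lemma SG.congr (h : SG I R) (hR : ∀ (N : Str.{u} (lang n)) [BMdl N], Good I N → ∀ v c,
    R' N v c ↔ R N v c) : SG I R' := by
  obtain ⟨d, h⟩ := h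
  refine ⟨d, fun e he => ?_⟩
  obtain ⟨S, hS, h⟩ := h e he
  exact ⟨S, hS, fun N _ hN v z hz => (hR N hN _ _).trans (h N hN v z hz)⟩

/-- Definability is required at every large degree, so that two relations can be expressed at a
common one. -/
lemma SG.imp (h : SG I R) (h' : SG I R') : SG I (fun N _ v c => R N v c → R' N v c) := by
  obtain ⟨d, h⟩ := h
  obtain ⟨d', h'⟩ := h'
  refine ⟨max d d', fun e he => ?_⟩
  obtain ⟨S, hS, h⟩ := h e (le_trans (le_max_left _ _) he)
  obtain ⟨S', hS', h'⟩ := h' e (le_trans (le_max_right _ _) he)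
  exact ⟨_, hS.imp hS', fun N _ hN v z hz => imp_congr (h N hN v z hz) (h' N hN v z hz)⟩

lemma SG.of_fd {S : ∀ (F : Type u) [Field F], (C → F) → Prop} (h : FD S) :
    SG I (fun N _ (_ : A → M N) c => S (K N) c) :=
  ⟨0, fun _ _ => ⟨_, h.comp Sum.inr, fun _ _ _ _ _ _ => Iff.rfl⟩⟩

lemma SG.false : SG I (fun N _ (_ : A → M N) (_ : C → K N) => False) :=
  SG.of_fd FD.false

lemma SG.not (h : SG I R) : SG I (fun N _ v c => ¬ R N v c) := h.imp .false

lemma SG.and (h : SG I R) (h' : SG I R') : SG I (fun N _ v c => R N v c ∧ R' N v c) :=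
  (h.imp h'.not).not.congr fun N _ _ v c => by tauto

lemma SG.forall_finite {ι : Type} [Finite ι]
    {R : ι → ∀ (N : Str.{u} (lang n)) [BMdl N], (A → M N) → (C → K N) → Prop}
    (h : ∀ i, SG I (R i)) : SG I (fun N _ v c => ∀ i, R i N v c) := by
  have _ := Fintype.ofFinite ι
  choose d h using h
  refine ⟨Finset.univ.sup d, fun e he => ?_⟩
  choose S hS h using fun i => h i e ((Finset.le_sup (Finset.mem_univ i)).trans he)
  exact ⟨_, FD.forall_finite hS, fun N _ hN v z hz => forall_congr' fun i => h i N hN v z hz⟩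

lemma SG.exK [Finite C] [Finite D]
    {R : ∀ (N : Str.{u} (lang n)) [BMdl N], (A → M N) → (C → K N) → (D → K N) → Prop}
    (h : SG I (fun N _ v (z : C ⊕ D → K N) => R N v (fun i => z (.inl i)) fun i => z (.inr i))) :
    SG I (fun N _ v c => ∃ y, R N v c y) := by
  obtain ⟨d, h⟩ := h
  refine ⟨d, fun e he => ?_⟩
  obtain ⟨S, hS, h⟩ := h e he
  refine ⟨_, FD.ex (S := fun F _ x y => S F
    (Sum.elim (fun i => x (.inl i)) (Sum.elim (fun i => x (.inr i)) y))) ?_, ?_⟩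
  · refine (hS.comp (Sum.elim (fun i => .inl (.inl i))
      (Sum.elim (fun i => .inl (.inr i)) Sum.inr))).congr fun F _ _ x => ?_
    refine iff_of_eq (congrArg (S F) ?_)
    ext (i | i | i) <;> rfl
  · intro N _ hN v z hz
    exact exists_congr fun y => h N hN v (Sum.elim (fun i => z (.inl i))
      (Sum.elim (fun i => z (.inr i)) y)) hz

lemma SG.allK [Finite C] [Finite D]
    {R : ∀ (N : Str.{u} (lang n)) [BMdl N], (A → M N) → (C → K N) → (D → K N) → Prop}
    (h : SG I (fun N _ v (z : C ⊕ D → K N) => R N v (fun i => z (.inl i)) fun i => z (.inr i))) :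
    SG I (fun N _ v c => ∀ y, R N v c y) :=
  (SG.exK (R := fun N _ v c y => ¬ R N v c y) h.not).not.congr fun N _ _ v c => by simp

lemma exists_forall_mem_box (P : A' → A → MvPolynomial (Fin n) (MvPolynomial C ℤ)) :
    ∃ δ, ∀ a' a (F : Type u) [Field F] (c : C → F),
      map (aeval c : MvPolynomial C ℤ →ₐ[ℤ] F).toRingHom (P a' a) ∈ (box n F).B δ := by
  refine ⟨Finset.univ.sup fun a' => Finset.univ.sup fun a => (P a' a).totalDegree,
    fun a' a F _ c => ?_⟩
  rw [mem_box]
  intro s hs i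
  have hs' : s ∈ (P a' a).support := by
    rw [MvPolynomial.mem_support_iff]
    rintro h
    rw [coeff_map, h, map_zero] at hs
    exact hs rfl
  calc s i ≤ s.degree := Finsupp.le_degree i s
    _ ≤ (P a' a).totalDegree := by
        rw [totalDegree]
        exact Finset.le_sup (f := fun s : Fin n →₀ ℕ => s.sum fun _ e => e) hs'
    _ ≤ _ := (Finset.le_sup (f := fun a => (P a' a).totalDegree) (Finset.mem_univ a)).trans
        (Finset.le_sup (f := fun a' => Finset.univ.sup fun a => (P a' a).totalDegree)
          (Finset.mem_univ a'))

/-- Substitution of terms in the variables. -/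
lemma SG.subst [Finite C] {R : ∀ (N : Str.{u} (lang n)) [BMdl N], (A' → M N) → (C' → K N) → Prop}
    (h : SG I R) (P : A' → A → MvPolynomial (Fin n) (MvPolynomial C ℤ))
    (σ : C' → MvPolynomial C ℤ) :
    SG I (fun N _ (v : A → M N) (c : C → K N) => R N
      (fun a' => ∑ a, ev N (map (aeval c : MvPolynomial C ℤ →ₐ[ℤ] K N).toRingHom (P a' a)) (v a))
      fun b => aeval c (σ b)) := by
  obtain ⟨δ, hδ⟩ := exists_forall_mem_box.{u} P
  obtain ⟨d, h⟩ := h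
  -- A relation of degree $d$ between combinations with coefficients of degree $\delta$ is a
  -- relation of degree $d + \delta$ between the given vectors. A matrix for the new relation space
  -- is quantified existentially and characterized by its row space.
  refine ⟨d + δ, fun e he => ?_⟩
  obtain ⟨S, hS, h⟩ := h d le_rfl
  refine ⟨_, FD.ex (β := RelIdx A' n d) (S := fun F _ z X' =>
    (∀ r : A' × Box n d → F, r ∈ rspan X' ↔ (fun aμ : A × Box n e => coeff aμ.2.exp
      (∑ a', (boxPoly fun μ => r (a', μ)) *
        map (aeval fun i => z (.inr i) : MvPolynomial C ℤ →ₐ[ℤ] F).toRingHom (P a' aμ.1))) ∈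
        rspan fun i => z (.inl i)) ∧
    S F (Sum.elim X' fun b => aeval (fun i => z (.inr i)) (σ b))) ?_, ?_⟩
  · refine FD.and (FD.all ?_) ?_
    · dsimp only
      refine FD.iff (FD.mem_rspan (fun _ => FT.var _) fun _ => FT.var _)
        (FD.mem_rspan (fun _ => FT.var _) fun aμ => UP.coeff (UP.sum _ fun a' =>
          UP.mul (UP.boxPoly fun μ => FT.var _) (UP.map_aeval _ fun i => FT.var _)) _)
    · refine FD.congr (hS.subst (s := Sum.elim (fun i F _ z => z (.inr i))
        fun b F _ z => aeval (fun i => z (.inl (.inr i))) (σ b)) ?_) fun F _ _ z => ?_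
      · rintro (i | b)
        · exact FT.var _
        · exact FT.aeval (fun i => FT.var _) _
      · refine iff_of_eq (congrArg (S F) ?_)
        ext (i | i) <;> rfl
  · intro N _ hN v z hz
    set c : C → K N := fun i => z (.inr i) with hc
    set v' : A' → M N := fun a' => ∑ a, ev N (map
      (aeval c : MvPolynomial C ℤ →ₐ[ℤ] K N).toRingHom (P a' a)) (v a) with hv'
    have key (r : A' × Box n d → K N) : ((fun aμ : A × Box n e => coeff aμ.2.exp
      (∑ a', (boxPoly fun μ => r (a', μ)) *
        map (aeval c : MvPolynomial C ℤ →ₐ[ℤ] K N).toRingHom (P a' aμ.1))) ∈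
        rspan fun i => z (.inl i)) ↔ r ∈ relSub (ev N) d v' := by
      rw [hz]
      refine (boxCoeff_mem_relSub (p := fun a => ∑ a', (boxPoly fun μ => r (a', μ)) *
        map (aeval c : MvPolynomial C ℤ →ₐ[ℤ] K N).toRingHom (P a' a)) (ev N)
        fun a => sum_mem fun a' _ => (box n (K N)).mono he
          ((box n (K N)).mul_mem (boxPoly_mem _) (hδ _ _ _ _))).trans ?_
      rw [mem_relSub]
      simp only [hv', map_sum, map_mul, LinearMap.sum_apply, Module.End.mul_apply]
      rw [Finset.sum_comm]
    constructor
    · intro hR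
      obtain ⟨X', hX'⟩ := exists_rspan_eq (relSub (ev N) d v')
      exact ⟨X', fun r => by rw [key, hX'],
        (h N hN v' (Sum.elim X' fun b => aeval c (σ b)) hX').1 hR⟩
    · rintro ⟨X', hX', hS'⟩
      refine (h N hN v' (Sum.elim X' fun b => aeval c (σ b)) ?_).2 hS'
      ext r
      exact (hX' r).trans (key r)

lemma SG.reindex [Finite C]
    {R : ∀ (N : Str.{u} (lang n)) [BMdl N], (A' → M N) → (C' → K N) → Prop}
    (h : SG I R) (f : A' → A) (g : C' → C) :
    SG I (fun N _ (v : A → M N) (c : C → K N) => R N (fun a => v (f a)) fun b => c (g b)) := by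
  classical
  refine (h.subst (fun a' a => if f a' = a then 1 else 0) fun b => X (g b)).congr
    fun N _ _ v c => iff_of_eq ?_
  congr 1
  · funext a'
    rw [Finset.sum_eq_single (f a')]
    · simp
    · intro a _ ha
      simp [ha.symm]
    · simp
  · funext b
    simp

lemma FD.extCond {q : ℕ} (p : Fin q → MvPolynomial (Fin n) ℤ) (d D e : ℕ) :
    FD (fun (F : Type u) [Field F] (z : RelIdx (Option A) n d ⊕ RelIdx A n e → F) =>
      ExtCond p A d D e F (fun i => z (.inl i)) fun i => z (.inr i)) := by
  refine FD.all ?_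
  dsimp only
  refine FD.imp (UP.eq (UP.add (UP.sum _ fun i => UP.mul (UP.boxPoly fun μ => FT.var _)
    (UP.boxPoly fun μ => FT.var _)) (UP.sum _ fun j => UP.mul (UP.boxPoly fun μ => FT.var _)
      (UP.map_int _))) (UP.boxPoly fun μ => FT.var _)) ?_
  refine FD.iff (FD.mem_rspan (fun _ => FT.var _) fun aμ => UP.coeff (UP.sub (UP.sum _ fun i =>
    UP.mul (UP.boxPoly fun μ => FT.var _) (UP.boxPoly fun μ => FT.var _))
      (UP.boxPoly fun μ => FT.var _)) _) (FD.mem_rspan (fun _ => FT.var _) fun _ => FT.var _)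

/-- Elimination of a quantifier over the module. -/
theorem SG.exM [Finite C]
    {R : ∀ (N : Str.{u} (lang n)) [BMdl N], (Option A → M N) → (C → K N) → Prop}
    (h : SG I R) : SG I (fun N _ v c => ∃ x, R N (fun o => o.elim x v) c) := by
  obtain ⟨q, p, hp⟩ := Submodule.fg_iff_exists_fin_generating_family.1
    ((isNoetherianRing_iff_ideal_fg _).1 inferInstance I)
  change Ideal.span (Set.range p) = I at hp
  obtain ⟨d, h⟩ := h
  obtain ⟨D, hD⟩ := exists_uniform_bound.{u} p (Option A × Box n d) d
  -- The quantifier over $M$ is exchanged for a quantifier over matrices $X'$ of field elements: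
  -- those that satisfy `ExtCond` are the ones realized by some $x$.
  refine ⟨d + D, fun e he => ?_⟩
  obtain ⟨S, hS, h⟩ := h d le_rfl
  refine ⟨_, FD.ex (β := RelIdx (Option A) n d) (S := fun F _ z X' =>
    ExtCond p A d D e F X' (fun i => z (.inl i)) ∧
    S F (Sum.elim X' fun i => z (.inr i))) (FD.and ?_ ?_), ?_⟩
  · refine ((FD.extCond p d D e).comp (Sum.elim Sum.inr fun i => .inl (.inl i))).congr
      fun F _ _ z => ?_
    exact iff_of_eq (congrArg₂ (ExtCond p A d D e F) (funext fun i => rfl) (funext fun i => rfl))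
  · refine (hS.comp (Sum.elim Sum.inr fun i => .inl (.inr i))).congr fun F _ _ z => ?_
    refine iff_of_eq (congrArg (S F) ?_)
    ext (i | i) <;> rfl
  · intro N _ hN v z hz
    have hev : ∀ h ∈ extIdeal (K N) I, ev N h = 0 := by
      have : extIdeal (K N) I ≤ RingHom.ker (ev N) :=
        Ideal.map_le_iff_le_comap.2 fun p hp => hN.tprops.ideal_eq_zero p hp
      exact fun h hh => this hh
    constructor
    · rintro ⟨x, hx⟩
      obtain ⟨X', hX'⟩ := exists_rspan_eq (relSub (ev N) d fun o : Option A => o.elim x v)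
      refine ⟨X', extCond_of_exists (fun j => hev _ (Ideal.mem_map_of_mem _ ?_)) he hz x hX',
        (h N hN _ (Sum.elim X' fun i => z (.inr i)) hX').1 hx⟩
      rw [← hp]
      exact Ideal.subset_span ⟨j, rfl⟩
    · rintro ⟨X', hX', hS'⟩
      obtain ⟨x, hx⟩ := exists_of_extCond hev (by rw [hp]) hN.isSolvable (hD (K N)) he hz hX'
      exact ⟨x, (h N hN _ (Sum.elim X' fun i => z (.inr i)) hx).2 hS'⟩

theorem SG.allM [Finite C]
    {R : ∀ (N : Str.{u} (lang n)) [BMdl N], (Option A → M N) → (C → K N) → Prop}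
    (h : SG I R) : SG I (fun N _ v c => ∀ x, R N (fun o => o.elim x v) c) :=
  (SG.exM h.not).not.congr fun N _ _ v c => by simp

/-! ### Atomic relations -/

/-- The vector is zero exactly if the constant polynomial $1$ is a relation. -/
lemma SG.eq_zero : SG I (fun N _ (v : Unit → M N) (_ : Empty → K N) => v () = 0) := by
  refine ⟨0, fun e _ => ⟨_, FD.mem_rspan (ρ := Unit × Box n e)
    (X := fun i F _ z => z (.inl i)) (fun _ => FT.var _)
    (r := fun aμ F _ _ => coeff aμ.2.exp (1 : MvPolynomial (Fin n) F)) fun aμ =>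
      UP.coeff (p := fun _ _ _ => 1) ⟨1, by simp⟩ _, fun N _ hN v z hz => ?_⟩⟩
  rw [hz]
  refine .trans ?_ (boxCoeff_mem_relSub (p := fun _ => 1) (ev N)
    fun a => by simpa using C_mem_box (1 : K N) e).symm
  simp

lemma FD.constant_relations (i : ℕ+) (e : ℕ) :
    FD (fun (F : Type u) [Field F] (z : RelIdx (Fin i) n e ⊕ (Fin i × Fin i) → F) =>
      ∀ r : Fin i → F, r ∈ rspan (fun ij : Fin i × Fin i => z (.inr ij)) ↔
        (fun aμ : Fin i × Box n e => coeff aμ.2.exp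
          (monomial 0 (r aμ.1) : MvPolynomial (Fin n) F)) ∈ rspan fun j => z (.inl j)) := by
  have h (aμ : Fin i × Box n e) : FT (fun (F : Type u) [Field F]
      (z : (RelIdx (Fin i) n e ⊕ (Fin i × Fin i)) ⊕ Fin i → F) =>
        coeff aμ.2.exp (monomial 0 (z (.inr aμ.1)) : MvPolynomial (Fin n) F)) :=
    UP.coeff (UP.monomial (FT.var _) _) _
  exact FD.all (FD.iff (FD.mem_rspan (fun _ => FT.var _) fun _ => FT.var _)
    (FD.mem_rspan (fun _ => FT.var _) h))

/-- Relations between the vectors themselves are the relations of all degrees whose coefficients are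
constant polynomials. -/
lemma SG.dep_eq (i : ℕ+) :
    SG I (fun N _ (v : Fin i → M N) (c : Fin i × Fin i → K N) => dep N v = proj N c) := by
  refine ⟨0, fun e _ => ⟨_, FD.constant_relations i e, fun N _ hN v z hz => ?_⟩⟩
  dsimp only
  rw [hN.tprops.dep_eq_iff, SetLike.ext_iff]
  refine forall_congr' fun r => iff_congr Iff.rfl ?_
  rw [hz]
  refine .trans ?_ (boxCoeff_mem_relSub (p := fun a => monomial 0 (r a)) (ev N)
    fun a => C_mem_box (r a) e).symm
  refine iff_of_eq (congrArg (· = 0) (Finset.sum_congr rfl fun a _ => ?_))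
  rw [← C_apply, ← algebraMap_eq, AlgHom.commutes, Module.algebraMap_end_apply]

lemma SG.proj_eq (i : ℕ+) {s t : Fin i × Fin i → MvPolynomial C ℤ} [Finite C] :
    SG I (fun N _ (_ : A → M N) (c : C → K N) =>
      proj N (fun ij => aeval c (s ij)) = proj N fun ij => aeval c (t ij)) := by
  refine (SG.of_fd (S := fun F _ c => ∀ r : Fin i → F,
    r ∈ rspan (fun ij => aeval c (s ij)) ↔ r ∈ rspan (fun ij => aeval c (t ij)))
    (FD.all (FD.iff (FD.mem_rspan (fun _ => FT.aeval (fun _ => FT.var _) _) fun _ => FT.var _)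
      (FD.mem_rspan (fun _ => FT.aeval (fun _ => FT.var _) _) fun _ => FT.var _)))).congr
    fun N _ hN v c => ?_
  rw [hN.tprops.proj_eq_iff, SetLike.ext_iff]
  rfl

end Definability

end GrassModule

namespace MSLanguage

instance Var.finite_sigma {S : Type} : ∀ Γ : List S, Finite (Σ s, Var Γ s)
  | [] => Finite.of_injective (β := Empty) (fun x => nomatch x.2) fun x => nomatch x.2
  | t :: Γ => by
    have := Var.finite_sigma Γ
    let f : (Σ s, Var (t :: Γ) s) → Option (Σ s, Var Γ s) := fun x => match x with
      | ⟨_, .zero⟩ => none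
      | ⟨s, .succ x⟩ => some ⟨s, x⟩
    refine Finite.of_injective f ?_
    rintro ⟨_, _ | x⟩ ⟨_, _ | y⟩ h
    · rfl
    · simp [f] at h
    · simp [f] at h
    · simp only [f, Option.some.injEq, Sigma.mk.injEq] at h
      obtain ⟨rfl, h⟩ := h
      rw [eq_of_heq h]

instance Var.finite {S : Type} (Γ : List S) (s : S) : Finite (Var Γ s) :=
  Finite.of_injective (fun x => (⟨s, x⟩ : Σ s, Var Γ s)) sigma_mk_injective

noncomputable instance {S : Type} (Γ : List S) (s : S) : Fintype (Var Γ s) := Fintype.ofFinite _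

end MSLanguage

/-! ### Translation of formulas into coordinates -/

namespace GrassModule

open MvPolynomial Module MSLanguage UniformBounds

section Formulas

variable {n : ℕ} {I : Ideal (MvPolynomial (Fin n) ℤ)}

/-- The variables for subspaces. -/
abbrev GVar (Γ : List Srt) : Type := Σ i : ℕ+, Var Γ (.G i)

instance (Γ : List Srt) : Finite (GVar Γ) :=
  Finite.of_injective (fun x => (⟨.G x.1, x.2⟩ : Σ s, Var Γ s)) <| by
    rintro ⟨i, x⟩ ⟨j, y⟩ h
    simp only [Sigma.mk.injEq, Srt.G.injEq] at h
    obtain ⟨rfl, h⟩ := h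
    rw [eq_of_heq h]

/-- Coordinates for the variables for field elements and subspaces. -/
abbrev Coord (Γ : List Srt) : Type := (Σ b : GVar Γ, Fin b.1 × Fin b.1) ⊕ Var Γ .K

/-- The assignment with given coordinates. -/
def envOf {N : Str.{u} (lang n)} {Γ : List Srt} (v : Var Γ .M → M N) (c : Coord Γ → K N) : Env N Γ
  | .K => fun x => c (.inr x)
  | .M => v
  | .G i => fun x => proj N fun ij => c (.inl ⟨⟨i, x⟩, ij⟩)

/-- The value of a term is given by polynomials. -/
def IsPolynomial (I : Ideal (MvPolynomial (Fin n) ℤ)) {Γ : List Srt} :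
    {s : Srt} → Term (lang n) Γ s → Prop
  | .K, t => ∃ p : MvPolynomial (Coord Γ) ℤ, ∀ (N : Str.{u} (lang n)) [BMdl N]
      (v : Var Γ .M → M N) (c : Coord Γ → K N), t.realize (envOf v c) = aeval c p
  | .M, t => ∃ P : Var Γ .M → MvPolynomial (Fin n) (MvPolynomial (Coord Γ) ℤ),
      ∀ (N : Str.{u} (lang n)) [BMdl N] (v : Var Γ .M → M N) (c : Coord Γ → K N),
        t.realize (envOf v c) =
          ∑ a, ev N (map (aeval c : MvPolynomial (Coord Γ) ℤ →ₐ[ℤ] K N).toRingHom (P a)) (v a)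
  | .G i, t => SG.{u} I fun N _ (v : Var Γ .M → M N) (z : Coord Γ ⊕ (Fin i × Fin i) → K N) =>
      t.realize (envOf v fun a => z (.inl a)) = proj N fun a => z (.inr a)

lemma isPolynomial_iff {Γ : List Srt} {i : ℕ+} (t : Term (lang n) Γ (Srt.G i)) :
    IsPolynomial.{u} I t ↔ SG.{u} I fun N _ (v : Var Γ .M → M N)
      (z : Coord Γ ⊕ (Fin i × Fin i) → K N) =>
        t.realize (envOf v fun a => z (.inl a)) = proj N fun a => z (.inr a) := Iff.rfl

lemma Term.realize_func {L : MSLanguage} {N : Str.{u} L} {Γ : List L.Srt} (e : Env N Γ)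
    (f : L.Fun) (ts : (a : L.arity f) → Term L Γ (L.dom f a)) :
    (Term.func f ts).realize e = N.funMap f fun a => (ts a).realize e := rfl

/-- Terms in $K$ are polynomials in the coordinates, and terms in $M$ are combinations of the
variables with coefficients polynomial in the operators and coordinates. A term in a Grassmannian
has no distinguished matrix, so only the relation that a matrix represents it is described. -/
lemma isPolynomial {Γ : List (lang n).Srt} {s : (lang n).Srt} (t : Term (lang n) Γ s) :
    IsPolynomial.{u} I t := by
  induction t with
  | @var s x =>
    match s with
    | Srt.K => exact ⟨X (.inr x), fun N _ v c => by simp [Term.realize, envOf]⟩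
    | Srt.M =>
      classical
      refine ⟨fun a => if a = x then 1 else 0, fun N _ v c => ?_⟩
      rw [Finset.sum_eq_single x]
      · simp [Term.realize, envOf]
      · intro b _ hb
        simp [hb]
      · simp
    | Srt.G i =>
      refine (isPolynomial_iff (i := i) _).2 ?_
      refine (SG.proj_eq (C := Coord Γ ⊕ (Fin i × Fin i)) i
        (s := fun ij => X (.inl (.inl ⟨⟨i, x⟩, ij⟩)))
        (t := fun ij => X (.inr ij))).congr fun N _ _ v c => ?_
      simp [Term.realize, envOf]
  | func f ts ih =>
    cases f with
    | kadd =>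
      obtain ⟨p, hp⟩ := ih (0 : Fin 2)
      obtain ⟨q, hq⟩ := ih (1 : Fin 2)
      refine ⟨p + q, fun N _ v c => ?_⟩
      rw [map_add, ← hp, ← hq, ← BMdl.kadd_eq, Term.realize_func, kadd]
      congr 1
      funext a
      fin_cases a <;> rfl
    | kmul =>
      obtain ⟨p, hp⟩ := ih (0 : Fin 2)
      obtain ⟨q, hq⟩ := ih (1 : Fin 2)
      refine ⟨p * q, fun N _ v c => ?_⟩
      rw [map_mul, ← hp, ← hq, ← BMdl.kmul_eq, Term.realize_func, kmul]
      congr 1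
      funext a
      fin_cases a <;> rfl
    | kzero =>
      refine ⟨0, fun N _ v c => ?_⟩
      rw [map_zero, ← BMdl.kzero_eq, Term.realize_func, kzero]
      congr 1
      funext a
      exact a.elim0
    | kone =>
      refine ⟨1, fun N _ v c => ?_⟩
      rw [map_one, ← BMdl.kone_eq, Term.realize_func, kone]
      congr 1
      funext a
      exact a.elim0
    | madd =>
      obtain ⟨p, hp⟩ := ih (0 : Fin 2)
      obtain ⟨q, hq⟩ := ih (1 : Fin 2)
      refine ⟨fun a => p a + q a, fun N _ v c => ?_⟩
      simp only [map_add, LinearMap.add_apply, Finset.sum_add_distrib]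
      rw [← hp, ← hq, ← BMdl.madd_eq, Term.realize_func, madd]
      congr 1
      funext a
      fin_cases a <;> rfl
    | mzero =>
      refine ⟨fun a => 0, fun N _ v c => ?_⟩
      simp only [map_zero, LinearMap.zero_apply, Finset.sum_const_zero]
      rw [← BMdl.mzero_eq, Term.realize_func, mzero]
      congr 1
      funext a
      exact a.elim0
    | smul =>
      obtain ⟨p, hp⟩ := ih (0 : Fin 2)
      obtain ⟨q, hq⟩ := ih (1 : Fin 2)
      refine ⟨fun a => C p * q a, fun N _ v c => ?_⟩
      have h (a) : ev N (map (aeval c : MvPolynomial (Coord Γ) ℤ →ₐ[ℤ] K N).toRingHom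
          (C p * q a)) (v a) = aeval c p • ev N (map (aeval c : MvPolynomial (Coord Γ) ℤ →ₐ[ℤ]
            K N).toRingHom (q a)) (v a) := by
        rw [map_mul, map_C, map_mul, Module.End.mul_apply, ← algebraMap_eq, AlgHom.commutes,
          Module.algebraMap_end_apply]
        rfl
      simp only [h]
      rw [← Finset.smul_sum, ← hp, ← hq, ← BMdl.smul_eq, Term.realize_func, smul]
      congr 1
      funext a
      fin_cases a <;> rfl
    | op j =>
      obtain ⟨q, hq⟩ := ih (0 : Fin 1)
      refine ⟨fun a => X j * q a, fun N _ v c => ?_⟩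
      simp only [map_mul, map_X, Module.End.mul_apply, ev, evalOps_X]
      rw [← map_sum, ← ev.eq_def, ← hq, ← BMdl.op_eq, Term.realize_func, op]
      congr 1
      funext a
      fin_cases a
      rfl
    | π i =>
      choose p hp using ih
      refine (isPolynomial_iff (i := i) _).2 ?_
      refine (SG.proj_eq (C := Coord Γ ⊕ (Fin i × Fin i)) i (s := fun ij => rename Sum.inl (p ij))
        (t := fun ij => X (.inr ij))).congr fun N _ _ v c => ?_
      simp only [Term.realize_func, hp, aeval_X, aeval_rename]
      rfl
    | D i =>
      choose P hP using ih
      refine (isPolynomial_iff (i := i) _).2 ?_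
      refine ((SG.dep_eq i).subst (fun a b => map (rename Sum.inl : MvPolynomial (Coord Γ) ℤ →ₐ[ℤ]
        MvPolynomial (Coord Γ ⊕ (Fin i × Fin i)) ℤ).toRingHom (P a b))
        fun ij => X (.inr ij)).congr fun N _ _ v c => ?_
      simp only [Term.realize_func, hP, aeval_X, map_map]
      have h : (aeval c : MvPolynomial (Coord Γ ⊕ (Fin i × Fin i)) ℤ →ₐ[ℤ] K N).toRingHom.comp
          (rename Sum.inl : MvPolynomial (Coord Γ) ℤ →ₐ[ℤ]
            MvPolynomial (Coord Γ ⊕ (Fin i × Fin i)) ℤ).toRingHom =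
          (aeval fun a => c (.inl a) : MvPolynomial (Coord Γ) ℤ →ₐ[ℤ] K N).toRingHom :=
        RingHom.ext fun p => aeval_rename _ _ _
      rw [h]
      rfl

lemma TProps.exists_eq_proj {N : Str.{u} (lang n)} [BMdl N] (h : TProps I N) {i : ℕ+} (p : G N i) :
    ∃ X, p = proj N X := by
  obtain ⟨X, hX⟩ := h.proj_surjective i p
  exact ⟨X, hX.symm⟩

/-- In a Grassmannian, equality means that some matrix represents both sides, and matrices are
quantified over the field. -/
lemma sg_equal {Γ : List Srt} : ∀ {s : Srt} (t₁ t₂ : Term (lang n) Γ s),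
    SG.{u} I fun N _ (v : Var Γ .M → M N) (c : Coord Γ → K N) =>
      t₁.realize (envOf v c) = t₂.realize (envOf v c)
  | .K, t₁, t₂ => by
    obtain ⟨p, hp⟩ := isPolynomial.{u} (I := I) t₁
    obtain ⟨q, hq⟩ := isPolynomial.{u} (I := I) t₂
    refine (SG.of_fd (FD.eq ⟨p, fun _ _ _ => rfl⟩ ⟨q, fun _ _ _ => rfl⟩)).congr
      fun N _ _ v c => ?_
    rw [hp, hq]
  | .M, t₁, t₂ => by
    obtain ⟨p, hp⟩ := isPolynomial.{u} (I := I) t₁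
    obtain ⟨q, hq⟩ := isPolynomial.{u} (I := I) t₂
    refine (SG.eq_zero.subst (fun _ a => p a - q a) Empty.elim).congr fun N _ _ v c => ?_
    rw [hp, hq, ← sub_eq_zero, ← Finset.sum_sub_distrib]
    simp only [map_sub, LinearMap.sub_apply]
  | .G i, t₁, t₂ => by
    refine (SG.exK (D := Fin i × Fin i) (R := fun N _ v c y =>
      t₁.realize (envOf v c) = proj N y ∧ t₂.realize (envOf v c) = proj N y)
      (((isPolynomial_iff _).1 (isPolynomial t₁)).and ((isPolynomial_iff _).1 (isPolynomial t₂)))).congr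
      fun N _ hN v c => ⟨fun h => ?_, fun ⟨y, h₁, h₂⟩ => h₁.trans h₂.symm⟩
    obtain ⟨y, hy⟩ := hN.tprops.exists_eq_proj (t₁.realize (envOf v c))
    exact ⟨y, hy, h.symm.trans hy⟩

/-- By its axiom, the predicate is itself an existential statement about matrices that represent its
arguments. -/
lemma sg_rel {Γ : List Srt} (r : Rel)
    (ts : (a : Fin r.m ⊕ Fin r.l) → Term (lang n) Γ (r.dom a)) :
    SG.{u} I fun N _ (v : Var Γ .M → M N) (c : Coord Γ → K N) =>
      N.relMap r fun a => (ts a).realize (envOf v c) := by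
  have hK (b : Fin r.l) := isPolynomial.{u} (I := I) (ts (.inr b))
  have hG (j : Fin r.m) := isPolynomial.{u} (I := I) (ts (.inl j))
  choose p hp using hK
  refine (SG.exK (D := Σ j : Fin r.m, Fin (r.k j) × Fin (r.k j)) (R := fun N _ v c y =>
    FieldHolds r.φ (K N) (Sum.elim y fun b => aeval c (p b)) ∧
    ∀ j, (ts (.inl j)).realize (envOf v c) = proj N fun a => y ⟨j, a⟩) (.and ?_ ?_)).congr
    fun N _ hN v c => ?_
  · refine (SG.of_fd ((FD.of_formula r.isQF).subst (s := Sum.elim (fun a F _ z => z (.inr a))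
      fun b F _ z => aeval (fun i => z (.inl i)) (p b)) ?_)).congr fun N _ _ v c => ?_
    · rintro (a | b)
      · exact FT.var _
      · exact FT.aeval (fun i => FT.var _) _
    · refine iff_of_eq (congrArg (FieldHolds r.φ (K N)) ?_)
      ext (a | b) <;> rfl
  · exact SG.forall_finite fun j => ((isPolynomial_iff _).1 (hG j)).reindex id
      (C := Coord Γ ⊕ Σ j : Fin r.m, Fin (r.k j) × Fin (r.k j))
      (Sum.elim Sum.inl fun a => .inr ⟨j, a⟩)
  · have h : (N.relMap r fun a => (ts a).realize (envOf v c)) =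
        pred N r (fun j => (ts (.inl j)).realize (envOf v c))
          fun b => (ts (.inr b)).realize (envOf v c) := by
      rw [pred]
      congr 1
      funext a
      rcases a with j | b <;> rfl
    rw [h, hN.tprops.pred_iff]
    simp only [hp]
    constructor
    · rintro ⟨X, h₁, h₂⟩
      exact ⟨fun ja => X ja.1 ja.2, h₁, fun j => (h₂ j).symm⟩
    · rintro ⟨y, h₁, h₂⟩
      exact ⟨fun j a => y ⟨j, a⟩, h₁, fun j => (h₂ j).symm⟩

/-- A formula is definable in terms of coordinates. -/
theorem sg_realize {Γ : List (lang n).Srt} (φ : MSLanguage.Formula (lang n) Γ) :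
    SG.{u} I fun N _ (v : Var Γ .M → M N) (c : Coord Γ → K N) => φ.Realize (envOf v c) := by
  induction φ with
  | falsum => exact SG.false
  | equal t₁ t₂ => exact sg_equal t₁ t₂
  | rel r ts => exact sg_rel r ts
  | imp φ ψ h₁ h₂ => exact h₁.imp h₂
  -- Quantifiers over $K$ and over subspaces become quantifiers over field elements, the latter
  -- since every subspace is represented by a matrix. Quantifiers over $M$ are handled by `SG.allM`.
  | @all Γ s φ ih =>
    match s with
    | Srt.K =>
      let f : Var (.K :: Γ) Srt.M → Var Γ Srt.M := fun | .succ x => x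
      let g : Coord (.K :: Γ) → Coord Γ ⊕ Unit := fun
        | .inl ⟨⟨i, .succ x⟩, ij⟩ => .inl (.inl ⟨⟨i, x⟩, ij⟩)
        | .inr .zero => .inr ()
        | .inr (.succ x) => .inl (.inr x)
      refine (SG.allK (D := Unit) (R := fun N _ v c y =>
        φ.Realize (envOf (fun a => v (f a)) fun b => (Sum.elim c y) (g b))) ?_).congr
        fun N _ hN v c => ?_
      · refine (ih.reindex f g).congr fun N _ _ v c => ?_
        rw [show Sum.elim (fun i => c (.inl i)) (fun i => c (.inr i)) = c from
          Sum.elim_comp_inl_inr c]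
      · have h (y : Unit → K N) : envOf (fun a => v (f a)) (fun b => (Sum.elim c y) (g b)) =
            Env.cons (y ()) (envOf v c) := by
          funext s x
          cases x with
          | zero => rfl
          | succ x => cases s <;> rfl
        simp only [h]
        exact ⟨fun h y => h _, fun h a => h fun _ => a⟩
    | Srt.M =>
      let f : Var (.M :: Γ) Srt.M → Option (Var Γ Srt.M) := fun
        | .zero => none
        | .succ x => some x
      let g : Coord (.M :: Γ) → Coord Γ := fun
        | .inl ⟨⟨i, .succ x⟩, ij⟩ => .inl ⟨⟨i, x⟩, ij⟩
        | .inr (.succ x) => .inr x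
      refine (ih.reindex f g).allM.congr fun N _ hN v c => ?_
      have h (y : M N) : envOf (fun a => (f a).elim y v) (fun b => c (g b)) =
          Env.cons y (envOf v c) := by
        funext s x
        cases x with
        | zero => rfl
        | succ x => cases s <;> rfl
      simp only [h]
      rfl
    | Srt.G i =>
      let f : Var (.G i :: Γ) Srt.M → Var Γ Srt.M := fun | .succ x => x
      let g : Coord (.G i :: Γ) → Coord Γ ⊕ (Fin i × Fin i) := fun
        | .inl ⟨⟨_, .zero⟩, ij⟩ => .inr ij
        | .inl ⟨⟨i, .succ x⟩, ij⟩ => .inl (.inl ⟨⟨i, x⟩, ij⟩)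
        | .inr (.succ x) => .inl (.inr x)
      refine (SG.allK (D := Fin i × Fin i) (R := fun N _ v c y =>
        φ.Realize (envOf (fun a => v (f a)) fun b => (Sum.elim c y) (g b))) ?_).congr
        fun N _ hN v c => ?_
      · refine (ih.reindex f g).congr fun N _ _ v c => ?_
        rw [show Sum.elim (fun i => c (.inl i)) (fun i => c (.inr i)) = c from
          Sum.elim_comp_inl_inr c]
      · have h (y : Fin i × Fin i → K N) : envOf (fun a => v (f a))
            (fun b => (Sum.elim c y) (g b)) = Env.cons (proj N y) (envOf v c) := by
          funext s x
          cases x with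
          | zero => rfl
          | succ x => cases s <;> rfl
        simp only [h]
        refine ⟨fun h y => h _, fun h a => ?_⟩
        obtain ⟨y, rfl⟩ := hN.tprops.exists_eq_proj a
        exact h y

end Formulas

end GrassModule

/-! ### Return to quantifier free formulas -/

namespace GrassModule

open MvPolynomial Module MSLanguage UniformBounds

section Elimination

variable {n : ℕ} {I : Ideal (MvPolynomial (Fin n) ℤ)} {Γ : List (lang n).Srt}

/-- A relation on subspaces and field elements that is induced by a constructible relation is
defined by a quantifier free formula. -/
lemma FD.exists_isQF {B C : Type} [Finite B] [Finite C] {k : B → ℕ+}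
    {S : ∀ (F : Type u) [Field F], ((Σ b, Fin (k b) × Fin (k b)) ⊕ C → F) → Prop} (hS : FD S)
    (s : ∀ b, Term (lang n) Γ (Srt.G (k b))) (t : C → Term (lang n) Γ Srt.K) :
    ∃ ψ : MSLanguage.Formula (lang n) Γ, ψ.IsQF ∧ ∀ (N : Str.{u} (lang n)) [BMdl N],
      TProps I N → IsAlgClosed (K N) → ∀ e : Env N Γ, ψ.Realize e ↔
        ∃ Y : (Σ b, Fin (k b) × Fin (k b)) → K N,
          (∀ b, proj N (fun a => Y ⟨b, a⟩) = (s b).realize e) ∧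
          S (K N) (Sum.elim Y fun c => (t c).realize e) := by
  obtain ⟨m, ⟨εB⟩⟩ := Finite.exists_equiv_fin B
  obtain ⟨l, ⟨εC⟩⟩ := Finite.exists_equiv_fin C
  let σ : (Σ j, Fin (k (εB.symm j)) × Fin (k (εB.symm j))) ≃ Σ b, Fin (k b) × Fin (k b) :=
    Equiv.sigmaCongrLeft (β := fun b => Fin (k b) × Fin (k b)) εB.symm
  obtain ⟨φ, hφ, h⟩ := (hS.comp (Sum.map σ.symm εC)).exists_formula
  let r : Rel := ⟨m, fun j => k (εB.symm j), l, φ, hφ⟩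
  refine ⟨.rel r fun
    | .inl j => s (εB.symm j)
    | .inr j => t (εC.symm j), trivial, fun N _ hN _ e => ?_⟩
  have h1 : (MSLanguage.Formula.rel (L := lang n) r fun
      | .inl j => s (εB.symm j)
      | .inr j => t (εC.symm j)).Realize e ↔
      pred N r (fun j => (s (εB.symm j)).realize e) fun j => (t (εC.symm j)).realize e := by
    rw [pred]
    refine iff_of_eq (congrArg (N.relMap r) ?_)
    funext a
    rcases a with j | j <;> rfl
  rw [h1, hN.pred_iff]
  have h2 (X : (j : Fin m) → Fin (k (εB.symm j)) × Fin (k (εB.symm j)) → K N)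
      (x : Fin l → K N) : r.Holds X x ↔
      S (K N) (Sum.elim (fun ba => X (σ.symm ba).1 (σ.symm ba).2) fun c => x (εC c)) := by
    refine (h (K N) _).trans (iff_of_eq (congrArg (S (K N)) ?_))
    ext (i | i) <;> rfl
  constructor
  · rintro ⟨X, hX, hp⟩
    refine ⟨fun ba => X (σ.symm ba).1 (σ.symm ba).2, fun b => ?_, ?_⟩
    · obtain ⟨j, rfl⟩ := εB.symm.surjective b
      refine (congrArg (proj N) (funext fun a => ?_)).trans (hp j)
      have h3 : σ.symm ⟨εB.symm j, a⟩ = ⟨j, a⟩ := σ.symm_apply_eq.2 rfl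
      exact congrArg (fun ja : Σ j, Fin (k (εB.symm j)) × Fin (k (εB.symm j)) => X ja.1 ja.2) h3
    · rw [h2] at hX
      simpa using hX
  · rintro ⟨Y, hY, hS⟩
    refine ⟨fun j a => Y (σ ⟨j, a⟩), ?_, fun j => hY _⟩
    rw [h2]
    simpa using hS

lemma exists_monomial_term (s : Fin n →₀ ℕ) : ∀ t : Term (lang n) Γ Srt.M,
    ∃ t' : Term (lang n) Γ Srt.M, ∀ (N : Str.{u} (lang n)) [BMdl N] (e : Env N Γ),
      t'.realize e = ev N (monomial s 1) (t.realize e : M N) := by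
  induction s using Finsupp.induction_linear with
  | zero => exact fun t => ⟨t, fun N _ e => by rw [← C_apply, C_1, map_one]; rfl⟩
  | add s s' h h' =>
    intro t
    obtain ⟨t₁, h₁⟩ := h' t
    obtain ⟨t₂, h₂⟩ := h t₁
    refine ⟨t₂, fun N _ e => ?_⟩
    rw [h₂, h₁, ← Module.End.mul_apply, ← map_mul, monomial_mul, one_mul]
  | single i k =>
    induction k with
    | zero =>
      exact fun t => ⟨t, fun N _ e => by rw [Finsupp.single_zero, ← C_apply, C_1, map_one]; rfl⟩
    | succ k ih =>
      intro t
      obtain ⟨t', h⟩ := ih t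
      refine ⟨.func (L := lang n) (Fun.op i) fun _ => t', fun N _ e => ?_⟩
      have h₁ : (monomial (Finsupp.single i (k + 1)) 1 : MvPolynomial (Fin n) (K N)) =
          X i * monomial (Finsupp.single i k) 1 := by
        rw [X, monomial_mul, one_mul, ← Finsupp.single_add, add_comm]
      rw [h₁, map_mul, Module.End.mul_apply, ← h, Term.realize_func, ev, evalOps_X, ← BMdl.op_eq, op]

/-- This recovers the relations between a family from those between the family with an additional
member, by extension with the coefficient $0$. -/
lemma FD.option_relations {ι κ : Type} [Finite ι] [Finite κ] (ε : κ → Option ι) :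
    FD (fun (F : Type u) [Field F] (z : (ι × ι) ⊕ (κ × κ) → F) => ∀ r : ι → F,
      r ∈ rspan (fun ab => z (.inl ab)) ↔
        (fun j => (ε j).elim 0 r) ∈ rspan fun ab : κ × κ => z (.inr ab)) := by
  have h (j : κ) : FT (fun (F : Type u) [Field F] (z : ((ι × ι) ⊕ (κ × κ)) ⊕ ι → F) =>
      (ε j).elim 0 fun b => z (.inr b)) := by
    cases ε j with
    | none => exact FT.zero
    | some b => exact FT.var _
  exact FD.all (FD.iff (FD.mem_rspan (fun _ => FT.var _) fun _ => FT.var _)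
    (FD.mem_rspan (fun _ => FT.var _) h))

/-- Quantifier elimination. -/
theorem exists_isQF (φ : MSLanguage.Formula (lang n) Γ) :
    ∃ ψ : MSLanguage.Formula (lang n) Γ, ψ.IsQF ∧ ∀ (N : Str.{u} (lang n)) [BMdl N],
      Good I N → ∀ e : Env N Γ, φ.Realize e ↔ ψ.Realize e := by
  classical
  obtain ⟨d, h⟩ := sg_realize.{u} (I := I) φ
  obtain ⟨S, hS, h⟩ := h d le_rfl
  set ι : Type := Var Γ Srt.M × Box n d
  -- The additional index carries the zero vector. It keeps the number of vectors positive when no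
  -- module variable occurs, as there is no Grassmannian of index $0$.
  obtain ⟨i, ⟨ε⟩⟩ : ∃ i : ℕ+, Nonempty (Fin i ≃ Option ι) :=
    ⟨⟨Fintype.card (Option ι), Fintype.card_pos⟩, ⟨(Fintype.equivFin (Option ι)).symm⟩⟩
  choose τ hτ using fun (aμ : ι) => exists_monomial_term.{u} aμ.2.exp (.var aμ.1)
  let τ' : Option ι → Term (lang n) Γ Srt.M := fun
    | none => .func (L := lang n) Fun.mzero fun a => Fin.elim0 a
    | some aμ => τ aμ
  let k : Option (GVar Γ) → ℕ+ := fun o => o.elim i fun b => b.1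
  let s : ∀ b, Term (lang n) Γ (Srt.G (k b)) := fun
    | none => .func (L := lang n) (Fun.D i) fun j => τ' (ε j)
    | some b => .var b.2
  let S₁ : ∀ (F : Type u) [Field F], ((Σ b, Fin (k b) × Fin (k b)) ⊕ Var Γ Srt.K → F) →
      (RelIdx (Var Γ Srt.M) n d → F) → Prop := fun F _ z X => ∀ r : ι → F, r ∈ rspan X ↔
        (fun j : Fin i => (ε j).elim 0 r) ∈ rspan fun ab : Fin i × Fin i => z (.inl ⟨none, ab⟩)
  let S₂ : ∀ (F : Type u) [Field F], ((Σ b, Fin (k b) × Fin (k b)) ⊕ Var Γ Srt.K → F) →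
      (RelIdx (Var Γ Srt.M) n d → F) → Prop := fun F _ z X =>
        S F (Sum.elim X (Sum.elim (fun ba => z (.inl ⟨some ba.1, ba.2⟩)) fun x => z (.inr x)))
  have hS' : FD fun F _ z => ∃ X, S₁ F z X ∧ S₂ F z X := by
    refine FD.ex (S := fun F _ z X => S₁ F z X ∧ S₂ F z X) (.and ?_ ?_)
    · let g : (ι × ι) ⊕ (Fin i × Fin i) →
          ((Σ b, Fin (k b) × Fin (k b)) ⊕ Var Γ Srt.K) ⊕ RelIdx (Var Γ Srt.M) n d :=
        Sum.elim Sum.inr fun ab => .inl (.inl ⟨none, ab⟩)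
      have hg := (FD.option_relations.{u} (ι := ι) ε).comp g
      exact hg.congr fun F _ _ z => Iff.rfl
    · refine (hS.comp (Sum.elim Sum.inr (Sum.elim (fun ba => .inl (.inl ⟨some ba.1, ba.2⟩))
        fun x => .inl (.inr x)))).congr fun F _ _ z => iff_of_eq (congrArg (S F) ?_)
      ext (_ | _ | _) <;> rfl
  obtain ⟨ψ, hψ, h'⟩ := FD.exists_isQF.{u} (I := I) hS' s fun x => .var x
  refine ⟨ψ, hψ, fun N _ hN e => ?_⟩
  rw [h' N hN.tprops hN.isAlgClosed]
  set v : Var Γ Srt.M → M N := e Srt.M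
  -- The predicate asks for some representing matrices. Any choice gives the same answer, as the
  -- condition only depends on the relation space and on the assignment.
  have key (Y : (Σ b, Fin (k b) × Fin (k b)) → K N)
      (hY : ∀ b, proj N (fun a => Y ⟨b, a⟩) = (s b).realize e) :
      (∃ X, S₁ (K N) (Sum.elim Y fun c => e Srt.K c) X ∧
        S₂ (K N) (Sum.elim Y fun c => e Srt.K c) X) ↔
        φ.Realize e := by
    set c : Coord Γ → K N := Sum.elim (fun ba => Y ⟨some ba.1, ba.2⟩) fun x => e Srt.K x
    have he : envOf v c = e := by
      funext t x
      match t with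
      | .K => rfl
      | .M => rfl
      | .G i => exact hY (some ⟨i, x⟩)
    have hrel : rspan (fun ab : Fin i × Fin i => Y ⟨none, ab⟩) =
        relations fun j => ((τ' (ε j)).realize e : M N) :=
      (hN.tprops.dep_eq_iff i _ _).1 (hY none).symm
    have hr (r : ι → K N) : ((fun j : Fin i => (ε j).elim 0 r) ∈
        rspan fun ab : Fin i × Fin i => Y ⟨none, ab⟩) ↔ r ∈ relSub (ev N) d v := by
      rw [hrel, mem_relSub]
      change ∑ j, (ε j).elim 0 r • ((τ' (ε j)).realize e : M N) = 0 ↔ _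
      rw [ε.sum_comp fun o => o.elim 0 r • ((τ' o).realize e : M N), Fintype.sum_option,
        Fintype.sum_prod_type]
      simp only [Option.elim_none, zero_smul, zero_add, Option.elim_some, boxPoly_apply, map_sum,
        LinearMap.sum_apply]
      refine iff_of_eq (congrArg (· = 0) (Finset.sum_congr rfl fun a _ =>
        Finset.sum_congr rfl fun μ _ => ?_))
      rw [show monomial μ.exp (r (a, μ)) = r (a, μ) • (monomial μ.exp 1 : MvPolynomial (Fin n) (K N))
        by rw [smul_monomial, smul_eq_mul, mul_one], map_smul, LinearMap.smul_apply]
      exact congrArg _ (hτ (a, μ) N e)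
    constructor
    · rintro ⟨X, hX, hSX⟩
      rw [← he]
      refine (h N hN v (Sum.elim X c) ?_).2 hSX
      ext r
      exact (hX r).trans (hr r)
    · intro hφ
      rw [← he] at hφ
      obtain ⟨X, hX⟩ := exists_rspan_eq (relSub (ev N) d v)
      refine ⟨X, fun r => ?_, (h N hN v (Sum.elim X c) hX).1 hφ⟩
      rw [hX]
      exact (hr r).symm
  constructor
  · intro hφ
    choose Y hY using fun b => hN.tprops.proj_surjective (k b) ((s b).realize e)
    exact ⟨fun ba => Y ba.1 ba.2, hY, (key _ hY).2 hφ⟩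
  · rintro ⟨Y, hY, hSY⟩
    exact (key Y hY).1 hSY

end Elimination

end GrassModule

namespace GrassModule

open MvPolynomial Module MSLanguage UniformBounds

/-! ### Definability by formulas -/

section Definable

variable {n : ℕ} {𝒞 : Str.{u} (lang n) → Type u} {Γ : List (lang n).Srt}

/-- A relation on assignments in structures with additional data `𝒞` that is defined by a
formula. -/
def Def (𝒞 : Str.{u} (lang n) → Type u) (Γ : List (lang n).Srt)
    (R : ∀ N : Str.{u} (lang n), 𝒞 N → Env N Γ → Prop) : Prop :=
  ∃ φ : MSLanguage.Formula (lang n) Γ, ∀ N c e, φ.Realize e ↔ R N c e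

/-- A function on assignments in structures with additional data `𝒞` that is defined by a term. -/
def TDef (𝒞 : Str.{u} (lang n) → Type u) (Γ : List (lang n).Srt) {s : (lang n).Srt}
    (t : ∀ N : Str.{u} (lang n), 𝒞 N → Env N Γ → N.carrier s) : Prop :=
  ∃ τ : Term (lang n) Γ s, ∀ N c e, τ.realize e = t N c e

section Terms

lemma TDef.var {s : (lang n).Srt} (x : Var Γ s) : TDef 𝒞 Γ fun _ _ e => e s x :=
  ⟨.var x, fun _ _ _ => rfl⟩

variable {s t : ∀ N : Str.{u} (lang n), 𝒞 N → Env N Γ → K N}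
  {v w : ∀ N : Str.{u} (lang n), 𝒞 N → Env N Γ → M N}

lemma TDef.kadd (hs : TDef 𝒞 Γ s) (ht : TDef 𝒞 Γ t) :
    TDef 𝒞 Γ fun N c e => kadd N (s N c e) (t N c e) := by
  obtain ⟨σ, hs⟩ := hs
  obtain ⟨τ, ht⟩ := ht
  refine ⟨.func (L := lang n) Fun.kadd fun a : Fin 2 => if a = 0 then σ else τ, fun N c e => ?_⟩
  dsimp only
  rw [GrassModule.kadd, ← hs, ← ht, Term.realize_func]
  congr 1
  funext a
  fin_cases a <;> rfl

lemma TDef.kmul (hs : TDef 𝒞 Γ s) (ht : TDef 𝒞 Γ t) :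
    TDef 𝒞 Γ fun N c e => kmul N (s N c e) (t N c e) := by
  obtain ⟨σ, hs⟩ := hs
  obtain ⟨τ, ht⟩ := ht
  refine ⟨.func (L := lang n) Fun.kmul fun a : Fin 2 => if a = 0 then σ else τ, fun N c e => ?_⟩
  dsimp only
  rw [GrassModule.kmul, ← hs, ← ht, Term.realize_func]
  congr 1
  funext a
  fin_cases a <;> rfl

lemma TDef.kzero : TDef 𝒞 Γ fun N _ _ => kzero N := by
  refine ⟨.func (L := lang n) Fun.kzero fun a => Fin.elim0 a, fun N c e => ?_⟩
  dsimp only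
  rw [GrassModule.kzero, Term.realize_func]
  congr 1
  funext a
  exact Fin.elim0 a

lemma TDef.kone : TDef 𝒞 Γ fun N _ _ => kone N := by
  refine ⟨.func (L := lang n) Fun.kone fun a => Fin.elim0 a, fun N c e => ?_⟩
  dsimp only
  rw [GrassModule.kone, Term.realize_func]
  congr 1
  funext a
  exact Fin.elim0 a

lemma TDef.madd (hs : TDef 𝒞 Γ v) (ht : TDef 𝒞 Γ w) :
    TDef 𝒞 Γ fun N c e => madd N (v N c e) (w N c e) := by
  obtain ⟨σ, hs⟩ := hs
  obtain ⟨τ, ht⟩ := ht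
  refine ⟨.func (L := lang n) Fun.madd fun a : Fin 2 => if a = 0 then σ else τ, fun N c e => ?_⟩
  dsimp only
  rw [GrassModule.madd, ← hs, ← ht, Term.realize_func]
  congr 1
  funext a
  fin_cases a <;> rfl

lemma TDef.mzero : TDef 𝒞 Γ fun N _ _ => mzero N := by
  refine ⟨.func (L := lang n) Fun.mzero fun a => Fin.elim0 a, fun N c e => ?_⟩
  dsimp only
  rw [GrassModule.mzero, Term.realize_func]
  congr 1
  funext a
  exact Fin.elim0 a

lemma TDef.smul (hs : TDef 𝒞 Γ s) (ht : TDef 𝒞 Γ v) :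
    TDef 𝒞 Γ fun N c e => smul N (s N c e) (v N c e) := by
  obtain ⟨σ, hs⟩ := hs
  obtain ⟨τ, ht⟩ := ht
  refine ⟨.func (L := lang n) Fun.smul fun
    | (0 : Fin 2) => σ
    | (1 : Fin 2) => τ, fun N c e => ?_⟩
  dsimp only
  rw [GrassModule.smul, ← hs, ← ht, Term.realize_func]
  congr 1
  funext a
  fin_cases a <;> rfl

lemma TDef.op (j : Fin n) (ht : TDef 𝒞 Γ v) : TDef 𝒞 Γ fun N c e => op N j (v N c e) := by
  obtain ⟨τ, ht⟩ := ht
  refine ⟨.func (L := lang n) (Fun.op j) fun _ => τ, fun N c e => ?_⟩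
  dsimp only
  rw [GrassModule.op, ← ht, Term.realize_func]

lemma TDef.proj {i : ℕ+} {X : Fin i × Fin i → ∀ N : Str.{u} (lang n), 𝒞 N → Env N Γ → K N}
    (h : ∀ a, TDef 𝒞 Γ (X a)) : TDef 𝒞 Γ fun N c e => proj N fun a => X a N c e := by
  choose τ h using h
  refine ⟨.func (L := lang n) (Fun.π i) τ, fun N c e => ?_⟩
  simp only [GrassModule.proj, ← h, Term.realize_func]

lemma TDef.dep {i : ℕ+} {v : Fin i → ∀ N : Str.{u} (lang n), 𝒞 N → Env N Γ → M N}
    (h : ∀ a, TDef 𝒞 Γ (v a)) : TDef 𝒞 Γ fun N c e => dep N fun a => v a N c e := by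
  choose τ h using h
  refine ⟨.func (L := lang n) (Fun.D i) τ, fun N c e => ?_⟩
  simp only [GrassModule.dep, ← h, Term.realize_func]

end Terms

variable {R R' : ∀ N : Str.{u} (lang n), 𝒞 N → Env N Γ → Prop}

lemma Def.congr (h : Def 𝒞 Γ R) (hR : ∀ N c e, R' N c e ↔ R N c e) : Def 𝒞 Γ R' := by
  obtain ⟨φ, h⟩ := h
  exact ⟨φ, fun N c e => (h N c e).trans (hR N c e).symm⟩

lemma Def.false : Def 𝒞 Γ fun _ _ _ => False := ⟨.falsum, fun _ _ _ => Iff.rfl⟩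

lemma Def.imp (h : Def 𝒞 Γ R) (h' : Def 𝒞 Γ R') : Def 𝒞 Γ fun N c e => R N c e → R' N c e := by
  obtain ⟨φ, h⟩ := h
  obtain ⟨ψ, h'⟩ := h'
  exact ⟨.imp φ ψ, fun N c e => imp_congr (h N c e) (h' N c e)⟩

lemma Def.not (h : Def 𝒞 Γ R) : Def 𝒞 Γ fun N c e => ¬ R N c e := h.imp .false

lemma Def.and (h : Def 𝒞 Γ R) (h' : Def 𝒞 Γ R') : Def 𝒞 Γ fun N c e => R N c e ∧ R' N c e :=
  (h.imp h'.not).not.congr fun N c e => by tauto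

lemma Def.iff (h : Def 𝒞 Γ R) (h' : Def 𝒞 Γ R') : Def 𝒞 Γ fun N c e => R N c e ↔ R' N c e :=
  ((h.imp h').and (h'.imp h)).congr fun N c e => by tauto

lemma Def.forall_finite {ι : Type*} [Finite ι]
    {R : ι → ∀ N : Str.{u} (lang n), 𝒞 N → Env N Γ → Prop} (h : ∀ i, Def 𝒞 Γ (R i)) :
    Def 𝒞 Γ fun N c e => ∀ i, R i N c e := by
  classical
  have _ := Fintype.ofFinite ι
  have key (I : Finset ι) : Def 𝒞 Γ fun N c e => ∀ i ∈ I, R i N c e := by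
    induction I using Finset.induction_on with
    | empty => exact Def.false.not.congr fun N c e => by simp
    | insert i I _ ih => exact ((h i).and ih).congr fun N c e => by simp
  exact (key Finset.univ).congr fun N c e => by simp

lemma Def.eq {s : (lang n).Srt} {t t' : ∀ N : Str.{u} (lang n), 𝒞 N → Env N Γ → N.carrier s}
    (h : TDef 𝒞 Γ t) (h' : TDef 𝒞 Γ t') : Def 𝒞 Γ fun N c e => t N c e = t' N c e := by
  obtain ⟨τ, h⟩ := h
  obtain ⟨τ', h'⟩ := h'
  exact ⟨.equal τ τ', fun N c e => by
    dsimp only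
    rw [← h, ← h']
    rfl⟩

lemma Def.pred (r : Rel) {p : ∀ (j : Fin r.m) (N : Str.{u} (lang n)), 𝒞 N → Env N Γ → G N (r.k j)}
    (hp : ∀ j, TDef 𝒞 Γ (p j)) {x : Fin r.l → ∀ N : Str.{u} (lang n), 𝒞 N → Env N Γ → K N}
    (hx : ∀ b, TDef 𝒞 Γ (x b)) :
    Def 𝒞 Γ fun N c e => pred N r (fun j => p j N c e) fun b => x b N c e := by
  choose τ hp using hp
  choose τ' hx using hx
  refine ⟨.rel (L := lang n) r fun
    | .inl j => τ j
    | .inr b => τ' b, fun N c e => ?_⟩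
  simp only [GrassModule.pred, ← hp, ← hx]
  refine iff_of_eq (congrArg (N.relMap r) ?_)
  funext a
  rcases a with j | b <;> rfl

lemma Def.all {s : (lang n).Srt}
    {R : ∀ N : Str.{u} (lang n), 𝒞 N → Env N Γ → N.carrier s → Prop}
    (h : Def 𝒞 (s :: Γ) fun N c e => R N c (fun t x => e t (.succ x)) (e s .zero)) :
    Def 𝒞 Γ fun N c e => ∀ a, R N c e a := by
  obtain ⟨φ, h⟩ := h
  exact ⟨.all s φ, fun N c e => forall_congr' fun a => h N c (Env.cons a e)⟩

lemma Def.ex {s : (lang n).Srt}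
    {R : ∀ N : Str.{u} (lang n), 𝒞 N → Env N Γ → N.carrier s → Prop}
    (h : Def 𝒞 (s :: Γ) fun N c e => R N c (fun t x => e t (.succ x)) (e s .zero)) :
    Def 𝒞 Γ fun N c e => ∃ a, R N c e a :=
  (Def.all (R := fun N c e a => ¬ R N c e a) h.not).not.congr fun N c e => by simp

/-- Binding a variable enlarges the context. The hypothesis is therefore stated for all contexts to
which the given one maps, so that the induction can pass below a quantifier. -/
lemma Def.forall_fin {s : (lang n).Srt} (k : ℕ) : ∀ {Γ : List (lang n).Srt}
    {R : ∀ N : Str.{u} (lang n), 𝒞 N → Env N Γ → (Fin k → N.carrier s) → Prop}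
    (_ : ∀ (Γ' : List (lang n).Srt) (ρ : ∀ t, Var Γ t → Var Γ' t) (y : Fin k → Var Γ' s),
      Def 𝒞 Γ' fun N c e => R N c (fun t x => e t (ρ t x)) fun b => e s (y b)),
    Def 𝒞 Γ fun N c e => ∀ y, R N c e y := by
  induction k with
  | zero =>
    intro Γ R h
    refine (h Γ (fun _ x => x) Fin.elim0).congr fun N c e =>
      ⟨fun h => h _, fun h y => ?_⟩
    rwa [Subsingleton.elim y fun b => e s (Fin.elim0 b)]
  | succ k ih =>
    intro Γ R h
    have h₁ : Def 𝒞 Γ fun N c e => ∀ a, ∀ y : Fin k → N.carrier s, R N c e (Fin.cons a y) := by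
      refine Def.all (ih fun Γ' ρ y => ?_)
      refine (h Γ' (fun t x => ρ t (.succ x)) (Fin.cons (ρ s .zero) y)).congr fun N c e => ?_
      refine iff_of_eq (congrArg (R N c _) ?_)
      funext b
      refine Fin.cases ?_ (fun b => ?_) b <;> simp
    exact h₁.congr fun N c e => ⟨fun h a y => h _, fun h y => by
      rw [← Fin.cons_self_tail y]
      exact h _ _⟩

/-- Quantification over finitely many elements of one sort. -/
lemma Def.all_block {s : (lang n).Srt} {D : Type} [Finite D]
    {R : ∀ N : Str.{u} (lang n), 𝒞 N → Env N Γ → (D → N.carrier s) → Prop}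
    (h : ∀ (Γ' : List (lang n).Srt) (ρ : ∀ t, Var Γ t → Var Γ' t) (y : D → Var Γ' s),
      Def 𝒞 Γ' fun N c e => R N c (fun t x => e t (ρ t x)) fun b => e s (y b)) :
    Def 𝒞 Γ fun N c e => ∀ y, R N c e y := by
  obtain ⟨k, ⟨ε⟩⟩ := Finite.exists_equiv_fin D
  refine (Def.forall_fin k (R := fun N c e y => R N c e fun b => y (ε b)) fun Γ' ρ y =>
    h Γ' ρ fun b => y (ε b)).congr fun N c e => ⟨fun h y => h _, fun h y => ?_⟩
  simpa using h fun b => y (ε.symm b)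

lemma Def.ex_block {s : (lang n).Srt} {D : Type} [Finite D]
    {R : ∀ N : Str.{u} (lang n), 𝒞 N → Env N Γ → (D → N.carrier s) → Prop}
    (h : ∀ (Γ' : List (lang n).Srt) (ρ : ∀ t, Var Γ t → Var Γ' t) (y : D → Var Γ' s),
      Def 𝒞 Γ' fun N c e => R N c (fun t x => e t (ρ t x)) fun b => e s (y b)) :
    Def 𝒞 Γ fun N c e => ∃ y, R N c e y :=
  (Def.all_block (R := fun N c e y => ¬ R N c e y) fun Γ' ρ y => (h Γ' ρ y).not).not.congr
    fun N c e => by simp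

/-- The sentences that hold in all structures with a given property. -/
def thyOf (P : Str.{u} (lang n) → Prop) : Thy (lang n) :=
  {σ | ∀ N : Str.{u} (lang n), P N → σ.Realize (Env.nil : Env N [])}

/-- The sentence that defines $R$ holds throughout the class, hence belongs to the theory. It does
not depend on the additional data, so it may be checked with one choice of them and used with
another. -/
lemma Def.of_models {P : Str.{u} (lang n) → Prop}
    {R : ∀ N : Str.{u} (lang n), 𝒞 N → Env N [] → Prop} (h : Def 𝒞 [] R)
    (hP : ∀ N, P N → ∃ c, R N c Env.nil) {N : Str.{u} (lang n)} (hN : N.Models (thyOf P))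
    (c : 𝒞 N) : R N c Env.nil := by
  obtain ⟨φ, h⟩ := h
  refine (h N c _).1 (hN φ fun N' hN' => ?_)
  obtain ⟨c', hc'⟩ := hP N' hN'
  exact (h N' c' _).2 hc'

end Definable

/-! ### The axioms for the field, the module and the operators -/

section Raw

variable {n : ℕ}

/-- The axioms for the field, the module and the operators. -/
def RawAxioms (N : Str.{u} (lang n)) : Prop :=
  (∀ x y z, kadd N (kadd N x y) z = kadd N x (kadd N y z)) ∧
  (∀ x, kadd N (kzero N) x = x) ∧
  (∀ x, ∃ y, kadd N y x = kzero N) ∧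
  (∀ x y z, kmul N (kmul N x y) z = kmul N x (kmul N y z)) ∧
  (∀ x y, kmul N x y = kmul N y x) ∧
  (∀ x, kmul N (kone N) x = x) ∧
  (∀ x, ¬ x = kzero N → ∃ y, kmul N x y = kone N) ∧
  (∀ x y z, kmul N x (kadd N y z) = kadd N (kmul N x y) (kmul N x z)) ∧
  (¬ kzero N = kone N) ∧
  (∀ x y z, madd N (madd N x y) z = madd N x (madd N y z)) ∧
  (∀ x y, madd N x y = madd N y x) ∧
  (∀ x, madd N (mzero N) x = x) ∧
  (∀ x, ∃ y, madd N y x = mzero N) ∧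
  (∀ x y z, smul N x (madd N y z) = madd N (smul N x y) (smul N x z)) ∧
  (∀ x y z, smul N (kadd N x y) z = madd N (smul N x z) (smul N y z)) ∧
  (∀ x y z, smul N (kmul N x y) z = smul N x (smul N y z)) ∧
  (∀ x, smul N (kone N) x = x) ∧
  (∀ j x y, op N j (madd N x y) = madd N (op N j x) (op N j y)) ∧
  (∀ j x y, op N j (smul N x y) = smul N x (op N j y)) ∧
  (∀ i j x, op N i (op N j x) = op N j (op N i x))

/-- No additional data are allowed here, since these axioms are what produces the field and module
structures in the first place. -/
lemma def_rawAxioms : Def (n := n) (fun _ => PUnit.{u + 1}) [] fun N _ _ => RawAxioms N := by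
  unfold RawAxioms
  repeat'
    first
    | exact TDef.var _
    | exact TDef.kzero
    | exact TDef.kone
    | exact TDef.mzero
    | refine TDef.kadd ?_ ?_
    | refine TDef.kmul ?_ ?_
    | refine TDef.madd ?_ ?_
    | refine TDef.smul ?_ ?_
    | refine TDef.op _ ?_
    | refine Def.eq ?_ ?_
    | refine Def.not ?_
    | refine Def.and ?_ ?_
    | refine Def.all ?_
    | refine Def.ex ?_
    | refine Def.forall_finite fun _ => ?_
    | refine Def.imp ?_ ?_

lemma rawAxioms (N : Str.{u} (lang n)) [BMdl N] : RawAxioms N := by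
  have hT (i j : Fin n) (x : M N) : BMdl.T i (BMdl.T j x) = BMdl.T j (BMdl.T i x) :=
    LinearMap.congr_fun (BMdl.commute (N := N) i j).eq x
  unfold RawAxioms
  simp only [BMdl.kadd_eq, BMdl.kmul_eq, BMdl.kzero_eq, BMdl.kone_eq, BMdl.madd_eq, BMdl.mzero_eq,
    BMdl.smul_eq, BMdl.op_eq]
  refine ⟨add_assoc, zero_add, fun x => ⟨-x, neg_add_cancel x⟩, mul_assoc, mul_comm, one_mul,
    fun x hx => ⟨x⁻¹, mul_inv_cancel₀ hx⟩, mul_add, zero_ne_one, add_assoc, add_comm, zero_add,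
    fun x => ⟨-x, neg_add_cancel x⟩, smul_add, add_smul, mul_smul, one_smul (K N),
    fun j => map_add _, fun j => map_smul _, hT⟩

lemma RawAxioms.exists_bMdl {N : Str.{u} (lang n)} (h : RawAxioms N) : Nonempty (BMdl N) := by
  classical
  obtain ⟨h1, h2, h3, h4, h5, h6, h7, h8, h9, h10, h11, h12, h13, h14, h15, h16, h17, h18, h19,
    h20⟩ := h
  choose ng hng using h3
  choose iv hiv using h7
  choose mng hmng using h13
  let _ : Add (K N) := ⟨kadd N⟩
  let _ : Mul (K N) := ⟨kmul N⟩
  let _ : Neg (K N) := ⟨ng⟩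
  let _ : Zero (K N) := ⟨kzero N⟩
  let _ : One (K N) := ⟨kone N⟩
  let _ : Inv (K N) := ⟨fun x => if hx : x = kzero N then kzero N else iv x hx⟩
  let _ : Field (K N) := Field.ofMinimalAxioms (K N) h1 h2 hng h4 h5 h6
    (fun x hx => (congrArg (kmul N x) (dif_neg hx)).trans (hiv x hx)) (dif_pos rfl) h8
    ⟨_, _, h9⟩
  let _ : Add (M N) := ⟨madd N⟩
  let _ : Neg (M N) := ⟨mng⟩
  let _ : Zero (M N) := ⟨mzero N⟩
  let _ : AddGroup (M N) := AddGroup.ofLeftAxioms h10 h12 hmng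
  let _ : AddCommGroup (M N) := { (inferInstance : AddGroup (M N)) with add_comm := h11 }
  let _ : SMul (K N) (M N) := ⟨smul N⟩
  let _ : Module (K N) (M N) := Module.ofMinimalAxioms h14 h15 h16 h17
  exact ⟨{
    kadd_eq := fun _ _ => rfl
    kmul_eq := fun _ _ => rfl
    kzero_eq := rfl
    kone_eq := rfl
    madd_eq := fun _ _ => rfl
    mzero_eq := rfl
    smul_eq := fun _ _ => rfl
    T := fun j => { toFun := op N j, map_add' := h18 j, map_smul' := h19 j }
    op_eq := fun _ _ => rfl
    commute := fun i j => LinearMap.ext (h20 i j) }⟩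

end Raw

end GrassModule

namespace GrassModule

open MvPolynomial Module MSLanguage UniformBounds

/-! ### The axioms for the Grassmannians -/

section Axioms

variable {n : ℕ} {Γ : List (lang n).Srt}

lemma TDef.congr {𝒞 : Str.{u} (lang n) → Type u} {s : (lang n).Srt}
    {t t' : ∀ N : Str.{u} (lang n), 𝒞 N → Env N Γ → N.carrier s} (h : TDef 𝒞 Γ t)
    (ht : ∀ N c e, t' N c e = t N c e) : TDef 𝒞 Γ t' := by
  obtain ⟨τ, h⟩ := h
  exact ⟨τ, fun N c e => (h N c e).trans (ht N c e).symm⟩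

section Terms

variable {s t : ∀ N : Str.{u} (lang n), BMdl N → Env N Γ → K N}
  {v w : ∀ N : Str.{u} (lang n), BMdl N → Env N Γ → M N}

lemma TDef.add (hs : TDef BMdl Γ s) (ht : TDef BMdl Γ t) :
    TDef BMdl Γ fun N c e => s N c e + t N c e :=
  (hs.kadd ht).congr fun _ _ _ => (BMdl.kadd_eq _ _).symm

lemma TDef.mul (hs : TDef BMdl Γ s) (ht : TDef BMdl Γ t) :
    TDef BMdl Γ fun N c e => s N c e * t N c e :=
  (hs.kmul ht).congr fun _ _ _ => (BMdl.kmul_eq _ _).symm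

lemma TDef.zero : TDef BMdl Γ fun (N : Str.{u} (lang n)) _ _ => (0 : K N) :=
  TDef.kzero.congr fun _ _ _ => BMdl.kzero_eq.symm

lemma TDef.one : TDef BMdl Γ fun (N : Str.{u} (lang n)) _ _ => (1 : K N) :=
  TDef.kone.congr fun _ _ _ => BMdl.kone_eq.symm

lemma TDef.natCast (k : ℕ) : TDef BMdl Γ fun (N : Str.{u} (lang n)) _ _ => (k : K N) := by
  induction k with
  | zero => exact TDef.zero.congr fun _ _ _ => Nat.cast_zero
  | succ k ih => exact (ih.add TDef.one).congr fun _ _ _ => Nat.cast_succ k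

lemma TDef.pow (hs : TDef BMdl Γ s) (k : ℕ) : TDef BMdl Γ fun N c e => s N c e ^ k := by
  induction k with
  | zero => exact TDef.one.congr fun _ _ _ => pow_zero _
  | succ k ih => exact (ih.mul hs).congr fun _ _ _ => pow_succ _ _

lemma TDef.sum {ι : Type*} (J : Finset ι)
    {s : ι → ∀ N : Str.{u} (lang n), BMdl N → Env N Γ → K N} (h : ∀ i, TDef BMdl Γ (s i)) :
    TDef BMdl Γ fun N c e => ∑ i ∈ J, s i N c e := by
  classical
  induction J using Finset.induction_on with
  | empty => exact TDef.zero.congr fun _ _ _ => Finset.sum_empty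
  | insert i J hi ih => exact ((h i).add ih).congr fun _ _ _ => Finset.sum_insert hi

lemma TDef.vadd (hs : TDef BMdl Γ v) (ht : TDef BMdl Γ w) :
    TDef BMdl Γ fun N c e => v N c e + w N c e :=
  (hs.madd ht).congr fun _ _ _ => (BMdl.madd_eq _ _).symm

lemma TDef.vzero : TDef BMdl Γ fun (N : Str.{u} (lang n)) _ _ => (0 : M N) :=
  TDef.mzero.congr fun _ _ _ => BMdl.mzero_eq.symm

lemma TDef.vsmul (hs : TDef BMdl Γ s) (ht : TDef BMdl Γ v) :
    TDef BMdl Γ fun N c e => s N c e • v N c e :=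
  (hs.smul ht).congr fun _ _ _ => (BMdl.smul_eq _ _).symm

lemma TDef.vsum {ι : Type*} (J : Finset ι)
    {s : ι → ∀ N : Str.{u} (lang n), BMdl N → Env N Γ → M N} (h : ∀ i, TDef BMdl Γ (s i)) :
    TDef BMdl Γ fun N c e => ∑ i ∈ J, s i N c e := by
  classical
  induction J using Finset.induction_on with
  | empty => exact TDef.vzero.congr fun _ _ _ => Finset.sum_empty
  | insert i J hi ih => exact ((h i).vadd ih).congr fun _ _ _ => Finset.sum_insert hi

lemma TDef.ev_monomial (k : Fin n →₀ ℕ) (hv : TDef BMdl Γ v) :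
    TDef BMdl Γ fun N c e => ev N (monomial k 1) (v N c e) := by
  obtain ⟨τ, hv⟩ := hv
  obtain ⟨τ', h⟩ := exists_monomial_term.{u} k τ
  exact ⟨τ', fun N c e => by dsimp only; rw [h, hv]⟩

lemma TDef.ev_boxPoly {d : ℕ} {a : Box n d → ∀ N : Str.{u} (lang n), BMdl N → Env N Γ → K N}
    (ha : ∀ μ, TDef BMdl Γ (a μ)) (hv : TDef BMdl Γ v) :
    TDef BMdl Γ fun N c e => ev N (boxPoly fun μ => a μ N c e) (v N c e) := by
  refine (TDef.vsum Finset.univ fun μ => (ha μ).vsmul (hv.ev_monomial μ.exp)).congr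
    fun N c e => ?_
  simp only [boxPoly_apply, map_sum, LinearMap.sum_apply]
  refine Finset.sum_congr rfl fun μ _ => ?_
  rw [show monomial μ.exp (a μ N c e) = a μ N c e • (monomial μ.exp 1 : MvPolynomial (Fin n) (K N))
    by rw [smul_monomial, smul_eq_mul, mul_one], map_smul, LinearMap.smul_apply]

end Terms

lemma Def.mem_rowSpan {i : ℕ+} (X : Fin i × Fin i → Var Γ Srt.K) (r : Fin i → Var Γ Srt.K) :
    Def BMdl Γ fun (N : Str.{u} (lang n)) _ e =>
      (fun b => (e Srt.K (r b) : K N)) ∈ rowSpan fun ab => (e Srt.K (X ab) : K N) := by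
  refine (Def.ex_block (𝒞 := BMdl) (D := Fin i) (s := Srt.K) (R := fun N c e y => ∀ b,
    ∑ a, (y a : K N) * e Srt.K (X (a, b)) = e Srt.K (r b)) fun Γ' ρ y =>
    Def.forall_finite fun b => Def.eq (TDef.sum _ fun a => TDef.mul (TDef.var _) (TDef.var _))
      (TDef.var _)).congr fun N c e => ?_
  rw [rowSpan, Submodule.mem_span_range_iff_exists_fun]
  simp only [funext_iff, Finset.sum_apply, Pi.smul_apply, smul_eq_mul]

lemma Def.rowSpan_eq {i : ℕ+} (X Y : Fin i × Fin i → Var Γ Srt.K) :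
    Def BMdl Γ fun (N : Str.{u} (lang n)) _ e =>
      (rowSpan fun ab => (e Srt.K (X ab) : K N)) = rowSpan fun ab => (e Srt.K (Y ab) : K N) := by
  refine (Def.all_block (𝒞 := BMdl) (D := Fin i) (s := Srt.K) (R := fun N c e r =>
    r ∈ rowSpan (fun ab => (e Srt.K (X ab) : K N)) ↔
      r ∈ rowSpan fun ab => (e Srt.K (Y ab) : K N)) fun Γ' ρ r =>
    Def.iff (Def.mem_rowSpan (fun ab => ρ _ (X ab)) r)
      (Def.mem_rowSpan (fun ab => ρ _ (Y ab)) r)).congr fun N c e => ?_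
  rw [SetLike.ext_iff]

lemma TDef.fieldValue {α : Type} (t : fieldLang.Term α)
    {z : α → ∀ N : Str.{u} (lang n), BMdl N → Env N Γ → K N} (hz : ∀ a, TDef BMdl Γ (z a)) :
    TDef BMdl Γ fun N c e => fieldValue t (K N) fun a => z a N c e := by
  induction t with
  | var a => exact hz a
  | func f ts ih =>
    simp only [fieldValue_func]
    cases f with
    | zero => exact TDef.zero
    | one => exact TDef.one
    | add => exact (ih 0).add (ih 1)
    | mul => exact (ih 0).mul (ih 1)

lemma fieldHolds_equal {α : Type} (t₁ t₂ : fieldLang.Term (α ⊕ Fin 0)) (F : Type u) [Field F]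
    (x : α → F) : FieldHolds (.equal t₁ t₂) F x ↔
      fieldValue t₁ F (Sum.elim x Fin.elim0) = fieldValue t₂ F (Sum.elim x Fin.elim0) := by
  let _ := fieldStructure F
  change FirstOrder.Language.BoundedFormula.Realize _ _ _ ↔ _
  rw [Subsingleton.elim (default : Fin 0 → F) Fin.elim0]
  rfl

lemma Def.fieldHolds {α : Type} {φ : fieldLang.Formula α} (hφ : φ.IsQF)
    {z : α → ∀ N : Str.{u} (lang n), BMdl N → Env N Γ → K N} (hz : ∀ a, TDef BMdl Γ (z a)) :
    Def BMdl Γ fun N c e => FieldHolds φ (K N) fun a => z a N c e := by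
  have key : ∀ {φ : fieldLang.BoundedFormula α 0}, φ.IsQF →
      Def BMdl Γ fun N c e => FieldHolds φ (K N) fun a => z a N c e := by
    intro φ hφ
    induction hφ with
    | falsum => exact Def.false
    | of_isAtomic h =>
      cases h with
      | equal t₁ t₂ =>
        have hv (i : α ⊕ Fin 0) : TDef BMdl Γ fun N c e =>
            (Sum.elim (fun a => z a N c e) Fin.elim0 : α ⊕ Fin 0 → K N) i := by
          rcases i with a | i
          · exact hz a
          · exact i.elim0
        exact (Def.eq (TDef.fieldValue t₁ hv) (TDef.fieldValue t₂ hv)).congr fun N c e =>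
          fieldHolds_equal _ _ _ _
      | rel R ts => exact R.elim
    | imp _ _ h₁ h₂ => exact (h₁.imp h₂).congr fun N c e => Iff.rfl
  exact key hφ

variable {I : Ideal (MvPolynomial (Fin n) ℤ)} {P : Str.{u} (lang n) → Prop}

/-- The language has no subtraction, so positive and negative parts of the coefficients are put on
different sides. -/
lemma ev_map_eq_zero_iff (N : Str.{u} (lang n)) [BMdl N] (p : MvPolynomial (Fin n) ℤ) :
    ev N (map (Int.castRingHom (K N)) p) = 0 ↔ ∀ x : M N,
      ∑ s ∈ p.support, (((coeff s p).toNat : ℕ) : K N) • ev N (monomial s 1) x =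
        ∑ s ∈ p.support, (((- coeff s p).toNat : ℕ) : K N) • ev N (monomial s 1) x := by
  have h : map (Int.castRingHom (K N)) p = ∑ s ∈ p.support,
      (((coeff s p : ℤ) : K N) • monomial s 1 : MvPolynomial (Fin n) (K N)) := by
    refine (congrArg (map (Int.castRingHom (K N))) p.as_sum).trans ?_
    rw [map_sum]
    refine Finset.sum_congr rfl fun s _ => ?_
    rw [map_monomial, smul_monomial, smul_eq_mul, mul_one]
    rfl
  have hc (k : ℤ) : (k : K N) = (k.toNat : K N) - ((-k).toNat : K N) := by
    conv_lhs => rw [← Int.toNat_sub_toNat_neg k]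
    push_cast
    rfl
  rw [h, LinearMap.ext_iff]
  refine forall_congr' fun x => ?_
  rw [LinearMap.zero_apply, ← sub_eq_zero (a := ∑ s ∈ p.support, _ • _), ← Finset.sum_sub_distrib]
  simp only [hc (coeff _ p), map_sum, map_smul, LinearMap.sum_apply, LinearMap.smul_apply, sub_smul,
    map_sub, LinearMap.sub_apply]

/-- Each property, for each index, predicate or polynomial, is one sentence in which equality of
subspaces is spelled out by linear combinations of rows. -/
lemma tProps_of_models (hP : ∀ N, P N → ∃ _ : BMdl N, TProps I N) {N : Str.{u} (lang n)}
    (hN : N.Models (thyOf P)) [c : BMdl N] : TProps I N := by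
  have surj (i : ℕ+) : ∀ p : G N i, ∃ X : Fin i × Fin i → K N, proj N X = p := by
    refine Def.of_models (𝒞 := BMdl)
      (R := fun N _ _ => ∀ p : G N i, ∃ X : Fin i × Fin i → K N, proj N X = p)
      (Def.all (Def.ex_block fun Γ' ρ y => Def.eq (TDef.proj fun a => TDef.var _) (TDef.var _)))
      (fun N hN => ?_) hN c
    obtain ⟨b, h⟩ := hP N hN
    exact ⟨b, h.proj_surjective i⟩
  refine ⟨surj, fun i => ?_, fun r => ?_, fun i => ?_, fun p hp => ?_⟩
  · refine Def.of_models (𝒞 := BMdl)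
      (R := fun N _ _ => ∀ X Y : Fin i × Fin i → K N, proj N X = proj N Y ↔ rowSpan X = rowSpan Y)
      (Def.all_block fun Γ₁ ρ₁ X => Def.all_block fun Γ₂ ρ₂ Y => Def.iff
        (Def.eq (TDef.proj fun a => TDef.var _) (TDef.proj fun a => TDef.var _))
        (Def.rowSpan_eq (fun ab => ρ₂ _ (X ab)) Y))
      (fun N hN => ?_) hN c
    obtain ⟨b, h⟩ := hP N hN
    exact ⟨b, h.proj_eq_iff i⟩
  -- The arguments of the predicate have different sorts. They are quantified in one block by means
  -- of matrices that represent them.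
  · have key := Def.of_models (𝒞 := BMdl)
      (R := fun N _ _ => ∀ (Y : (Σ j : Fin r.m, Fin (r.k j) × Fin (r.k j)) → K N)
        (x : Fin r.l → K N), pred N r (fun j => proj N fun a => Y ⟨j, a⟩) x ↔
          ∃ X : (Σ j : Fin r.m, Fin (r.k j) × Fin (r.k j)) → K N,
            FieldHolds r.φ (K N) (Sum.elim X x) ∧
            ∀ j, proj N (fun a => X ⟨j, a⟩) = proj N fun a => Y ⟨j, a⟩)
      (P := P) (Def.all_block fun Γ₁ ρ₁ Y => Def.all_block fun Γ₂ ρ₂ x => Def.iff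
        (Def.pred r (fun j => TDef.proj fun a => TDef.var _) fun b => TDef.var _)
        (Def.ex_block fun Γ₃ ρ₃ X => Def.and ?_ (Def.forall_finite fun j => Def.eq
          (TDef.proj fun a => TDef.var _) (TDef.proj fun a => TDef.var _))))
      (fun N hN => ?_) hN c
    · intro p x
      choose Y hY using fun j => surj (r.k j) (p j)
      obtain rfl : (fun j => proj N (Y j)) = p := funext hY
      refine (key (fun ja => Y ja.1 ja.2) x).trans ?_
      constructor
      · rintro ⟨X, h₁, h₂⟩
        exact ⟨fun j a => X ⟨j, a⟩, h₁, h₂⟩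
      · rintro ⟨X, h₁, h₂⟩
        exact ⟨fun ja => X ja.1 ja.2, h₁, h₂⟩
    · refine (Def.fieldHolds r.isQF (z := Sum.elim (fun a N _ e => e Srt.K (X a))
        fun b N _ e => e Srt.K (ρ₃ _ (x b))) ?_).congr fun N _ e =>
          iff_of_eq (congrArg (FieldHolds r.φ (K N)) ?_)
      · rintro (a | b) <;> exact TDef.var _
      · ext (a | b) <;> rfl
    · obtain ⟨b, h⟩ := hP N hN
      refine ⟨b, fun Y x => (h.pred_iff r _ x).trans ?_⟩
      constructor
      · rintro ⟨X, h₁, h₂⟩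
        exact ⟨fun ja => X ja.1 ja.2, h₁, h₂⟩
      · rintro ⟨X, h₁, h₂⟩
        exact ⟨fun j a => X ⟨j, a⟩, h₁, h₂⟩
  · have key := Def.of_models (𝒞 := BMdl)
      (R := fun N _ _ => ∀ (v : Fin i → M N) (X : Fin i × Fin i → K N), dep N v = proj N X ↔
        ∀ r : Fin i → K N, r ∈ rowSpan X ↔ ∑ a, r a • v a = 0)
      (P := P) (Def.all_block fun Γ₁ ρ₁ v => Def.all_block fun Γ₂ ρ₂ X => Def.iff
        (Def.eq (TDef.dep fun a => TDef.var _) (TDef.proj fun a => TDef.var _))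
        (Def.all_block fun Γ₃ ρ₃ r => Def.iff (Def.mem_rowSpan (fun ab => ρ₃ _ (X ab)) r)
          (Def.eq (TDef.vsum _ fun a => TDef.vsmul (TDef.var _) (TDef.var _)) TDef.vzero)))
      (fun N hN => ?_) hN c
    · exact fun v X => (key v X).trans
        (SetLike.ext_iff (p := rowSpan X) (q := relations v)).symm
    · obtain ⟨b, h⟩ := hP N hN
      refine ⟨b, fun v X => ?_⟩
      rw [h.dep_eq_iff, SetLike.ext_iff]
      rfl
  · rw [ev_map_eq_zero_iff]
    refine Def.of_models (𝒞 := BMdl) (R := fun N _ _ => ∀ x : M N,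
      ∑ s ∈ p.support, (((coeff s p).toNat : ℕ) : K N) • ev N (monomial s 1) x =
        ∑ s ∈ p.support, (((- coeff s p).toNat : ℕ) : K N) • ev N (monomial s 1) x)
      (Def.all (Def.eq (TDef.vsum _ fun s => (TDef.natCast _).vsmul ((TDef.var _).ev_monomial s))
        (TDef.vsum _ fun s => (TDef.natCast _).vsmul ((TDef.var _).ev_monomial s))))
      (fun N hN => ?_) hN c
    obtain ⟨b, h⟩ := hP N hN
    exact ⟨b, (ev_map_eq_zero_iff N p).1 (h.ideal_eq_zero p hp)⟩

lemma isAlgClosed_of_models (hP : ∀ N, P N → ∃ _ : BMdl N, IsAlgClosed (K N))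
    {N : Str.{u} (lang n)} (hN : N.Models (thyOf P)) [c : BMdl N] : IsAlgClosed (K N) := by
  -- One sentence per degree: every monic polynomial of degree $d+1$ has a root.
  have key (d : ℕ) : ∀ a : Fin (d + 1) → K N, ∃ x : K N,
      ∑ i, a i * x ^ (i : ℕ) + x ^ (d + 1) = 0 := by
    refine Def.of_models (𝒞 := BMdl) (R := fun N _ _ => ∀ a : Fin (d + 1) → K N, ∃ x : K N,
      ∑ i, a i * x ^ (i : ℕ) + x ^ (d + 1) = 0)
      (Def.all_block fun Γ' ρ a => Def.ex (Def.eq (TDef.add (TDef.sum _ fun i =>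
        (TDef.var _).mul ((TDef.var _).pow _)) ((TDef.var _).pow _)) TDef.zero))
      (fun N hN => ?_) hN c
    obtain ⟨b, h⟩ := hP N hN
    refine ⟨b, fun a => ?_⟩
    set f : Polynomial (K N) := Polynomial.X ^ (d + 1) + ∑ i : Fin (d + 1),
      Polynomial.C (a i) * Polynomial.X ^ (i : ℕ) with hf
    obtain ⟨x, hx⟩ := IsAlgClosed.exists_root f (by
      rw [hf, Polynomial.degree_add_eq_left_of_degree_lt]
      · rw [Polynomial.degree_X_pow]
        exact_mod_cast Nat.succ_ne_zero d
      · rw [Polynomial.degree_X_pow]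
        exact Polynomial.degree_sum_fin_lt a)
    refine ⟨x, ?_⟩
    simpa [hf, Polynomial.IsRoot, Polynomial.eval_finsetSum, add_comm] using hx
  refine IsAlgClosed.of_exists_root _ fun f hf hirr => ?_
  obtain ⟨d, hd⟩ := Nat.exists_eq_succ_of_ne_zero hirr.natDegree_pos.ne'
  obtain ⟨x, hx⟩ := key d fun i => f.coeff i
  refine ⟨x, ?_⟩
  rw [Polynomial.eval_eq_sum_range, Finset.sum_range_succ, hf.coeff_natDegree, one_mul, hd,
    Finset.sum_range]
  exact hx

end Axioms

end GrassModule

namespace GrassModule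

open MvPolynomial Module MSLanguage UniformBounds

/-! ### The axioms for solvability -/

section Solvability

variable {n : ℕ}

/-- With bounded multipliers, ideal membership is a condition on finitely many coefficients.
`exists_uniform_bound` shows that a suitable bound loses nothing. -/
lemma FD.member {q m : ℕ} (p : Fin q → MvPolynomial (Fin n) ℤ) (d D : ℕ) :
    FD (fun (F : Type u) [Field F] (z : (Fin m × Box n d) ⊕ Box n d → F) =>
      ∃ y : (Fin m × Box n D) ⊕ (Fin q × Box n D) → F,
        ∑ i, (boxPoly fun μ => y (.inl (i, μ))) * (boxPoly fun μ => z (.inl (i, μ))) +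
          ∑ j, (boxPoly fun μ => y (.inr (j, μ))) * map (Int.castRingHom F) (p j) =
          boxPoly fun μ => z (.inr μ)) := by
  refine FD.ex ?_
  dsimp only
  exact UP.eq (UP.add (UP.sum _ fun i => UP.mul (UP.boxPoly fun μ => FT.var _)
    (UP.boxPoly fun μ => FT.var _)) (UP.sum _ fun j => UP.mul (UP.boxPoly fun μ => FT.var _)
      (UP.map_int _))) (UP.boxPoly fun μ => FT.var _)

lemma FD.syzygy {q m : ℕ} (p : Fin q → MvPolynomial (Fin n) ℤ) (d D : ℕ) :
    FD (fun (F : Type u) [Field F] (z : (Fin m × Box n d) ⊕ (Fin m × Box n D) → F) =>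
      ∃ y : Fin q × Box n D → F,
        ∑ i, (boxPoly fun μ => z (.inr (i, μ))) * (boxPoly fun μ => z (.inl (i, μ))) +
          ∑ j, (boxPoly fun μ => y (j, μ)) * map (Int.castRingHom F) (p j) = 0) := by
  refine FD.ex ?_
  dsimp only
  exact UP.eq (UP.add (UP.sum _ fun i => UP.mul (UP.boxPoly fun μ => FT.var _)
    (UP.boxPoly fun μ => FT.var _)) (UP.sum _ fun j => UP.mul (UP.boxPoly fun μ => FT.var _)
      (UP.map_int _))) UP.zero

/-- The solvability condition for polynomials of bounded degree, with formulas that express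
membership in an ideal and the relations between the generators of an ideal. -/
def SolvableWith {m d D : ℕ} (φ : fieldLang.Formula ((Fin m × Box n d) ⊕ Box n d))
    (ψ : fieldLang.Formula ((Fin m × Box n d) ⊕ (Fin m × Box n D))) (k r : ℕ)
    (N : Str.{u} (lang n)) [BMdl N] : Prop :=
  ∀ (f : Fin m × Box n d → K N) (g : Fin k × Box n d → K N) (v : Fin m → M N) (u : Fin r → M N),
    (∀ j, ¬ FieldHolds φ (K N) (Sum.elim f fun μ => g (j, μ))) →
    (∀ t : Fin m × Box n D → K N, FieldHolds ψ (K N) (Sum.elim f t) →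
      ∑ i, ev N (boxPoly fun μ => t (i, μ)) (v i) = 0) →
    ∃ x : M N, (∀ i, ev N (boxPoly fun μ => f (i, μ)) x = v i) ∧
      ∀ j, ¬ ∃ c : Fin r → K N, ∑ l, c l • u l = ev N (boxPoly fun μ => g (j, μ)) x

lemma def_solvableWith {m d D : ℕ} {φ : fieldLang.Formula ((Fin m × Box n d) ⊕ Box n d)}
    (hφ : φ.IsQF) {ψ : fieldLang.Formula ((Fin m × Box n d) ⊕ (Fin m × Box n D))} (hψ : ψ.IsQF)
    (k r : ℕ) : Def BMdl [] fun (N : Str.{u} (lang n)) _ _ => SolvableWith φ ψ k r N := by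
  unfold SolvableWith
  refine Def.all_block fun Γ₁ ρ₁ f => Def.all_block fun Γ₂ ρ₂ g => Def.all_block fun Γ₃ ρ₃ v =>
    Def.all_block fun Γ₄ ρ₄ w => Def.imp (Def.forall_finite fun j => Def.not ?_)
      (Def.imp (Def.all_block fun Γ₅ ρ₅ t => Def.imp ?_ ?_)
        (Def.ex (Def.and (Def.forall_finite fun i => ?_) (Def.forall_finite fun j =>
          Def.not (Def.ex_block fun Γ₅ ρ₅ c => ?_)))))
  · refine (Def.fieldHolds hφ (z := Sum.elim (fun i N _ e => e Srt.K (ρ₄ _ (ρ₃ _ (ρ₂ _ (f i)))))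
      fun μ N _ e => e Srt.K (ρ₄ _ (ρ₃ _ (g (j, μ))))) ?_).congr fun N _ e =>
        iff_of_eq (congrArg (FieldHolds φ (K N)) ?_)
    · rintro (a | b) <;> exact TDef.var _
    · ext (a | b) <;> rfl
  · refine (Def.fieldHolds hψ (z := Sum.elim
      (fun i N _ e => e Srt.K (ρ₅ _ (ρ₄ _ (ρ₃ _ (ρ₂ _ (f i))))))
      fun i N _ e => e Srt.K (t i)) ?_).congr fun N _ e =>
        iff_of_eq (congrArg (FieldHolds ψ (K N)) ?_)
    · rintro (a | b) <;> exact TDef.var _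
    · ext (a | b) <;> rfl
  · exact Def.eq (TDef.vsum _ fun i => TDef.ev_boxPoly (fun μ => TDef.var _) (TDef.var _))
      TDef.vzero
  · exact Def.eq (TDef.ev_boxPoly (fun μ => TDef.var _) (TDef.var _)) (TDef.var _)
  · exact Def.eq (TDef.vsum _ fun l => TDef.vsmul (TDef.var _) (TDef.var _))
      (TDef.ev_boxPoly (fun μ => TDef.var _) (TDef.var _))

lemma exists_forall_mem_box_fin {F : Type*} [Field F] {m k : ℕ} (f : Fin m → MvPolynomial (Fin n) F)
    (g : Fin k → MvPolynomial (Fin n) F) :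
    ∃ d, (∀ i, f i ∈ (box n F).B d) ∧ ∀ j, g j ∈ (box n F).B d := by
  have h (p : MvPolynomial (Fin n) F) : p ∈ (box n F).B p.totalDegree := by
    rw [mem_box]
    intro s hs i
    exact (Finsupp.le_degree i s).trans
      (Finset.le_sup (f := fun s : Fin n →₀ ℕ => s.sum fun _ e => e)
        (MvPolynomial.mem_support_iff.2 hs))
  refine ⟨max (Finset.univ.sup fun i => (f i).totalDegree)
    (Finset.univ.sup fun i => (g i).totalDegree), fun i => (box n F).mono ?_ (h _),
    fun i => (box n F).mono ?_ (h _)⟩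
  · exact le_max_of_le_left (Finset.le_sup (f := fun i => (f i).totalDegree) (Finset.mem_univ i))
  · exact le_max_of_le_right (Finset.le_sup (f := fun i => (g i).totalDegree) (Finset.mem_univ i))

/-- The degree bounds replace ideal membership by its bounded version, and all syzygies by a
generating set of bounded ones. Field elimination then turns both into quantifier free formulas. -/
lemma exists_solvableWith (I : Ideal (MvPolynomial (Fin n) ℤ)) (m d : ℕ) :
    ∃ (D : ℕ) (φ : fieldLang.Formula ((Fin m × Box n d) ⊕ Box n d))
      (ψ : fieldLang.Formula ((Fin m × Box n d) ⊕ (Fin m × Box n D))), φ.IsQF ∧ ψ.IsQF ∧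
      ∀ (N : Str.{u} (lang n)) [BMdl N], IsAlgClosed (K N) → ∀ k r, (SolvableWith φ ψ k r N ↔
        ∀ (f : Fin m × Box n d → K N) (g : Fin k × Box n d → K N) (v : Fin m → M N)
          (u : Fin r → M N),
          (∀ j, (boxPoly fun μ => g (j, μ)) ∉
            Ideal.span (Set.range fun i => boxPoly fun μ => f (i, μ)) ⊔ extIdeal (K N) I) →
          (∀ t : Fin m → MvPolynomial (Fin n) (K N),
            ∑ i, t i * (boxPoly fun μ => f (i, μ)) ∈ extIdeal (K N) I →
              ∑ i, ev N (t i) (v i) = 0) →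
          ∃ x : M N, (∀ i, ev N (boxPoly fun μ => f (i, μ)) x = v i) ∧
            ∀ j, ev N (boxPoly fun μ => g (j, μ)) x ∉ Submodule.span (K N) (Set.range u)) := by
  obtain ⟨q, p, hp⟩ := Submodule.fg_iff_exists_fin_generating_family.1
    ((isNoetherianRing_iff_ideal_fg _).1 inferInstance I)
  change Ideal.span (Set.range p) = I at hp
  obtain ⟨D, hD⟩ := exists_uniform_bound.{u} p (Fin m) d
  obtain ⟨φ, hφ, hφ'⟩ := (FD.member.{u} (m := m) p d D).exists_formula
  obtain ⟨ψ, hψ, hψ'⟩ := (FD.syzygy.{u} (m := m) p d D).exists_formula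
  refine ⟨D, φ, ψ, hφ, hψ, fun N _ _ k r => ?_⟩
  rw [hp] at hD
  have hpI (s : Fin q → MvPolynomial (Fin n) (K N)) :
      ∑ j, s j * map (Int.castRingHom (K N)) (p j) ∈ extIdeal (K N) I :=
    sum_mem fun j _ => Ideal.mul_mem_left _ _ (Ideal.mem_map_of_mem _ (by
      rw [← hp]
      exact Ideal.subset_span ⟨j, rfl⟩))
  refine forall_congr' fun f => forall_congr' fun g => forall_congr' fun v => forall_congr' fun w =>
    imp_congr (forall_congr' fun j => not_congr ?_) (imp_congr ?_ (exists_congr fun x =>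
      and_congr_right fun _ => forall_congr' fun j => not_congr ?_))
  · rw [hφ']
    simp only [Sum.elim_inl, Sum.elim_inr]
    constructor
    · rintro ⟨y, hy⟩
      rw [← hy]
      exact add_mem (Ideal.mem_sup_left (sum_mem fun i _ => Ideal.mul_mem_left _ _
        (Ideal.subset_span ⟨i, rfl⟩))) (Ideal.mem_sup_right (hpI _))
    · intro h
      obtain ⟨t, s, ht, hs, hts⟩ := (hD (K N) _ fun i => boxPoly_mem _).1 _ (boxPoly_mem _) h
      refine ⟨Sum.elim (fun iμ => boxCoeff D (t iμ.1) iμ.2) fun jμ => boxCoeff D (s jμ.1) jμ.2, ?_⟩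
      simp only [Sum.elim_inl, Sum.elim_inr]
      simp only [fun i => boxPoly_boxCoeff (ht i), fun i => boxPoly_boxCoeff (hs i)]
      exact hts
  · simp only [hψ', Sum.elim_inl, Sum.elim_inr]
    constructor
    · intro h t ht
      obtain ⟨l, c, τ, s, h1, h2, h3, h4⟩ := (hD (K N) _ fun i => boxPoly_mem _).2 t ht
      have h5 (a) : ∑ i, ev N (τ a i) (v i) = 0 := by
        have := h (fun iμ => boxCoeff D (τ a iμ.1) iμ.2) ⟨fun jμ => boxCoeff D (s a jμ.1) jμ.2, by
          simp only [fun i => boxPoly_boxCoeff (h1 a i), fun i => boxPoly_boxCoeff (h2 a i)]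
          exact h3 a⟩
        simpa only [fun i => boxPoly_boxCoeff (h1 a i)] using this
      simp only [h4, map_sum, map_mul, LinearMap.sum_apply, Module.End.mul_apply]
      rw [Finset.sum_comm]
      refine Finset.sum_eq_zero fun a _ => ?_
      rw [← map_sum, h5, map_zero]
    · rintro h t ⟨y, hy⟩
      refine h _ ?_
      rw [eq_neg_of_add_eq_zero_left hy]
      exact neg_mem (hpI _)
  · rw [Submodule.mem_span_range_iff_exists_fun]

variable {I : Ideal (MvPolynomial (Fin n) ℤ)} {P : Str.{u} (lang n) → Prop}

/-- Any given polynomials have some common degree bound, so solvability is the conjunction of its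
bounded instances, each of which is a sentence over algebraically closed fields. -/
lemma isSolvable_of_models (hP : ∀ N, P N → ∃ _ : BMdl N, Good I N)
    {N : Str.{u} (lang n)} (hN : N.Models (thyOf P)) [c : BMdl N] :
    IsSolvable (ev N) (extIdeal (K N) I) := by
  have hac : IsAlgClosed (K N) := isAlgClosed_of_models (fun N hN => by
    obtain ⟨b, h⟩ := hP N hN
    exact ⟨b, h.isAlgClosed⟩) hN
  intro m k r f g v w
  obtain ⟨d, hf, hg⟩ := exists_forall_mem_box_fin f g
  obtain ⟨D, φ, ψ, hφ, hψ, h⟩ := exists_solvableWith.{u} I m d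
  have key := (h N hac k r).1 <| Def.of_models (def_solvableWith hφ hψ k r) (fun N hN => by
    obtain ⟨b, hb⟩ := hP N hN
    exact ⟨b, (h N hb.isAlgClosed k r).2 fun f g v u => hb.isSolvable m k r _ _ v u⟩) hN c
  have := key (fun iμ => boxCoeff d (f iμ.1) iμ.2) (fun iμ => boxCoeff d (g iμ.1) iμ.2) v w
  simp only [fun i => boxPoly_boxCoeff (hf i), fun i => boxPoly_boxCoeff (hg i)] at this
  exact this

end Solvability

/-- The models of `𝔗_I` with an algebraically closed field that satisfy the solvability
condition. -/
def IsCompleteModel {n : ℕ} (I : Ideal (MvPolynomial (Fin n) ℤ)) (N : Str.{u} (lang n)) : Prop :=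
  ∃ d : TModel I N, d.AlgClosed ∧ d.Solvable

lemma IsCompleteModel.exists_good {n : ℕ} {I : Ideal (MvPolynomial (Fin n) ℤ)}
    {N : Str.{u} (lang n)} (h : IsCompleteModel I N) : ∃ _ : BMdl N, Good I N := by
  obtain ⟨d, h₁, h₂⟩ := h
  exact ⟨d.toBMdl, d.good h₁ h₂⟩

lemma nonempty_tModel_of_models {n : ℕ} {I : Ideal (MvPolynomial (Fin n) ℤ)}
    {N : Str.{u} (lang n)}
    (hN : N.Models (thyOf fun N : Str.{u} (lang n) => Nonempty (TModel I N))) :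
    Nonempty (TModel I N) := by
  have hP (N : Str.{u} (lang n)) (h : Nonempty (TModel I N)) : ∃ _ : BMdl N, TProps I N := by
    obtain ⟨d⟩ := h
    exact ⟨d.toBMdl, d.tprops⟩
  have hraw : RawAxioms N := Def.of_models def_rawAxioms (fun N hN => by
    obtain ⟨b, -⟩ := hP N hN
    exact ⟨⟨⟩, rawAxioms N⟩) hN ⟨⟩
  obtain ⟨b⟩ := hraw.exists_bMdl
  exact ⟨(tProps_of_models hP hN).toTModel⟩

end GrassModule

/-- The theories are those of the two classes. The smaller class has the larger theory, and every
model of it carries the data required by `exists_isQF`. -/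
theorem mainTheorem2 (n : ℕ) (I : Ideal (MvPolynomial (Fin n) ℤ)) :
    ∃ T T' : MSLanguage.Thy (GrassModule.lang n),
      (∀ N : MSLanguage.Str.{u} (GrassModule.lang n),
        N.Models T ↔ Nonempty (GrassModule.TModel I N)) ∧
      T ⊆ T' ∧
      (∀ N : MSLanguage.Str.{u} (GrassModule.lang n),
        N.Models T' ↔ ∃ d : GrassModule.TModel I N, d.AlgClosed ∧ d.Solvable) ∧
      MSLanguage.Thy.EliminatesQuantifiers.{u} T' := by
  have hsub : GrassModule.thyOf (fun N : MSLanguage.Str.{u} (GrassModule.lang n) =>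
      Nonempty (GrassModule.TModel I N)) ⊆ GrassModule.thyOf (GrassModule.IsCompleteModel I) :=
    fun σ hσ N ⟨d, _⟩ => hσ N ⟨d⟩
  have hmodels (N : MSLanguage.Str.{u} (GrassModule.lang n)) :
      N.Models (GrassModule.thyOf (GrassModule.IsCompleteModel I)) ↔
        GrassModule.IsCompleteModel I N := by
    refine ⟨fun hN => ?_, fun h σ hσ => hσ N h⟩
    -- A model of the larger theory is first recognized as a model of $\mathfrak T$, which supplies
    -- the field and the module needed to express the other two conditions.
    obtain ⟨d⟩ := GrassModule.nonempty_tModel_of_models (I := I) fun σ hσ => hN σ (hsub hσ)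
    let _ := d.toBMdl
    exact ⟨d, GrassModule.isAlgClosed_of_models (fun N h => by
      obtain ⟨b, h⟩ := h.exists_good
      exact ⟨b, h.isAlgClosed⟩) hN, d.solvable_iff.2 <|
        GrassModule.isSolvable_of_models (fun N h => h.exists_good) hN⟩
  refine ⟨_, _, fun N => ⟨GrassModule.nonempty_tModel_of_models, fun h σ hσ => hσ N h⟩, hsub,
    hmodels, fun Γ φ => ?_⟩
  obtain ⟨ψ, hψ, h⟩ := GrassModule.exists_isQF.{u} (I := I) φ
  refine ⟨ψ, hψ, fun N hN e => ?_⟩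
  obtain ⟨b, hb⟩ := ((hmodels N).1 hN).exists_good
  exact h N hb e
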